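/- Let $\mathcal L$ be the twisted Heisenberg–Virasoro algebra, i.e. the complex Lie algebra with basis $L(m), I(m)$ $(m\in\mathbb Z)$, $C_L, C_I, C_{LI}$ and brackets $[L(m),L(n)]=(n-m)L(m+n)+\delta_{m+n,0}\frac{m^3-m}{12}C_L$, $[I(m),I(n)]=n\,\delta_{m+n,0}C_I$, $[L(m),I(n)]=nI(m+n)+\delta_{m+n,0}(m^2-m)C_{LI}$, with $C_L,C_I,C_{LI}$ central. A Harish-Chandra module over $\mathcal L$ is a nonzero indecomposable $\mathcal L$-module $V$ that is the direct sum of the eigenspaces (weight spaces) of $L(0)$, all of them finite-dimensional. It is of the intermediate series if moreover $\mathcal L$ does not act by zero and every weight space is at most one-dimensional. Consider the following modules, each with basis $v_t$ $(t\in\mathbb Z)$ and with $C_L,C_I,C_{LI}$ acting by $0$: 1. $\mathcal A_{a,b,c}$ $(a,b,c\in\mathbb C)$: $L(n)v_t=(a+t+bn)v_{n+t}$, $I(n)v_t=cv_{n+t}$. 2. $\mathcal A(a,d)$ $(a,d\in\mathbb C)$: $L(n)v_t=(t+n)v_{n+t}$ and $I(n)v_t=0$ if $t\ne0$; $L(n)v_0=n(n+a)v_n$,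 $I(n)v_0=dn\,v_n$. 3. $\mathcal B(a,d)$ $(a,d\in\mathbb C)$: $L(n)v_t=tv_{n+t}$ and $I(n)v_t=0$ if $n+t\ne0$; $L(n)v_{-n}=-n(n+a)v_0$, $I(n)v_{-n}=dn\,v_0$. 4. $\mathcal U_d$ $(d\in\mathbb C)$: $L(n)v_t=tv_{n+t}$; $I(n)v_t=0$ if $n+t\ne0$, $I(n)v_{-n}=nd\,v_0$. 5. $\mathcal V_d$ $(d\in\mathbb C)$: $L(n)v_t=(t+n)v_{n+t}$; $I(n)v_t=0$ if $t\ne0$, $I(n)v_0=nd\,v_n$. 6. $\tilde{\mathcal U}_d$ $(d\in\mathbb C\setminus\{0\})$: $L(n)v_t=tv_{n+t}$ and $I(n)v_t=0$ if $n+t\neq0$; $L(n)v_{-n}=0$, $I(n)v_{-n}=dn\,v_0$. 7. $\tilde{\mathcal V}_c$ $(c\in\mathbb C\setminus\{0\})$: $L(n)v_t=tv_{n+t}$ if $n+t\ne0$, $L(n)v_{-n}=0$; $I(n)v_0=cv_n$ if $n\ne0$, and $I(n)v_t=0$ if $t\ne0$ or $n=t=0$. Let $V$ be a Harish-Chandra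 module of the intermediate series over $\mathcal L$. If $V$ is irreducible, then $V$ is isomorphic to an irreducible module among the modules 1–7, or to a nontrivial simple subquotient of one of the modules 1–7 (a subquotient is $N/P$ with $P\subseteq N$ submodules; nontrivial means that $\mathcal L$ does not act by zero). If $V$ is not irreducible, then $V$ is isomorphic to one of the modules 1–7. -/

import Mathlib

noncomputable section

namespace TwistedHV

/-- Indices of the standard basis `L(m), I(m), C_L, C_I, C_{LI}` (`m ∈ ℤ`). -/
inductive Gen : Type
  | L (m : ℤ)
  | I (m : ℤ)
  | CL
  | CI
  | CLI

/-- The twisted Heisenberg–Virasoro algebra over `ℂ`: the complex vector space with basis `Gen`. -/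
def Alg : Type := Gen →₀ ℂ

instance : AddCommGroup Alg := inferInstanceAs (AddCommGroup (Gen →₀ ℂ))
instance : Module ℂ Alg := inferInstanceAs (Module ℂ (Gen →₀ ℂ))

/-- `z` times the basis vector with index `g`. -/
def mono (g : Gen) (z : ℂ) : Alg := Finsupp.single g z

/-- The defining brackets of basis vectors. -/
def bracketGen : Gen → Gen → Alg
  | .L m, .L n => mono (.L (m + n)) ((n : ℂ) - m)
      + mono .CL (if m + n = 0 then ((m : ℂ) ^ 3 - m) / 12 else 0)
  | .I m, .I n => mono .CI (if m + n = 0 then (n : ℂ) else 0)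
  | .L m, .I n => mono (.I (m + n)) (n : ℂ)
      + mono .CLI (if m + n = 0 then (m : ℂ) ^ 2 - m else 0)
  | .I n, .L m => -(mono (.I (m + n)) (n : ℂ)
      + mono .CLI (if m + n = 0 then (m : ℂ) ^ 2 - m else 0))
  | _, _ => 0

/-- The bilinear extension of `bracketGen`. -/
def bracketHom : Alg →ₗ[ℂ] Alg →ₗ[ℂ] Alg :=
  Finsupp.linearCombination ℂ fun x : Gen =>
    (Finsupp.linearCombination ℂ (bracketGen x) : (Gen →₀ ℂ) →ₗ[ℂ] Alg)

instance : Bracket Alg Alg := ⟨fun x y => bracketHom x y⟩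

theorem lie_def (x y : Alg) : ⁅x, y⁆ = bracketHom x y := rfl

theorem lie_mono (x y : Gen) (a b : ℂ) : ⁅mono x a, mono y b⁆ = (a * b) • bracketGen x y := by
  have h : bracketHom (mono x a)
      = a • (Finsupp.linearCombination ℂ (bracketGen x) : (Gen →₀ ℂ) →ₗ[ℂ] Alg) :=
    Finsupp.linearCombination_single ℂ a x
  have h' : (Finsupp.linearCombination ℂ (bracketGen x) : (Gen →₀ ℂ) →ₗ[ℂ] Alg)
      (Finsupp.single y b) = b • bracketGen x y :=
    Finsupp.linearCombination_single ℂ b y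
  have h'' : bracketHom (mono x a) (mono y b) = a • (b • bracketGen x y) := by
    rw [h, ← h']; rfl
  rw [lie_def, h'', smul_smul]

theorem smul_mono (a b : ℂ) (x : Gen) : a • mono x b = mono x (a * b) :=
  Finsupp.smul_single a x b

theorem mono_add (x : Gen) (a b : ℂ) : mono x (a + b) = mono x a + mono x b :=
  Finsupp.single_add x a b

theorem mono_zero (x : Gen) : mono x 0 = 0 := Finsupp.single_zero x

theorem mono_neg (x : Gen) (a : ℂ) : mono x (-a) = -mono x a := Finsupp.single_neg x a

theorem alg_induction {p : Alg → Prop} (x : Alg) (h0 : p 0)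
    (ha : ∀ x y, p x → p y → p (x + y)) (hs : ∀ g z, p (mono g z)) : p x :=
  Finsupp.induction_linear x h0 ha hs

theorem add_lie' (x y z : Alg) : ⁅x + y, z⁆ = ⁅x, z⁆ + ⁅y, z⁆ := by simp [lie_def]
theorem lie_add' (x y z : Alg) : ⁅x, y + z⁆ = ⁅x, y⁆ + ⁅x, z⁆ := by simp [lie_def]
theorem zero_lie' (z : Alg) : ⁅(0 : Alg), z⁆ = 0 := by simp [lie_def]
theorem lie_zero' (z : Alg) : ⁅z, (0 : Alg)⁆ = 0 := by simp [lie_def]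
theorem smul_lie' (a : ℂ) (x z : Alg) : ⁅a • x, z⁆ = a • ⁅x, z⁆ := by simp [lie_def]
theorem lie_smul' (a : ℂ) (x z : Alg) : ⁅x, a • z⁆ = a • ⁅x, z⁆ := by simp [lie_def]
theorem neg_lie' (x z : Alg) : ⁅-x, z⁆ = -⁅x, z⁆ := by simp [lie_def]
theorem lie_neg' (x z : Alg) : ⁅x, -z⁆ = -⁅x, z⁆ := by simp [lie_def]

theorem bracketGen_antisymm (x y : Gen) : bracketGen x y = -bracketGen y x := by
  rcases x with m | m | _ | _ | _ <;> rcases y with n | n | _ | _ | _ <;>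
    simp only [bracketGen, neg_zero, neg_neg, neg_add_rev, ← mono_neg]
  · rw [add_comm n m, add_comm (mono Gen.CL _)]
    congr 2
    · ring
    · split_ifs with h
      · obtain rfl : n = -m := by lia
        push_cast; ring
      · simp
  · rw [add_comm n m]
    congr 1
    split_ifs with h
    · obtain rfl : n = -m := by lia
      simp
    · simp

theorem lie_antisymm (x y : Alg) : ⁅x, y⁆ = -⁅y, x⁆ := by
  induction x using alg_induction with
  | h0 => simp [zero_lie', lie_zero']
  | ha a b h1 h2 => rw [add_lie', lie_add', h1, h2, neg_add]
  | hs g z =>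
    induction y using alg_induction with
    | h0 => simp [zero_lie', lie_zero']
    | ha a b h1 h2 => rw [add_lie', lie_add', h1, h2, neg_add]
    | hs g' z' => rw [lie_mono, lie_mono, bracketGen_antisymm g g', mul_comm, smul_neg]

set_option linter.unusedSimpArgs false in
theorem jacobi_gen (x y z : Gen) (a b c : ℂ) :
    ⁅mono x a, ⁅mono y b, mono z c⁆⁆
      = ⁅⁅mono x a, mono y b⁆, mono z c⁆ + ⁅mono y b, ⁅mono x a, mono z c⁆⁆ := by
  rcases x with l | l | _ | _ | _ <;> rcases y with m | m | _ | _ | _ <;>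
    rcases z with n | n | _ | _ | _ <;>
    simp only [lie_mono, bracketGen, lie_smul', smul_lie', lie_add', add_lie', lie_neg', neg_lie',
      lie_zero', zero_lie', smul_zero, smul_add, smul_neg, smul_mono, add_zero, zero_add, neg_zero,
      mul_zero, zero_mul, neg_neg, neg_add_rev]
  · rw [show m + (l + n) = l + (m + n) by ring, show l + m + n = l + (m + n) by ring]
    by_cases h : l + (m + n) = 0
    · obtain rfl : l = -(m + n) := by lia
      simp only [h, if_true]
      rw [add_add_add_comm, ← mono_add, ← mono_add]
      congr 2 <;> push_cast <;> ring
    · simp only [h, if_false, mul_zero, mono_zero, add_zero]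
      rw [← mono_add]
      congr 1; push_cast; ring
  · rw [show m + (l + n) = l + (m + n) by ring, show l + m + n = l + (m + n) by ring]
    by_cases h : l + (m + n) = 0
    · obtain rfl : l = -(m + n) := by lia
      simp only [h, if_true]
      rw [add_add_add_comm, ← mono_add, ← mono_add]
      congr 2 <;> push_cast <;> ring
    · simp only [h, if_false, mul_zero, mono_zero, add_zero]
      rw [← mono_add]
      congr 1; push_cast; ring
  · rw [show n + (l + m) = l + (n + m) by ring, show l + n + m = l + (n + m) by ring]
    simp only [← mono_neg]
    rw [add_add_add_comm, ← mono_add, ← mono_add]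
    by_cases h : l + (n + m) = 0
    · obtain rfl : l = -(n + m) := by lia
      simp only [h, if_true]
      congr 2 <;> push_cast <;> ring
    · simp only [h, if_false, mul_zero, neg_zero, mono_zero, zero_add, add_zero]
      congr 1; push_cast; ring
  · rw [show m + (l + n) = l + m + n by ring, ← mono_add]
    by_cases h : l + m + n = 0
    · obtain rfl : l = -(m + n) := by lia
      simp only [h, if_true]
      rw [← mono_zero Gen.CI]
      congr 1; push_cast; ring
    · simp [h, mono_zero]
  · rw [show n + (m + l) = m + n + l by ring, show m + (n + l) = m + n + l by ring]
    simp only [← mono_neg]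
    rw [add_comm (mono (Gen.I _) (a * b * l * c * _)), add_add_add_comm, ← mono_add, ← mono_add]
    by_cases h : m + n + l = 0
    · obtain rfl : l = -(m + n) := by lia
      simp only [h, if_true]
      congr 2 <;> push_cast <;> ring
    · simp only [h, if_false, mul_zero, neg_zero, mono_zero, zero_add, add_zero]
      congr 1; push_cast; ring
  · rw [show m + l + n = l + (m + n) by ring, ← mono_neg]
    by_cases h : l + (m + n) = 0
    · obtain rfl : l = -(m + n) := by lia
      simp only [h, if_true]
      congr 1; push_cast; ring
    · simp [h, mono_zero]
  · rw [show m + (n + l) = l + (n + m) by ring]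
    by_cases h : l + (n + m) = 0
    · obtain rfl : l = -(n + m) := by lia
      simp only [h, if_true]
      congr 2; push_cast; ring
    · simp [h, mono_zero]

theorem jacobi (x y z : Alg) : ⁅x, ⁅y, z⁆⁆ = ⁅⁅x, y⁆, z⁆ + ⁅y, ⁅x, z⁆⁆ := by
  induction x using alg_induction with
  | h0 => simp [zero_lie', lie_zero']
  | ha a b h1 h2 => simp only [add_lie', lie_add', h1, h2]; abel
  | hs g u =>
    induction y using alg_induction with
    | h0 => simp [zero_lie', lie_zero']
    | ha a b h1 h2 => simp only [add_lie', lie_add', h1, h2]; abel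
    | hs g' u' =>
      induction z using alg_induction with
      | h0 => simp [lie_zero']
      | ha a b h1 h2 => simp only [lie_add', h1, h2]; abel
      | hs g'' u'' => exact jacobi_gen g g' g'' u u' u''

instance : LieRing Alg where
  add_lie := add_lie'
  lie_add := lie_add'
  lie_self x := by
    have h := lie_antisymm x x
    have h2 : (2 : ℂ) • ⁅x, x⁆ = 0 := by rw [two_smul]; nth_rewrite 1 [h]; simp
    exact (smul_eq_zero.mp h2).resolve_left two_ne_zero
  leibniz_lie := jacobi

instance : LieAlgebra ℂ Alg where
  lie_smul := lie_smul'

/-- Structure constants of a `ℤ`-graded module with basis `v_t` (`t ∈ ℤ`) on which the centre acts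
by zero: `L(n) v_t = ℓ n t • v_{n+t}` and `I(n) v_t = f n t • v_{n+t}`, together with the identities
saying that this is a module. -/
structure Coeffs where
  ℓ : ℤ → ℤ → ℂ
  f : ℤ → ℤ → ℂ
  LL : ∀ m n t, ℓ m (n + t) * ℓ n t - ℓ n (m + t) * ℓ m t = ((n : ℂ) - m) * ℓ (m + n) t
  LI : ∀ m n t, ℓ m (n + t) * f n t - f n (m + t) * ℓ m t = (n : ℂ) * f (m + n) t
  II : ∀ m n t, f m (n + t) * f n t = f n (m + t) * f m t

/-- The vector space with basis `v_t`, `t ∈ ℤ`, underlying the module given by `C`. -/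
def Mod (_C : Coeffs) : Type := ℤ →₀ ℂ

section

variable (C : Coeffs)

instance : AddCommGroup (Mod C) := inferInstanceAs (AddCommGroup (ℤ →₀ ℂ))
instance : Module ℂ (Mod C) := inferInstanceAs (Module ℂ (ℤ →₀ ℂ))

/-- `z • v_t`. -/
def vec (t : ℤ) (z : ℂ) : Mod C := Finsupp.single t z

/-- The action of a basis element of the algebra on `v_t`. -/
def actGen : Gen → ℤ → Mod C
  | .L n, t => vec C (n + t) (C.ℓ n t)
  | .I n, t => vec C (n + t) (C.f n t)
  | .CL, _ => 0
  | .CI, _ => 0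
  | .CLI, _ => 0

/-- The bilinear extension of `actGen`. -/
def actHom : Alg →ₗ[ℂ] Mod C →ₗ[ℂ] Mod C :=
  Finsupp.linearCombination ℂ fun x : Gen =>
    (Finsupp.linearCombination ℂ (actGen C x) : (ℤ →₀ ℂ) →ₗ[ℂ] Mod C)

instance : Bracket Alg (Mod C) := ⟨fun x v => actHom C x v⟩

theorem act_def (x : Alg) (v : Mod C) : ⁅x, v⁆ = actHom C x v := rfl

theorem act_mono (x : Gen) (t : ℤ) (a b : ℂ) : ⁅mono x a, vec C t b⁆ = (a * b) • actGen C x t := by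
  have h : actHom C (mono x a)
      = a • (Finsupp.linearCombination ℂ (actGen C x) : (ℤ →₀ ℂ) →ₗ[ℂ] Mod C) :=
    Finsupp.linearCombination_single ℂ a x
  have h' : (Finsupp.linearCombination ℂ (actGen C x) : (ℤ →₀ ℂ) →ₗ[ℂ] Mod C)
      (Finsupp.single t b) = b • actGen C x t :=
    Finsupp.linearCombination_single ℂ b t
  have h'' : actHom C (mono x a) (vec C t b) = a • (b • actGen C x t) := by
    rw [h, ← h']; rfl
  rw [act_def, h'', smul_smul]

theorem smul_vec (a b : ℂ) (t : ℤ) : a • vec C t b = vec C t (a * b) :=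
  Finsupp.smul_single a t b

theorem vec_add (t : ℤ) (a b : ℂ) : vec C t (a + b) = vec C t a + vec C t b :=
  Finsupp.single_add t a b

theorem vec_zero (t : ℤ) : vec C t 0 = 0 := Finsupp.single_zero t

theorem vec_neg (t : ℤ) (a : ℂ) : vec C t (-a) = -vec C t a := Finsupp.single_neg t a

theorem mod_induction {p : Mod C → Prop} (x : Mod C) (h0 : p 0)
    (ha : ∀ x y, p x → p y → p (x + y)) (hs : ∀ t z, p (vec C t z)) : p x :=
  Finsupp.induction_linear x h0 ha hs

theorem add_act (x y : Alg) (v : Mod C) : ⁅x + y, v⁆ = ⁅x, v⁆ + ⁅y, v⁆ := by simp [act_def]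
theorem act_add (x : Alg) (v w : Mod C) : ⁅x, v + w⁆ = ⁅x, v⁆ + ⁅x, w⁆ := by simp [act_def]
theorem zero_act (v : Mod C) : ⁅(0 : Alg), v⁆ = 0 := by simp [act_def]
theorem act_zero (x : Alg) : ⁅x, (0 : Mod C)⁆ = 0 := by simp [act_def]
theorem smul_act (a : ℂ) (x : Alg) (v : Mod C) : ⁅a • x, v⁆ = a • ⁅x, v⁆ := by simp [act_def]
theorem act_smul (a : ℂ) (x : Alg) (v : Mod C) : ⁅x, a • v⁆ = a • ⁅x, v⁆ := by simp [act_def]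
theorem neg_act (x : Alg) (v : Mod C) : ⁅-x, v⁆ = -⁅x, v⁆ := by simp [act_def]

set_option linter.unusedSimpArgs false in
theorem leibniz_gen (x y : Gen) (t : ℤ) (a b c : ℂ) :
    ⁅mono x a, ⁅mono y b, vec C t c⁆⁆
      = ⁅⁅mono x a, mono y b⁆, vec C t c⁆ + ⁅mono y b, ⁅mono x a, vec C t c⁆⁆ := by
  rcases x with l | l | _ | _ | _ <;> rcases y with m | m | _ | _ | _ <;>
    simp only [lie_mono, act_mono, bracketGen, actGen, act_smul, smul_act, add_act, neg_act,
      act_zero, zero_act, smul_zero, smul_add, smul_neg, smul_mono, smul_vec, add_zero, zero_add,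
      neg_zero, mul_zero, zero_mul]
  · rw [show m + (l + t) = l + (m + t) by ring, show l + m + t = l + (m + t) by ring, ← vec_add]
    congr 1
    linear_combination a * b * c * C.LL l m t
  · rw [show m + (l + t) = l + (m + t) by ring, show l + m + t = l + (m + t) by ring, ← vec_add]
    congr 1
    linear_combination a * b * c * C.LI l m t
  · rw [show m + (l + t) = l + (m + t) by ring, show m + l + t = l + (m + t) by ring, ← vec_neg,
      ← vec_add]
    congr 1
    linear_combination -(a * b * c) * C.LI m l t
  · rw [show m + (l + t) = l + (m + t) by ring]
    congr 1
    linear_combination a * b * c * C.II l m t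

instance : LieRingModule Alg (Mod C) where
  add_lie := add_act C
  lie_add := act_add C
  leibniz_lie x y v := by
    induction x using alg_induction with
    | h0 => simp [zero_act, act_zero]
    | ha a b h1 h2 => simp only [add_act, act_add, add_lie, h1, h2]; abel
    | hs g u =>
      induction y using alg_induction with
      | h0 => simp [zero_act, act_zero]
      | ha a b h1 h2 => simp only [add_act, act_add, lie_add, h1, h2]; abel
      | hs g' u' =>
        induction v using mod_induction C with
        | h0 => simp [act_zero]
        | ha a b h1 h2 => simp only [act_add, h1, h2]; abel
        | hs t u'' => exact leibniz_gen C g g' t u u' u''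

instance : LieModule ℂ Alg (Mod C) where
  smul_lie a x v := by simp [act_def]
  lie_smul a x v := by simp [act_def]

end

theorem cast_cases (m n t : ℤ) :
    (n + t = 0 → (t : ℂ) = -n) ∧ (m + t = 0 → (t : ℂ) = -m) ∧
      (m + n + t = 0 → (t : ℂ) = -m - n) ∧ (t = 0 → (t : ℂ) = 0) := by
  refine ⟨fun h => ?_, fun h => ?_, fun h => ?_, fun h => ?_⟩
  · obtain rfl : t = -n := by lia
    simp
  · obtain rfl : t = -m := by lia
    simp
  · obtain rfl : t = -m - n := by lia
    simp
  · simp [h]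

/-- `A_{a,b,c}`: `L(n) v_t = (a+t+bn) v_{n+t}`, `I(n) v_t = c v_{n+t}`. -/
def coeffsA (a b c : ℂ) : Coeffs where
  ℓ n t := a + t + b * n
  f _ _ := c
  LL m n t := by push_cast; ring
  LI m n t := by push_cast; ring
  II m n t := rfl

/-- `A(a, d)`: `L(n) v_t = (t+n) v_{n+t}` and `I(n) v_t = 0` for `t ≠ 0`,
`L(n) v_0 = n(n+a) v_n`, `I(n) v_0 = d n v_n`. -/
def coeffsA' (a d : ℂ) : Coeffs where
  ℓ n t := if t = 0 then n * (n + a) else t + n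
  f n t := if t = 0 then d * n else 0
  LL m n t := by
    obtain ⟨h1, h2, h3, h4⟩ := cast_cases m n t
    push_cast
    by_cases e1 : n + t = 0 <;> by_cases e2 : m + t = 0 <;> by_cases e3 : m + n + t = 0 <;>
      by_cases e4 : t = 0 <;> simp only [e1, e2, e3, e4, if_true, if_false] at * <;>
      first | lia | grind
  LI m n t := by
    obtain ⟨h1, h2, h3, h4⟩ := cast_cases m n t
    push_cast
    grind
  II m n t := by
    obtain ⟨h1, h2, h3, h4⟩ := cast_cases m n t
    push_cast
    grind

/-- `B(a, d)`: `L(n) v_t = t v_{n+t}` and `I(n) v_t = 0` for `t ≠ -n`,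
`L(n) v_{-n} = -n(n+a) v_0`, `I(n) v_{-n} = d n v_0`. -/
def coeffsB (a d : ℂ) : Coeffs where
  ℓ n t := if n + t = 0 then -n * (n + a) else t
  f n t := if n + t = 0 then d * n else 0
  LL m n t := by
    obtain ⟨h1, h2, h3, h4⟩ := cast_cases m n t
    simp only [add_left_comm n m t, ← add_assoc m n t]
    push_cast
    by_cases e1 : n + t = 0 <;> by_cases e2 : m + t = 0 <;> by_cases e3 : m + n + t = 0 <;>
      by_cases e4 : t = 0 <;> simp only [e1, e2, e3, e4, if_true, if_false] at * <;>
      first | lia | grind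
  LI m n t := by
    obtain ⟨h1, h2, h3, h4⟩ := cast_cases m n t
    simp only [add_left_comm n m t, ← add_assoc m n t]
    push_cast
    by_cases e1 : n + t = 0 <;> by_cases e2 : m + t = 0 <;> by_cases e3 : m + n + t = 0 <;>
      by_cases e4 : t = 0 <;> simp only [e1, e2, e3, e4, if_true, if_false] at * <;>
      first | lia | grind
  II m n t := by
    obtain ⟨h1, h2, h3, h4⟩ := cast_cases m n t
    push_cast
    grind

/-- `U_d`: `L(n) v_t = t v_{n+t}`, `I(n) v_t = 0` for `n + t ≠ 0`, `I(n) v_{-n} = n d v_0`. -/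
def coeffsU (d : ℂ) : Coeffs where
  ℓ _ t := t
  f n t := if n + t = 0 then n * d else 0
  LL m n t := by
    obtain ⟨h1, h2, h3, h4⟩ := cast_cases m n t
    push_cast
    grind
  LI m n t := by
    obtain ⟨h1, h2, h3, h4⟩ := cast_cases m n t
    simp only [add_left_comm n m t, ← add_assoc m n t]
    push_cast
    by_cases e1 : n + t = 0 <;> by_cases e2 : m + t = 0 <;> by_cases e3 : m + n + t = 0 <;>
      by_cases e4 : t = 0 <;> simp only [e1, e2, e3, e4, if_true, if_false] at * <;>
      first | lia | grind
  II m n t := by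
    obtain ⟨h1, h2, h3, h4⟩ := cast_cases m n t
    push_cast
    grind

/-- `V_d`: `L(n) v_t = (t+n) v_{n+t}`, `I(n) v_t = 0` for `t ≠ 0`, `I(n) v_0 = n d v_n`. -/
def coeffsV (d : ℂ) : Coeffs where
  ℓ n t := t + n
  f n t := if t = 0 then n * d else 0
  LL m n t := by
    obtain ⟨h1, h2, h3, h4⟩ := cast_cases m n t
    push_cast
    grind
  LI m n t := by
    obtain ⟨h1, h2, h3, h4⟩ := cast_cases m n t
    push_cast
    grind
  II m n t := by
    obtain ⟨h1, h2, h3, h4⟩ := cast_cases m n t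
    push_cast
    grind

/-- `Ũ_d`: `L(n) v_t = t v_{n+t}` and `I(n) v_t = 0` for `n + t ≠ 0`,
`L(n) v_{-n} = 0`, `I(n) v_{-n} = d n v_0`. -/
def coeffsU' (d : ℂ) : Coeffs where
  ℓ n t := if n + t = 0 then 0 else t
  f n t := if n + t = 0 then d * n else 0
  LL m n t := by
    obtain ⟨h1, h2, h3, h4⟩ := cast_cases m n t
    push_cast
    grind
  LI m n t := by
    obtain ⟨h1, h2, h3, h4⟩ := cast_cases m n t
    simp only [add_left_comm n m t, ← add_assoc m n t]
    push_cast
    by_cases e1 : n + t = 0 <;> by_cases e2 : m + t = 0 <;> by_cases e3 : m + n + t = 0 <;>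
      by_cases e4 : t = 0 <;> simp only [e1, e2, e3, e4, if_true, if_false] at * <;>
      first | lia | grind
  II m n t := by
    obtain ⟨h1, h2, h3, h4⟩ := cast_cases m n t
    push_cast
    grind

/-- `Ṽ_c`: `L(n) v_t = t v_{n+t}` for `n + t ≠ 0`, `L(n) v_{-n} = 0`,
`I(n) v_0 = c v_n` for `n ≠ 0`, and `I(n) v_t = 0` if `t ≠ 0` or `n = t = 0`. -/
def coeffsV' (c : ℂ) : Coeffs where
  ℓ n t := if n + t = 0 then 0 else t
  f n t := if t = 0 ∧ n ≠ 0 then c else 0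
  LL m n t := by
    obtain ⟨h1, h2, h3, h4⟩ := cast_cases m n t
    push_cast
    grind
  LI m n t := by
    obtain ⟨h1, h2, h3, h4⟩ := cast_cases m n t
    push_cast
    grind
  II m n t := by
    obtain ⟨h1, h2, h3, h4⟩ := cast_cases m n t
    push_cast
    grind

/-- The parameters of the seven families of modules. -/
inductive Param : Type
  | A (a b c : ℂ)
  | A' (a d : ℂ)
  | B (a d : ℂ)
  | U (d : ℂ)
  | V (d : ℂ)
  | U' (d : ℂ) (hd : d ≠ 0)
  | V' (c : ℂ) (hc : c ≠ 0)

/-- The structure constants of the module with the given parameters. -/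
def Param.coeffs : Param → Coeffs
  | .A a b c => coeffsA a b c
  | .A' a d => coeffsA' a d
  | .B a d => coeffsB a d
  | .U d => coeffsU d
  | .V d => coeffsV d
  | .U' d _ => coeffsU' d
  | .V' c _ => coeffsV' c

/-- The listed module with parameters `p`. -/
abbrev Series (p : Param) : Type := Mod p.coeffs

universe u

variable (V : Type u) [AddCommGroup V] [Module ℂ V] [LieRingModule Alg V] [LieModule ℂ Alg V]

/-- The eigenspace `{v | L(0) v = μ v}`. -/
def weightSpace (μ : ℂ) : Submodule ℂ V :=
  Module.End.eigenspace (LieModule.toEnd ℂ Alg V (mono (.L 0) 1)) μ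

/-- A weight module: the direct sum of the eigenspaces of `L(0)` (eigenspaces for different
eigenvalues are automatically independent). -/
def IsWeightModule : Prop := ⨆ μ, weightSpace V μ = ⊤

/-- Nonzero, and not the direct sum of two nonzero submodules. -/
def IsIndecomposable : Prop :=
  Nontrivial V ∧ ∀ N P : LieSubmodule ℂ Alg V, IsCompl N P → N = ⊥ ∨ P = ⊥

/-- A Harish-Chandra module: an indecomposable weight module with finite-dimensional weight
spaces. -/
def IsHarishChandra : Prop :=
  IsIndecomposable V ∧ IsWeightModule V ∧ ∀ μ, FiniteDimensional ℂ (weightSpace V μ)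

/-- A Harish-Chandra module of the intermediate series: the action is nontrivial and all weight
spaces are at most one-dimensional. -/
def IsIntermediateSeries : Prop :=
  IsHarishChandra V ∧ ¬ LieModule.IsTrivial Alg V ∧ ∀ μ, Module.rank ℂ (weightSpace V μ) ≤ 1

/-- `V` is isomorphic to a nontrivial simple subquotient `N / P` of `M`. -/
def IsNontrivialSimpleSubquotient (M : Type) [AddCommGroup M] [Module ℂ M] [LieRingModule Alg M]
    [LieModule ℂ Alg M] : Prop :=
  ∃ (N : LieSubmodule ℂ Alg M) (P : LieSubmodule ℂ Alg N),
    LieModule.IsIrreducible ℂ Alg (N ⧸ P) ∧ ¬ LieModule.IsTrivial Alg (N ⧸ P) ∧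
      Nonempty (V ≃ₗ⁅ℂ,Alg⁆ (N ⧸ P))

end TwistedHV

end

noncomputable section

namespace TwistedHV

/-! Indecomposability puts all weights in one coset `wt + ℤ` and makes `C_L`, `C_I`, `C_LI` and
`I(0)` act by scalars (`weights_of_indecomposable`, `central_scalar`). Choosing a generator of each
weight space therefore encodes the module by two functions `ℓ`, `f` on `ℤ × ℤ` satisfying the
commutator identities on a support `S` (`exists_realization`). It remains to solve these identities
up to rescaling the generators.

The Virasoro part comes first, and without assuming indecomposability (`VirSystem.classify`). If `S`
contains no ray, `sl₂`-theory leaves only a point of weight zero. On a ray, the products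
`L(-1)L(1)`, `L(-1)²L(2)` and `L(-2)L(1)²` are polynomials in the weight. Computing one product of
operators in two ways forces `c = 0` and produces the parameter `b` of a density module
(`ray_invariants`). This form propagates down the ray, and can stop only at weight zero with `b ∈
{0, 1}` (`IsDensityFrom.extend`). So the module is a density module on all of `ℤ`, or it agrees with
`A_{0,0}` away from the vector of weight zero.

Next, `I(-1)` is determined by `[L(1), I(-1)] = -I(0)` up to one constant `H`, and the `I(n)` follow
from `[L(n+1), I(-1)] = -I(n)`. For `b ≠ 0, 1` the remaining relations give `H = 0`; for `b = 0`
they give `H ∈ {0, c₀}`, and the two values correspond to `b = 0` and `b = 1` after rescaling.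

In the punctured case everything depends on the arrows into and out of `v_0`. Both Virasoro families
are given by cocycles, hence by linear functions, and one of them vanishes. If `c₀ ≠ 0` only
`A_{0,0,c}` and `A_{0,1,c}` survive. If `c₀ = 0` the surviving parameters give the families 2–7, or
a direct sum decomposition, which indecomposability forbids (`classify_extension`, `not_split`). If
`v_0` is absent, the module is the simple quotient of `A_{0,0,0}`, the only case needing a
subquotient. -/

/-- Structure constants of a weight module over the Virasoro algebra with weights in `wt + ℤ`, all
of multiplicity at most one: `S` is the support, `c` the central charge, and
`L(n) v_t = ℓ n t • v_{n+t}`. -/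
structure VirSystem where
  S : Set ℤ
  wt : ℂ
  c : ℂ
  ℓ : ℤ → ℤ → ℂ
  normalized : wt = 0 ∨ ∀ t : ℤ, wt + t ≠ 0
  source : ∀ n t, t ∉ S → ℓ n t = 0
  target : ∀ n t, n + t ∉ S → ℓ n t = 0
  zero : ∀ t ∈ S, ℓ 0 t = wt + t
  comm : ∀ m n, ∀ t ∈ S, ℓ m (n + t) * ℓ n t - ℓ n (m + t) * ℓ m t
    = ((n : ℂ) - m) * ℓ (m + n) t + if m + n = 0 then ((m : ℂ) ^ 3 - m) / 12 * c else 0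

/-! ### Virasoro systems: symmetries and supports without rays. -/

namespace VirSystem

variable (D : VirSystem)

theorem comm_of {m n t a b d : ℤ} (ht : t ∈ D.S) (ha : n + t = a) (hb : m + t = b)
    (hd : m + n = d) : D.ℓ m a * D.ℓ n t - D.ℓ n b * D.ℓ m t
      = ((n : ℂ) - m) * D.ℓ d t + if d = 0 then ((m : ℂ) ^ 3 - m) / 12 * D.c else 0 := by
  subst ha hb hd; exact D.comm m n t ht

theorem comm_of_ne {m n t a b d : ℤ} (ht : t ∈ D.S) (ha : n + t = a) (hb : m + t = b)
    (hd : m + n = d) (h0 : d ≠ 0) : D.ℓ m a * D.ℓ n t - D.ℓ n b * D.ℓ m t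
      = ((n : ℂ) - m) * D.ℓ d t := by
  have := D.comm_of ht ha hb hd
  rwa [if_neg h0, add_zero] at this

theorem comm_of_zero {n t a b : ℤ} (ht : t ∈ D.S) (ha : n + t = a) (hb : -n + t = b) :
    D.ℓ (-n) a * D.ℓ n t - D.ℓ n b * D.ℓ (-n) t
      = 2 * n * (D.wt + t) - ((n : ℂ) ^ 3 - n) / 12 * D.c := by
  have := D.comm_of ht ha hb (neg_add_cancel n)
  rw [if_pos rfl, D.zero t ht] at this
  rw [this]; push_cast; ring

/-- The system of the module twisted by the involution `L(n) ↦ -L(-n)`. -/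
def flip : VirSystem where
  S := {t | -t ∈ D.S}
  wt := -D.wt
  c := -D.c
  ℓ n t := -D.ℓ (-n) (-t)
  normalized := by
    rcases D.normalized with h | h
    · left; simp [h]
    · right; intro t e
      apply h (-t)
      push_cast; linear_combination -e
  source n t h := by rw [D.source _ _ h, neg_zero]
  target n t h := by
    rw [D.target _ _ _, neg_zero]
    rwa [← neg_add]
  zero t h := by
    rw [neg_zero, D.zero _ h]; push_cast; ring
  comm m n t h := by
    have := D.comm (-m) (-n) (-t) h
    rw [neg_add, neg_add, neg_add]
    rw [← neg_add m n] at this ⊢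
    simp only [neg_eq_zero] at this
    push_cast at this
    split_ifs at this ⊢ with h0 <;> linear_combination this

/-- The system with respect to the rescaled basis `s t • v_t`. -/
def rescale (s : ℤ → ℂ) (hs : ∀ t, s t ≠ 0) : VirSystem where
  S := D.S
  wt := D.wt
  c := D.c
  ℓ n t := s t * D.ℓ n t / s (n + t)
  normalized := D.normalized
  source n t h := by rw [D.source _ _ h]; simp
  target n t h := by rw [D.target _ _ h]; simp
  zero t h := by rw [D.zero t h, zero_add]; field_simp [hs t]
  comm m n t h := by
    have := D.comm m n t h
    have e1 : m + (n + t) = m + n + t := by ring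
    have e2 : n + (m + t) = m + n + t := by ring
    rw [e1, e2]
    have h1 := hs t
    have h2 := hs (n + t)
    have h3 := hs (m + t)
    have h4 := hs (m + n + t)
    have e3 : (if m + n = 0 then ((m : ℂ) ^ 3 - m) / 12 * D.c else 0)
        = s t / s (m + n + t) * (if m + n = 0 then ((m : ℂ) ^ 3 - m) / 12 * D.c else 0) := by
      split_ifs with h0
      · rw [h0, zero_add, div_self h1, one_mul]
      · simp
    rw [e3]
    have : s t / s (m + n + t) * (D.ℓ m (n + t) * D.ℓ n t - D.ℓ n (m + t) * D.ℓ m t)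
      = s t / s (m + n + t) * (((n : ℂ) - m) * D.ℓ (m + n) t
        + if m + n = 0 then ((m : ℂ) ^ 3 - m) / 12 * D.c else 0) := by rw [this]
    rw [mul_add] at this
    rw [div_mul_div_comm, div_mul_div_comm]
    have e4 : s (n + t) * D.ℓ m (n + t) * (s t * D.ℓ n t) / (s (m + n + t) * s (n + t))
        = s t / s (m + n + t) * (D.ℓ m (n + t) * D.ℓ n t) := by field_simp
    have e5 : s (m + t) * D.ℓ n (m + t) * (s t * D.ℓ m t) / (s (m + n + t) * s (m + t))
        = s t / s (m + n + t) * (D.ℓ n (m + t) * D.ℓ m t) := by field_simp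
    rw [e4, e5]
    linear_combination this

/-- `L(-1)L(1)` on a segment of the support starting at `p` with `p - 1` outside. -/
theorem lower_raise_of_segment {p q : ℤ} (hp : p - 1 ∉ D.S) (h : ∀ t, p ≤ t → t ≤ q → t ∈ D.S) :
    ∀ t, p ≤ t → t ≤ q → D.ℓ (-1) (t + 1) * D.ℓ 1 t = (t - p + 1) * (2 * D.wt + t + p) := by
  intro t ht
  induction t, ht using Int.leInduction with
  | base =>
    intro hq
    have := D.comm_of_zero (n := 1) (a := p + 1) (b := p - 1) (h p le_rfl hq) (by ring) (by ring)
    rw [D.source _ _ hp] at this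
    push_cast at this
    linear_combination this
  | succ t ht ih =>
    intro hq
    have := D.comm_of_zero (n := 1) (a := t + 1 + 1) (b := t) (h (t + 1) (by lia) hq)
      (by ring) (by ring)
    have ih := ih (by lia)
    push_cast at this ⊢
    linear_combination this + ih

/-- At the top of the segment `L(1)` acts by zero, so the telescoped value of `L(-1)L(1)` vanishes
there: the weights of a finite-dimensional `sl₂`-string are symmetric about zero. -/
theorem segment_symm {p q : ℤ} (hpq : p ≤ q) (hp : p - 1 ∉ D.S) (hq : q + 1 ∉ D.S)
    (h : ∀ t, p ≤ t → t ≤ q → t ∈ D.S) : 2 * D.wt + p + q = 0 := by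
  have := D.lower_raise_of_segment hp h q hpq le_rfl
  rw [D.source _ _ hq, zero_mul] at this
  have h1 : ((q : ℂ) - p + 1) ≠ 0 := by
    have : q - p + 1 ≠ 0 := by lia
    exact_mod_cast this
  rcases mul_eq_zero.1 this.symm with h2 | h2
  · exact absurd h2 h1
  · linear_combination h2

theorem exists_upper_end {t : ℤ} {S : Set ℤ} (ht : t ∈ S) (h : ¬ ∃ T, ∀ t, T ≤ t → t ∈ S) :
    ∃ q, t ≤ q ∧ q + 1 ∉ S ∧ ∀ r, t ≤ r → r ≤ q → r ∈ S := by
  push Not at h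
  by_contra! hc
  obtain ⟨r, hr, hrS⟩ := h t
  have : ∀ r, t ≤ r → ∀ r', t ≤ r' → r' ≤ r → r' ∈ S := by
    intro r hr
    induction r, hr using Int.leInduction with
    | base => intro r' h1 h2; obtain rfl : r' = t := by lia
              exact ht
    | succ r hr ih =>
      intro r' h1 h2
      by_cases e : r' ≤ r
      · exact ih r' h1 e
      · obtain rfl : r' = r + 1 := by lia
        by_contra hn
        obtain ⟨x, hx1, hx2, hx3⟩ := hc r hr hn
        exact hx3 (ih x hx1 hx2)
  exact hrS (this r hr r hr le_rfl)

theorem exists_lower_end {t : ℤ} {S : Set ℤ} (ht : t ∈ S) (h : ¬ ∃ T, ∀ t, t ≤ T → t ∈ S) :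
    ∃ p, p ≤ t ∧ p - 1 ∉ S ∧ ∀ r, p ≤ r → r ≤ t → r ∈ S := by
  obtain ⟨q, h1, h2, h3⟩ := exists_upper_end (t := -t) (S := {t | -t ∈ S}) (by simpa using ht) (by
    rintro ⟨T, hT⟩
    refine h ⟨-T, fun t ht => ?_⟩
    have := hT (-t) (by lia)
    simpa using this)
  refine ⟨-q, by lia, ?_, fun r hr1 hr2 => ?_⟩
  · rwa [Set.mem_ofPred_eq, neg_add'] at h2
  · have := h3 (-r) (by lia) (by lia)
    simpa using this

/-- A support without rays is a point of weight `0`. -/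
theorem support_of_no_ray (hr : ¬ ∃ T, ∀ t, T ≤ t → t ∈ D.S) (hl : ¬ ∃ T, ∀ t, t ≤ T → t ∈ D.S)
    (hne : D.S.Nonempty) : D.S = {0} ∧ D.wt = 0 ∧ D.c = 0 := by
  have key : ∀ t ∈ D.S, ∃ p q : ℤ, p ≤ t ∧ t ≤ q ∧ p - 1 ∉ D.S ∧ q + 1 ∉ D.S ∧
      (∀ r, p ≤ r → r ≤ q → r ∈ D.S) ∧ 2 * D.wt + p + q = 0 := by
    intro t ht
    obtain ⟨q, h1, h2, h3⟩ := exists_upper_end ht hr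
    obtain ⟨p, h4, h5, h6⟩ := exists_lower_end ht hl
    have hS : ∀ r, p ≤ r → r ≤ q → r ∈ D.S := fun r hr1 hr2 => by
      rcases le_total r t with h | h
      · exact h6 r hr1 h
      · exact h3 r h hr2
    exact ⟨p, q, h4, h1, h5, h2, hS, D.segment_symm (by lia) h5 h2 hS⟩
  obtain ⟨t₀, ht₀⟩ := hne
  obtain ⟨p, q, h1, h2, h3, h4, h5, h6⟩ := key t₀ ht₀
  -- All components of the support are segments with the same centre `-wt`, so any two are nested.
  -- Their outer neighbours are missing, so they coincide.
  have hS : ∀ t ∈ D.S, p ≤ t ∧ t ≤ q := by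
    intro t ht
    obtain ⟨p', q', h1', h2', h3', h4', h5', h6'⟩ := key t ht
    have hpq : p + q = p' + q' := by
      have : (p : ℂ) + q = p' + q' := by linear_combination h6 - h6'
      exact_mod_cast this
    have a1 : p' ≤ p := by
      by_contra hlt
      exact h3' (h5 _ (by lia) (by lia))
    have a2 : p ≤ p' := by
      by_contra hlt
      exact h3 (h5' _ (by lia) (by lia))
    lia
  -- The shift `q - p + 1` exceeds the length of the segment, so `L(±(q - p + 1))` vanish on it. The
  -- central term of their commutator does not depend on the weight; comparing the two ends gives `p
  -- = q`.
  have b1 := D.comm_of_zero (n := q - p + 1) (h5 p le_rfl (by lia)) rfl rfl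
  have b2 := D.comm_of_zero (n := q - p + 1) (h5 q (by lia) le_rfl) rfl rfl
  have n1 : ∀ t, p ≤ t → t ≤ q → D.ℓ (q - p + 1) t = 0 := fun t ht _ =>
    D.target _ _ fun h => by have := hS _ h; lia
  have n2 : ∀ t, p ≤ t → t ≤ q → D.ℓ (-(q - p + 1)) t = 0 := fun t _ ht' =>
    D.target _ _ fun h => by have := hS _ h; lia
  rw [n1 p le_rfl (by lia), n2 p le_rfl (by lia)] at b1
  rw [n1 q (by lia) le_rfl, n2 q (by lia) le_rfl] at b2
  have hN : ((q : ℂ) - p + 1) ≠ 0 := by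
    have : q - p + 1 ≠ 0 := by lia
    exact_mod_cast this
  have hpq : p = q := by
    have : 2 * ((q : ℂ) - p + 1) * (q - p) = 0 := by push_cast at b1 b2; linear_combination b1 - b2
    have : (q : ℂ) - p = 0 := by simpa [hN] using this
    have : (q : ℂ) = p := by linear_combination this
    exact_mod_cast this.symm
  subst hpq
  have hwt : D.wt + p = 0 := by linear_combination h6 / 2
  have hp : D.wt = 0 ∧ p = 0 := by
    rcases D.normalized with h | h
    · refine ⟨h, ?_⟩
      rw [h, zero_add] at hwt
      exact_mod_cast hwt
    · exact absurd hwt (h p)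
  obtain ⟨hw, rfl⟩ := hp
  refine ⟨?_, hw, ?_⟩
  · ext t
    refine ⟨fun h => ?_, ?_⟩
    · have := hS t h
      simp only [Set.mem_singleton_iff]; lia
    · rintro rfl; exact h5 _ le_rfl le_rfl
  -- The factor `n³ - n` vanishes for `n = 1`, so `n = 2` is the first commutator that detects the
  -- central charge.
  · have b3 := D.comm_of_zero (n := 2) (h5 0 le_rfl le_rfl) rfl rfl
    rw [D.target 2 0 fun h => by have := hS _ h; lia,
      D.target (-2) 0 fun h => by have := hS _ h; lia, hw] at b3
    push_cast at b3
    linear_combination 2 * b3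

end VirSystem

/-! ### Invariants of `L(±1)` and `L(±2)` on a ray. -/

open Polynomial in
theorem coeffs_eq_zero_of_infinite {a₀ a₁ a₂ a₃ a₄ a₅ : ℂ}
    (h : {z : ℂ | a₅ * z ^ 5 + a₄ * z ^ 4 + a₃ * z ^ 3 + a₂ * z ^ 2 + a₁ * z + a₀ = 0}.Infinite) :
    a₅ = 0 ∧ a₄ = 0 ∧ a₃ = 0 ∧ a₂ = 0 ∧ a₁ = 0 ∧ a₀ = 0 := by
  let p : ℂ[X] := C a₅ * X ^ 5 + C a₄ * X ^ 4 + C a₃ * X ^ 3 + C a₂ * X ^ 2 + C a₁ * X + C a₀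
  have hp : p = 0 := by
    refine Polynomial.eq_zero_of_infinite_isRoot p (h.mono fun z hz => ?_)
    have hz : a₅ * z ^ 5 + a₄ * z ^ 4 + a₃ * z ^ 3 + a₂ * z ^ 2 + a₁ * z + a₀ = 0 := hz
    change p.eval z = 0
    simpa [p] using hz
  have hc : ∀ n, p.coeff n = 0 := fun n => by rw [hp, coeff_zero]
  have h5 := hc 5
  have h4 := hc 4
  have h3 := hc 3
  have h2 := hc 2
  have h1 := hc 1
  have h0 := hc 0
  simp [p, coeff_X, coeff_C] at h5 h4 h3 h2 h1 h0
  exact ⟨h5, h4, h3, h2, h1, h0⟩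

theorem infinite_of_progression {P : ℂ → Prop} (a : ℂ) {d : ℂ} (hd : d ≠ 0)
    (h : ∀ j : ℕ, P (a + d * j)) : {z | P z}.Infinite := by
  refine Set.infinite_of_injective_forall_mem (f := fun j : ℕ => a + d * j) (fun i j hij => ?_) h
  have : d * ((i : ℂ) - j) = 0 := by
    have hij : a + d * i = a + d * j := hij
    linear_combination hij
  have : (i : ℂ) - j = 0 := by simpa [hd] using this
  exact_mod_cast sub_eq_zero.1 this

namespace VirSystem

variable (D : VirSystem)

/-- Telescoping of `[L(-1), L(1)] = 2 L(0)`. Unlike on a segment, the starting value is unknown and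
gives the free constant `k`. -/
theorem ray_quadratic {T : ℤ} (hT : ∀ t, T ≤ t → t ∈ D.S) : ∃ k : ℂ, ∀ t, T ≤ t →
    D.ℓ (-1) (t + 1) * D.ℓ 1 t = (D.wt + t) * (D.wt + t + 1) + k := by
  refine ⟨D.ℓ (-1) (T + 1) * D.ℓ 1 T - (D.wt + T) * (D.wt + T + 1), fun t ht => ?_⟩
  induction t, ht using Int.leInduction with
  | base => ring
  | succ t ht ih =>
    have := D.comm_of_zero (n := 1) (a := t + 1 + 1) (b := t) (hT (t + 1) (by lia))
      (by ring) (by ring)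
    push_cast at this ⊢
    linear_combination this + ih

/-- By `[L(-1), L(2)] = 3 L(1)`, consecutive values of `L(-1)²L(2)` differ by three times the
quadratic `L(-1)L(1)`; summation gives a cubic with one new constant. -/
theorem ray_cubic_left {T : ℤ} (hT : ∀ t, T ≤ t → t ∈ D.S) {k : ℂ}
    (hk : ∀ t, T ≤ t → D.ℓ (-1) (t + 1) * D.ℓ 1 t = (D.wt + t) * (D.wt + t + 1) + k) :
    ∃ k₁ : ℂ, ∀ t, T ≤ t → D.ℓ (-1) (t + 1) * D.ℓ (-1) (t + 2) * D.ℓ 2 t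
      = (D.wt + t + 1) ^ 3 + (3 * k - 1) * (D.wt + t + 1) + k₁ := by
  refine ⟨D.ℓ (-1) (T + 1) * D.ℓ (-1) (T + 2) * D.ℓ 2 T
    - ((D.wt + T + 1) ^ 3 + (3 * k - 1) * (D.wt + T + 1)), fun t ht => ?_⟩
  induction t, ht using Int.leInduction with
  | base => ring
  | succ t ht ih =>
    have := D.comm_of_ne (m := -1) (n := 2) (a := t + 3) (b := t) (d := 1) (hT (t + 1) (by lia))
      (by ring) (by ring) (by ring) (by simp)
    have hk := hk (t + 1) (by lia)
    rw [show t + 1 + 1 = t + 2 by ring] at *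
    rw [show t + 1 + 2 = t + 3 by ring] at *
    push_cast at this hk ⊢
    linear_combination D.ℓ (-1) (t + 2) * this + 3 * hk + ih

theorem ray_cubic_right {T : ℤ} (hT : ∀ t, T ≤ t → t ∈ D.S) {k : ℂ}
    (hk : ∀ t, T ≤ t → D.ℓ (-1) (t + 1) * D.ℓ 1 t = (D.wt + t) * (D.wt + t + 1) + k) :
    ∃ k₂ : ℂ, ∀ t, T ≤ t → D.ℓ (-2) (t + 2) * D.ℓ 1 (t + 1) * D.ℓ 1 t
      = (D.wt + t + 1) ^ 3 + (3 * k - 1) * (D.wt + t + 1) + k₂ := by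
  refine ⟨D.ℓ (-2) (T + 2) * D.ℓ 1 (T + 1) * D.ℓ 1 T
    - ((D.wt + T + 1) ^ 3 + (3 * k - 1) * (D.wt + T + 1)), fun t ht => ?_⟩
  induction t, ht using Int.leInduction with
  | base => ring
  | succ t ht ih =>
    have := D.comm_of_ne (m := 1) (n := -2) (a := t) (b := t + 3) (d := -1)
      (hT (t + 2) (by lia)) (by ring) (by ring) (by ring) (by simp)
    have hk := hk (t + 1) (by lia)
    rw [show t + 1 + 1 = t + 2 by ring] at *
    rw [show t + 1 + 2 = t + 3 by ring] at *
    push_cast at this hk ⊢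
    linear_combination -D.ℓ 1 (t + 1) * this + 3 * hk + ih

/-- Telescoping of `[L(-2), L(2)]`, where the central charge enters. The relation links weights two
apart, so it is followed only along one residue class. -/
theorem ray_step_two {T : ℤ} (hT : ∀ t, T ≤ t → t ∈ D.S) : ∃ β : ℂ, ∀ j : ℕ,
    D.ℓ (-2) (T + 2 * j + 2) * D.ℓ 2 (T + 2 * j)
      = (D.wt + T + 2 * j + 1) ^ 2 - D.c / 4 * (D.wt + T + 2 * j + 1) + β := by
  refine ⟨D.ℓ (-2) (T + 2) * D.ℓ 2 T
    - ((D.wt + T + 1) ^ 2 - D.c / 4 * (D.wt + T + 1)), fun j => ?_⟩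
  induction j with
  | zero => push_cast; simp only [mul_zero, add_zero]; ring
  | succ j ih =>
    have := D.comm_of_zero (n := 2) (a := T + 2 * j + 2 + 2) (b := T + 2 * j)
      (hT (T + 2 * j + 2) (by lia)) (by ring) (by ring)
    push_cast at this ih ⊢
    rw [show T + 2 * ((j : ℤ) + 1) = T + 2 * j + 2 by ring]
    linear_combination this + ih

/-- On a ray the operators `L(±1)`, `L(±2)` have the invariants of a module `A_{a,b}`. -/
theorem ray_invariants {T : ℤ} (hT : ∀ t, T ≤ t → t ∈ D.S) : D.c = 0 ∧ ∃ b : ℂ, ∀ t, T ≤ t →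
    D.ℓ (-1) (t + 1) * D.ℓ 1 t = (D.wt + t + b) * (D.wt + t + 1 - b) ∧
    D.ℓ (-1) (t + 1) * D.ℓ (-1) (t + 2) * D.ℓ 2 t
      = (D.wt + t + 2 * b) * (D.wt + t + 2 - b) * (D.wt + t + 1 - b) ∧
    D.ℓ (-2) (t + 2) * D.ℓ 1 (t + 1) * D.ℓ 1 t
      = (D.wt + t + b) * (D.wt + t + 1 + b) * (D.wt + t + 2 - 2 * b) := by
  obtain ⟨k, hk⟩ := D.ray_quadratic hT
  obtain ⟨k₁, h₁⟩ := D.ray_cubic_left hT hk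
  obtain ⟨k₂, h₂⟩ := D.ray_cubic_right hT hk
  obtain ⟨β, hβ⟩ := D.ray_step_two hT
  -- The product `L(-2)L(2) · L(-1)L(1) · L(-1)L(1)`, with the last two factors taken at `t` and `t
  -- + 1`, regroups as the product of the two cubics. In `z = wt + t + 1` this is a polynomial
  -- identity of degree five with infinitely many solutions.
  have hinf := infinite_of_progression (d := 2) (a := D.wt + T + 1) (P := fun z =>
    (-(D.c / 4)) * z ^ 5 + (β + 2 * k - 1 - 2 * (3 * k - 1)) * z ^ 4
      + (-(D.c / 4) * (2 * k - 1) - (k₁ + k₂)) * z ^ 3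
      + (k ^ 2 + β * (2 * k - 1) - (3 * k - 1) ^ 2) * z ^ 2
      + (-(D.c / 4) * k ^ 2 - (k₁ + k₂) * (3 * k - 1)) * z + (β * k ^ 2 - k₁ * k₂) = 0)
    two_ne_zero fun j => by
      have hj : T ≤ T + 2 * (j : ℤ) := by lia
      have e := hβ j
      have e1 := h₁ _ hj
      have e2 := h₂ _ hj
      have e3 := hk _ hj
      have e4 := hk (T + 2 * j + 1) (by lia)
      rw [show T + 2 * (j : ℤ) + 1 + 1 = T + 2 * j + 2 by ring] at e4
      push_cast at e e1 e2 e3 e4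
      have key : (D.ℓ (-2) (T + 2 * j + 2) * D.ℓ 2 (T + 2 * j))
          * (D.ℓ (-1) (T + 2 * j + 1) * D.ℓ 1 (T + 2 * j))
          * (D.ℓ (-1) (T + 2 * j + 2) * D.ℓ 1 (T + 2 * j + 1))
          = (D.ℓ (-1) (T + 2 * j + 1) * D.ℓ (-1) (T + 2 * j + 2) * D.ℓ 2 (T + 2 * j))
          * (D.ℓ (-2) (T + 2 * j + 2) * D.ℓ 1 (T + 2 * j + 1) * D.ℓ 1 (T + 2 * j)) := by ring
      rw [e, e1, e2, e3, e4] at key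
      linear_combination key
  obtain ⟨c5, c4, c3, c2, c1, c0⟩ := coeffs_eq_zero_of_infinite hinf
  have hc : D.c = 0 := by linear_combination -4 * c5
  refine ⟨hc, ?_⟩
  rw [hc] at c3
  have hk₂ : k₂ = -k₁ := by linear_combination -c3
  have hβ' : β = 4 * k - 1 := by linear_combination c4
  have hk₁ : k₁ ^ 2 = k ^ 2 * (1 - 4 * k) := by
    rw [hk₂, hβ'] at c0; linear_combination c0
  -- Since `k` is to be `b(1 - b)`, the discriminant `1 - 4k` is `(1 - 2b)²` and `d` is `1 - 2b`.
  -- The quadratic does not separate `b` from `1 - b`; the sign of `d` is chosen to match `k₁`.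
  obtain ⟨d, hd, hd'⟩ : ∃ d : ℂ, d ^ 2 = 1 - 4 * k ∧ k₁ = k * d := by
    obtain ⟨d, hd⟩ := IsAlgClosed.exists_pow_nat_eq (1 - 4 * k) (n := 2) (by norm_num)
    have : (k₁ - k * d) * (k₁ + k * d) = 0 := by linear_combination hk₁ - k ^ 2 * hd
    rcases mul_eq_zero.1 this with h | h
    · exact ⟨d, hd, by linear_combination h⟩
    · exact ⟨-d, by linear_combination hd, by linear_combination h⟩
  have hk' : k = (1 - d ^ 2) / 4 := by linear_combination hd / 4
  refine ⟨(1 - d) / 2, fun t ht => ⟨?_, ?_, ?_⟩⟩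
  · rw [hk t ht, hk']; ring
  · rw [h₁ t ht, hd', hk']; ring
  · rw [h₂ t ht, hk₂, hd', hk']; ring

/-! ### Density modules on a ray and their extension downwards. -/

/-- After rescaling by `s`, the part of the module above `T` is the one of `A_{wt,b}`. -/
def IsDensityFrom (b : ℂ) (s : ℤ → ℂ) (T : ℤ) : Prop :=
  ∀ n t, T ≤ t → T ≤ n + t → D.ℓ n t * s t = s (n + t) * (D.wt + t + b * n)

variable {D}

/-- `L(±1)` and `L(±2)` generate the other `L(n)` through `[L(1), L(n)] = (n - 1) L(n + 1)` and its
mirror image. The induction for negative indices is indexed by the target vector, so that every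
intermediate vector stays above `T`. -/
theorem isDensityFrom_of_generators {b : ℂ} {s : ℤ → ℂ} {T : ℤ} (hS : ∀ t, T ≤ t → t ∈ D.S)
    (hs : ∀ t, s t ≠ 0)
    (h1 : ∀ t, T ≤ t → D.ℓ 1 t * s t = s (t + 1) * (D.wt + t + b))
    (h2 : ∀ t, T ≤ t → D.ℓ 2 t * s t = s (t + 2) * (D.wt + t + 2 * b))
    (h3 : ∀ t, T ≤ t → D.ℓ (-1) (t + 1) * s (t + 1) = s t * (D.wt + t + 1 - b))
    (h4 : ∀ t, T ≤ t → D.ℓ (-2) (t + 2) * s (t + 2) = s t * (D.wt + t + 2 - 2 * b)) :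
    D.IsDensityFrom b s T := by
  have up : ∀ n : ℕ, ∀ t, T ≤ t →
      D.ℓ (n + 2) t * s t = s (t + (n + 2)) * (D.wt + t + b * (n + 2)) := by
    intro n
    induction n with
    | zero =>
      intro t ht
      simpa [mul_comm b] using h2 t ht
    | succ n ih =>
      intro t ht
      have e := D.comm_of_ne (m := 1) (n := n + 2) (t := t) (a := t + (n + 2)) (b := t + 1)
        (d := ((n + 1 : ℕ) : ℤ) + 2) (hS t ht) (by ring) (by ring) (by push_cast; ring) (by lia)
      have a1 := ih t ht
      have a2 := ih (t + 1) (by lia)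
      have a3 := h1 t ht
      have a4 := h1 (t + (n + 2)) (by lia)
      have hn : ((n : ℂ) + 1) ≠ 0 := by exact_mod_cast (by lia : n + 1 ≠ 0)
      rw [show t + 1 + ((n : ℤ) + 2) = t + (((n + 1 : ℕ) : ℤ) + 2) by push_cast; ring] at a2
      rw [show t + ((n : ℤ) + 2) + 1 = t + (((n + 1 : ℕ) : ℤ) + 2) by push_cast; ring] at a4
      push_cast at e a1 a2 a3 a4 ⊢
      have n1 := hs t
      have n2 := hs (t + 1)
      have n3 := hs (t + (n + 2))
      apply mul_left_cancel₀ hn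
      rw [← eq_div_iff n1] at a1 a3
      rw [← eq_div_iff n2] at a2
      rw [← eq_div_iff n3] at a4
      rw [a1, a2, a3, a4] at e
      field_simp at e
      linear_combination -e
  have down : ∀ n : ℕ, ∀ t, T ≤ t →
      D.ℓ (-(n + 2)) (t + (n + 2)) * s (t + (n + 2)) = s t * (D.wt + t + (1 - b) * (n + 2)) := by
    intro n
    induction n with
    | zero =>
      intro t ht
      have := h4 t ht
      simp only [Nat.cast_zero, zero_add]
      rw [this]; ring
    | succ n ih =>
      intro t ht
      have e := D.comm_of_ne (m := -1) (n := -(n + 2)) (t := t + (((n + 1 : ℕ) : ℤ) + 2))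
        (a := t + 1) (b := t + (n + 2)) (d := -(((n + 1 : ℕ) : ℤ) + 2)) (hS _ (by lia))
        (by push_cast; ring) (by push_cast; ring) (by push_cast; ring) (by lia)
      have a1 := ih t ht
      have a2 := ih (t + 1) (by lia)
      have a3 := h3 t ht
      have a4 := h3 (t + (n + 2)) (by lia)
      have hn : ((n : ℂ) + 1) ≠ 0 := by exact_mod_cast (by lia : n + 1 ≠ 0)
      rw [show t + 1 + ((n : ℤ) + 2) = t + (((n + 1 : ℕ) : ℤ) + 2) by push_cast; ring] at a2
      rw [show t + ((n : ℤ) + 2) + 1 = t + (((n + 1 : ℕ) : ℤ) + 2) by push_cast; ring] at a4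
      push_cast at e a1 a2 a3 a4 ⊢
      have n2 := hs (t + 1)
      have n3 := hs (t + (n + 2))
      have n4 := hs (t + (n + 1 + 2))
      apply mul_left_cancel₀ hn
      rw [← eq_div_iff n3] at a1
      rw [← eq_div_iff n2] at a3
      rw [← eq_div_iff n4] at a2 a4
      rw [a1, a2, a3, a4] at e
      field_simp at e
      linear_combination e
  intro n t ht hnt
  rcases lt_trichotomy n 0 with hn | rfl | hn
  · rcases eq_or_ne n (-1) with rfl | h
    · have := h3 (t - 1) (by lia)
      rw [show t - 1 + 1 = t by ring] at this
      rw [this, show -1 + t = t - 1 by ring]; push_cast; ring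
    · obtain ⟨k, rfl⟩ : ∃ k : ℕ, n = -((k : ℤ) + 2) := ⟨(-n - 2).toNat, by lia⟩
      have := down k (t - (k + 2)) (by lia)
      rw [show t - ((k : ℤ) + 2) + (k + 2) = t by ring] at this
      rw [this, show -((k : ℤ) + 2) + t = t - (k + 2) by ring]; push_cast; ring
  · rw [D.zero t (hS t ht), zero_add]; push_cast; ring
  · rcases eq_or_ne n 1 with rfl | h
    · rw [h1 t ht, add_comm]; push_cast; ring
    · obtain ⟨k, rfl⟩ : ∃ k : ℕ, n = (k : ℤ) + 2 := ⟨(n - 2).toNat, by lia⟩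
      rw [up k t ht, add_comm]; push_cast; ring

theorem exists_ne_zero_from (a : ℂ) : ∃ T : ℤ, ∀ t : ℤ, T ≤ t → a + t ≠ 0 := by
  by_cases h : ∃ t : ℤ, a + t = 0
  · obtain ⟨t₀, h0⟩ := h
    refine ⟨t₀ + 1, fun t ht e => ?_⟩
    have : (t : ℂ) = t₀ := by linear_combination e - h0
    have : t = t₀ := by exact_mod_cast this
    lia
  · push Not at h
    exact ⟨0, fun t _ => h t⟩

/-- A ray in the support makes the module a density module far up the ray. -/
theorem exists_isDensityFrom {T : ℤ} (hT : ∀ t, T ≤ t → t ∈ D.S) :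
    D.c = 0 ∧ ∃ b s T', 1 ≤ T' ∧ (∀ t, s t ≠ 0) ∧ D.IsDensityFrom b s T' := by
  obtain ⟨hc, b, hb⟩ := D.ray_invariants hT
  refine ⟨hc, b, ?_⟩
  obtain ⟨T₁, hT₁⟩ := exists_ne_zero_from (D.wt + b)
  obtain ⟨T₂, hT₂⟩ := exists_ne_zero_from (D.wt + 1 - b)
  obtain ⟨T', h0, h1, h2, h3⟩ : ∃ T', T ≤ T' ∧ T₁ ≤ T' ∧ T₂ ≤ T' ∧ 1 ≤ T' :=
    ⟨max (max T T₁) (max T₂ 1), by simp, by simp, by simp, by simp⟩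
  have n1 : ∀ t, T' ≤ t → D.wt + t + b ≠ 0 := fun t ht e => hT₁ t (by lia) (by rw [← e]; ring)
  have n2 : ∀ t, T' ≤ t → D.wt + t + 1 - b ≠ 0 := fun t ht e =>
    hT₂ t (by lia) (by rw [← e]; ring)
  have n3 : ∀ t, T' ≤ t → D.ℓ (-1) (t + 1) ≠ 0 ∧ D.ℓ 1 t ≠ 0 := fun t ht => by
    rw [← mul_ne_zero_iff, (hb t (by lia)).1]
    exact mul_ne_zero (n1 t ht) (n2 t ht)
  -- The recursion is the one that brings `L(1)` to density form. Its factors are nonzero because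
  -- `T'` lies beyond the zeros of `wt + t + b` and `wt + t + 1 - b`.
  let σ : ℕ → ℂ := fun j => Nat.rec 1 (fun i x => x * D.ℓ 1 (T' + i) / (D.wt + (T' + i) + b)) j
  have hσ : ∀ j, σ (j + 1) = σ j * D.ℓ 1 (T' + j) / (D.wt + (T' + j) + b) := fun j => rfl
  have hσ0 : ∀ j, σ j ≠ 0 := by
    intro j
    induction j with
    | zero => exact one_ne_zero
    | succ j ih =>
      rw [hσ]
      have := n1 (T' + j) (by lia)
      push_cast at this
      exact div_ne_zero (mul_ne_zero ih (n3 _ (by lia)).2) this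
  let s : ℤ → ℂ := fun t => σ (t - T').toNat
  have hs : ∀ t, s t ≠ 0 := fun t => hσ0 _
  have g1 : ∀ t, T' ≤ t → D.ℓ 1 t * s t = s (t + 1) * (D.wt + t + b) := by
    intro t ht
    obtain ⟨j, rfl⟩ : ∃ j : ℕ, t = T' + j := ⟨(t - T').toNat, by lia⟩
    have e1 : s (T' + j) = σ j := congrArg σ (by lia : (T' + j - T').toNat = j)
    have e2 : s (T' + j + 1) = σ (j + 1) :=
      congrArg σ (by lia : (T' + j + 1 - T').toNat = j + 1)
    have := n1 (T' + j) (by lia)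
    push_cast at this ⊢
    rw [e1, e2, hσ]
    field_simp
  have g3 : ∀ t, T' ≤ t → D.ℓ (-1) (t + 1) * s (t + 1) = s t * (D.wt + t + 1 - b) := by
    intro t ht
    have e := (hb t (by lia)).1
    have e1 := g1 t ht
    apply mul_right_cancel₀ (n1 t ht)
    linear_combination -D.ℓ (-1) (t + 1) * e1 + s t * e
  -- Once `L(1)` and `L(-1)` are in density form, the two cubic invariants determine `L(2)` and
  -- `L(-2)`, since the factors to cancel do not vanish above `T'`.
  refine ⟨s, T', h3, hs, isDensityFrom_of_generators (fun t ht => hT t (by lia)) hs g1 ?_ g3 ?_⟩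
  · intro t ht
    have e := (hb t (by lia)).2.1
    have e1 := g3 t ht
    have e2 := g3 (t + 1) (by lia)
    rw [show t + 1 + 1 = t + 2 by ring] at e2
    push_cast at e2
    have m1 := n2 t ht
    have m2 := n2 (t + 1) (by lia)
    push_cast at m2
    have m3 := hs (t + 1)
    apply mul_right_cancel₀ (mul_ne_zero m1 m2)
    have e3 : s t * ((D.wt + t + 1 - b) * (D.wt + (t + 1) + 1 - b))
        = D.ℓ (-1) (t + 1) * D.ℓ (-1) (t + 2) * s (t + 2) := by
      apply mul_left_cancel₀ m3
      linear_combination -D.ℓ (-1) (t + 1) * s (t + 1) * e2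
        - s (t + 1) * (D.wt + (t + 1) + 1 - b) * e1
    linear_combination D.ℓ 2 t * e3 + s (t + 2) * e
  · intro t ht
    have e := (hb t (by lia)).2.2
    have e1 := g1 t ht
    have e2 := g1 (t + 1) (by lia)
    rw [show t + 1 + 1 = t + 2 by ring] at e2
    push_cast at e2
    have m1 := n1 t ht
    have m2 := n1 (t + 1) (by lia)
    push_cast at m2
    have m3 := hs (t + 1)
    apply mul_right_cancel₀ (mul_ne_zero m1 m2)
    have e3 : s (t + 2) * ((D.wt + t + b) * (D.wt + (t + 1) + b))
        = D.ℓ 1 (t + 1) * D.ℓ 1 t * s t := by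
      apply mul_left_cancel₀ m3
      linear_combination - D.ℓ 1 (t + 1) * s (t + 1) * e1
        - s (t + 1) * (D.wt + t + b) * e2
    linear_combination D.ℓ (-2) (t + 2) * e3 + s t * e

/-- A density module above `T + 1` extends one step down unless the weight at `T` is zero and
`b ∈ {0, 1}`. -/
theorem IsDensityFrom.extend {b : ℂ} {s : ℤ → ℂ} {T : ℤ} (hc : D.c = 0)
    (hS : ∀ t, T + 1 ≤ t → t ∈ D.S) (hs : ∀ t, s t ≠ 0) (h : D.IsDensityFrom b s (T + 1))
    (hne : ¬ (D.wt + T = 0 ∧ (b = 0 ∨ b = 1))) :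
    T ∈ D.S ∧ ∃ κ, κ ≠ 0 ∧ D.IsDensityFrom b (Function.update s T κ) T := by
  -- `L(m)L(-n) v_{T+n}` passes through `v_T`, while `L(-n)L(m) v_{T+n}` and the commutator term
  -- stay above `T` and are known. The result factors into a function of `m` times a function of
  -- `n`, so one pair with nonzero factors fixes the scale at `T`.
  have key : ∀ m n : ℤ, 1 ≤ m → 1 ≤ n → D.ℓ m T * (D.ℓ (-n) (T + n) * s (T + n))
      = s (T + m) * (D.wt + T + b * m) * (D.wt + T + n - b * n) := by
    intro m n hm hn
    have e := D.comm_of (m := m) (n := -n) (t := T + n) (a := T) (b := T + m + n) (d := m - n)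
      (hS _ (by lia)) (by ring) (by ring) (by ring)
    rw [hc, mul_zero, ite_self, add_zero] at e
    have e1 := h m (T + n) (by lia) (by lia)
    have e2 := h (-n) (T + m + n) (by lia) (by lia)
    have e3 := h (m - n) (T + n) (by lia) (by lia)
    rw [show m + (T + n) = T + m + n by ring] at e1
    rw [show -n + (T + m + n) = T + m by ring] at e2
    rw [show m - n + (T + n) = T + m by ring] at e3
    push_cast at e e1 e2 e3
    linear_combination s (T + n) * e + D.ℓ (-n) (T + m + n) * e1 - (n + m) * e3
      + (D.wt + (T + n) + b * m) * e2
  -- The expression is affine in `m`; vanishing at `m = 1` and `m = 2` would force `wt + T = 0` and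
  -- `b = 0`. The same argument in `n` excludes `b = 1`.
  obtain ⟨m, hm, hm'⟩ : ∃ m : ℤ, 1 ≤ m ∧ D.wt + T + b * m ≠ 0 := by
    by_contra! hcon
    have h1 := hcon 1 le_rfl
    have h2 := hcon 2 (by norm_num)
    push_cast at h1 h2
    exact hne ⟨by linear_combination 2 * h1 - h2, Or.inl (by linear_combination h2 - h1)⟩
  obtain ⟨n, hn, hn'⟩ : ∃ n : ℤ, 1 ≤ n ∧ D.wt + T + n - b * n ≠ 0 := by
    by_contra! hcon
    have h1 := hcon 1 le_rfl
    have h2 := hcon 2 (by norm_num)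
    push_cast at h1 h2
    exact hne ⟨by linear_combination 2 * h1 - h2, Or.inr (by linear_combination h1 - h2)⟩
  have hmn := key m n hm hn
  have h0 : D.ℓ m T * (D.ℓ (-n) (T + n) * s (T + n)) ≠ 0 := by
    rw [hmn]; exact mul_ne_zero (mul_ne_zero (hs _) hm') hn'
  have hφ := left_ne_zero_of_mul h0
  have he := right_ne_zero_of_mul h0
  have hTS : T ∈ D.S := by
    by_contra hT
    exact hφ (D.source _ _ hT)
  have hsm := hs (T + m)
  refine ⟨hTS, s (T + m) * (D.wt + T + b * m) / D.ℓ m T,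
    div_ne_zero (mul_ne_zero hsm hm') hφ, ?_⟩
  intro i t ht hit
  rcases eq_or_lt_of_le ht with rfl | ht
  · rcases eq_or_ne i 0 with rfl | hi
    · rw [D.zero _ hTS, zero_add]; push_cast; ring
    · rw [Function.update_self, Function.update_of_ne (by lia)]
      have e := key i n (by lia) hn
      rw [add_comm i]
      apply mul_right_cancel₀ (mul_ne_zero he hφ)
      field_simp
      linear_combination s (T + m) * (D.wt + T + b * m) * e
        - s (T + i) * (D.wt + T + b * i) * hmn
  · rw [Function.update_of_ne (by lia)]
    rcases eq_or_lt_of_le hit with hit | hit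
    · rw [← hit, Function.update_self]
      obtain ⟨j, rfl⟩ : ∃ j, i = -j := ⟨-i, by ring⟩
      obtain rfl : t = T + j := by lia
      have e := key m j hm (by lia)
      field_simp
      push_cast
      linear_combination e
    · rw [Function.update_of_ne (by lia)]
      exact h i t ht hit

/-- For `wt = 0` the only index at which the extension can fail is `0`, so the descent always
reaches `1`, even when `b ∈ {0, 1}`. -/
theorem IsDensityFrom.exists_from_one {b : ℂ} {s : ℤ → ℂ} (hc : D.c = 0) (hw : D.wt = 0) {T : ℤ}
    (hT : 1 ≤ T) (hS : ∀ t, T ≤ t → t ∈ D.S) (hs : ∀ t, s t ≠ 0) (h : D.IsDensityFrom b s T) :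
    (∀ t, 1 ≤ t → t ∈ D.S) ∧ ∃ s, (∀ t, s t ≠ 0) ∧ D.IsDensityFrom b s 1 := by
  induction T, hT using Int.leInduction generalizing s with
  | base => exact ⟨hS, s, hs, h⟩
  | succ T hT ih =>
    obtain ⟨hTS, κ, hκ, h'⟩ := h.extend hc hS hs (by
      rw [hw, zero_add]
      rintro ⟨e, -⟩
      have : T = 0 := by exact_mod_cast e
      lia)
    refine ih (fun t ht => ?_) (fun t => ?_) h'
    · rcases eq_or_lt_of_le ht with rfl | ht
      · exact hTS
      · exact hS t ht
    · by_cases e : t = T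
      · subst e; simpa using hκ
      · simpa [e] using hs t

theorem IsDensityFrom.exists_global {b : ℂ} {s : ℤ → ℂ} (hc : D.c = 0)
    (hb : ¬ (D.wt = 0 ∧ (b = 0 ∨ b = 1))) {T : ℤ} (hS : ∀ t, T ≤ t → t ∈ D.S)
    (hs : ∀ t, s t ≠ 0) (h : D.IsDensityFrom b s T) :
    D.S = Set.univ ∧ ∃ s : ℤ → ℂ, (∀ t, s t ≠ 0) ∧
      ∀ n t, D.ℓ n t * s t = s (n + t) * (D.wt + t + b * n) := by
  -- Each extension changes the scale only at the newly reached index. The successive scales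
  -- therefore stabilise pointwise, and the limit at `t` can be read off at stage `(T - t).toNat`.
  let X : ℕ → Type := fun j => {s : ℤ → ℂ // (∀ t, s t ≠ 0) ∧ (∀ t, T - j ≤ t → t ∈ D.S) ∧
    D.IsDensityFrom b s (T - j)}
  have step : ∀ j (x : X j), ∃ y : X (j + 1), ∀ t, T - j ≤ t → y.1 t = x.1 t := by
    rintro j ⟨s, hs, hS, h⟩
    have ej : T - ((j + 1 : ℕ) : ℤ) + 1 = T - j := by push_cast; ring
    rw [← ej] at hS h
    obtain ⟨hTS, κ, hκ, h'⟩ := h.extend hc hS hs (by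
      rintro ⟨e, he⟩
      rcases D.normalized with h0 | h0
      · exact hb ⟨h0, he⟩
      · exact h0 _ e)
    refine ⟨⟨_, fun t => ?_, fun t ht => ?_, h'⟩, fun t ht => ?_⟩
    · by_cases e : t = T - ((j + 1 : ℕ) : ℤ)
      · rw [e, Function.update_self]; exact hκ
      · rw [Function.update_of_ne e]; exact hs t
    · rcases eq_or_lt_of_le ht with rfl | ht
      · exact hTS
      · exact hS t ht
    · exact Function.update_of_ne (by lia) _ _
  choose next hnext using step
  let x : ∀ j, X j := fun j => Nat.rec ⟨s, hs, by simpa using hS, by simpa using h⟩ next j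
  have hx : ∀ j, x (j + 1) = next j (x j) := fun j => rfl
  have stable : ∀ t (i j : ℕ), T - i ≤ t → i ≤ j → (x j).1 t = (x i).1 t := by
    intro t i j hi hij
    induction j, hij using Nat.le_induction with
    | base => rfl
    | succ j hij ih => rw [hx, hnext j _ t (by lia), ih]
  refine ⟨Set.eq_univ_of_forall fun t => (x (T - t).toNat).2.2.1 t (by lia),
    fun t => (x (T - t).toNat).1 t, fun t => (x _).2.1 t, fun n t => ?_⟩
  let j := max (T - t).toNat (T - (n + t)).toNat
  have := (x j).2.2.2 n t (by lia) (by lia)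
  rwa [stable t (T - t).toNat j (by lia) (le_max_left _ _),
    stable (n + t) (T - (n + t)).toNat j (by lia) (le_max_right _ _)] at this

/-! ### Gluing the two halves: global and punctured Virasoro modules. -/

variable (D)

/-- The module is `A_{wt,b}`, with no vector on which the case `b ∈ {0, 1}` degenerates. -/
def IsGlobal : Prop :=
  D.S = Set.univ ∧ ∃ (b : ℂ) (s : ℤ → ℂ), ¬ (D.wt = 0 ∧ (b = 0 ∨ b = 1)) ∧ (∀ t, s t ≠ 0) ∧
    ∀ n t, D.ℓ n t * s t = s (n + t) * (D.wt + t + b * n)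

/-- Up to the vector of weight zero the module is `A_{0,0}`. -/
def IsPunctured : Prop :=
  D.wt = 0 ∧ (∀ t ≠ 0, t ∈ D.S) ∧ ∃ s : ℤ → ℂ, (∀ t, s t ≠ 0) ∧
    ∀ n t, t ≠ 0 → n + t ≠ 0 → D.ℓ n t * s t = s (n + t) * t

variable {D}

theorem IsGlobal.of_flip (h : D.flip.IsGlobal) : D.IsGlobal := by
  obtain ⟨hS, b, s, hb, hs, h⟩ := h
  refine ⟨Set.eq_univ_of_forall fun t => ?_, b, fun t => s (-t), ?_, fun t => hs _, fun n t => ?_⟩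
  · have : -t ∈ D.flip.S := by rw [hS]; trivial
    simpa [flip] using this
  · simpa [flip] using hb
  · have := h (-n) (-t)
    simp only [flip, neg_neg] at this
    rw [← neg_add] at this
    push_cast at this
    linear_combination -this

theorem ray_dichotomy {T : ℤ} (hT : ∀ t, T ≤ t → t ∈ D.S) :
    D.c = 0 ∧ (D.IsGlobal ∨ (D.wt = 0 ∧ (∀ t, 1 ≤ t → t ∈ D.S) ∧
      ∃ s, (∀ t, s t ≠ 0) ∧ D.IsDensityFrom 0 s 1)) := by
  obtain ⟨hc, -⟩ := D.ray_invariants hT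
  obtain ⟨T', hTT', b, s, h1, hs, h⟩ : ∃ T', T ≤ T' ∧ ∃ b s, 1 ≤ T' ∧ (∀ t, s t ≠ 0) ∧
      D.IsDensityFrom b s T' := by
    obtain ⟨-, b, s, T', h1, hs, h⟩ := exists_isDensityFrom hT
    exact ⟨max T T', le_max_left _ _, b, s, le_trans h1 (le_max_right _ _), hs,
      fun n t ht hnt => h n t (le_trans (le_max_right _ _) ht) (le_trans (le_max_right _ _) hnt)⟩
  have hT' : ∀ t, T' ≤ t → t ∈ D.S := fun t ht => hT t (by lia)
  refine ⟨hc, ?_⟩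
  by_cases hb : D.wt = 0 ∧ (b = 0 ∨ b = 1)
  · right
    obtain ⟨hw, hb⟩ := hb
    obtain ⟨hS, s, hs, h⟩ := h.exists_from_one hc hw h1 hT' hs
    refine ⟨hw, hS, ?_⟩
    rcases hb with rfl | rfl
    · exact ⟨s, hs, h⟩
    -- Away from weight zero the factor `t` identifies `A_{0,1}` with `A_{0,0}`. The value at `0`
    -- only keeps the scale invertible.
    · refine ⟨fun t => if t = 0 then 1 else s t * t, fun t => ?_, fun n t ht hnt => ?_⟩
      · dsimp only
        split_ifs with h0
        · exact one_ne_zero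
        · exact mul_ne_zero (hs t) (by exact_mod_cast h0)
      · have := h n t ht hnt
        dsimp only
        rw [if_neg (by lia), if_neg (by lia)]
        rw [hw] at this ⊢
        push_cast
        linear_combination t * this
  · left
    obtain ⟨hS, s, hs, h⟩ := h.exists_global hc hb hT' hs
    exact ⟨hS, b, s, hb, hs, h⟩

/-- The two halves of a punctured module are glued in only one way. -/
theorem cross_terms (hc : D.c = 0) (hS : ∀ t ≠ 0, t ∈ D.S)
    (hpos : ∀ n t, 1 ≤ t → 1 ≤ n + t → D.ℓ n t = t)
    (hneg : ∀ n t, t ≤ -1 → n + t ≤ -1 → D.ℓ n t = t) :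
    ∃ κ : ℂ, κ ≠ 0 ∧ (∀ n t, t ≤ -1 → 1 ≤ n + t → D.ℓ n t = t * κ) ∧
      ∀ n t, 1 ≤ t → n + t ≤ -1 → D.ℓ n t * κ = t := by
  -- The path `-i → j → -r` crosses zero twice, whereas the path in the other order and the
  -- commutator remain in the negative half. Hence the product of two crossing coefficients is
  -- known, and a single constant `κ` governs all crossings.
  have h1 : ∀ i j r : ℤ, 1 ≤ i → 1 ≤ j → 1 ≤ r →
      D.ℓ (-j - r) j * D.ℓ (i + j) (-i) = -(i * j) := by
    intro i j r hi hj hr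
    have e := D.comm_of (m := -j - r) (n := i + j) (t := -i) (a := j) (b := -j - r - i)
      (d := i - r) (hS _ (by lia)) (by ring) (by ring) (by ring)
    rw [hc, mul_zero, ite_self, add_zero, hneg (i + j) (-j - r - i) (by lia) (by lia),
      hneg (-j - r) (-i) (by lia) (by lia), hneg (i - r) _ (by lia) (by lia)] at e
    push_cast at e
    linear_combination e
  have h2 : ∀ i j r : ℤ, 1 ≤ i → 1 ≤ j → 1 ≤ r →
      D.ℓ (j + r) (-j) * D.ℓ (-i - j) i = -(i * j) := by
    intro i j r hi hj hr
    have e := D.comm_of (m := j + r) (n := -i - j) (t := i) (a := -j) (b := j + r + i)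
      (d := r - i) (hS _ (by lia)) (by ring) (by ring) (by ring)
    rw [hc, mul_zero, ite_self, add_zero, hpos (-i - j) (j + r + i) (by lia) (by lia),
      hpos (j + r) i (by lia) (by lia), hpos (r - i) _ (by lia) (by lia)] at e
    push_cast at e
    linear_combination e
  let κ := -D.ℓ 2 (-1)
  have hκ : κ ≠ 0 := fun h0 => by
    have := h1 1 1 1 le_rfl le_rfl le_rfl
    rw [show D.ℓ (1 + 1) (-1) = -κ from (neg_neg _).symm, h0] at this
    simp at this
  have g1 : ∀ j : ℤ, 1 ≤ j → D.ℓ (-j - 1) j * κ = j := by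
    intro j hj
    have := h2 j 1 1 hj le_rfl le_rfl
    rw [show D.ℓ (1 + 1) (-1) = -κ from (neg_neg _).symm] at this
    push_cast at this
    linear_combination -this
  have g2 : ∀ i j : ℤ, 1 ≤ i → 1 ≤ j → D.ℓ (i + j) (-i) = -i * κ := by
    intro i j hi hj
    have a := h1 i j 1 hi hj le_rfl
    have b := g1 j hj
    have hj0 : (j : ℂ) ≠ 0 := by exact_mod_cast (by lia : j ≠ 0)
    apply mul_left_cancel₀ hj0
    linear_combination κ * a - D.ℓ (i + j) (-i) * b
  refine ⟨κ, hκ, fun n t ht hnt => ?_, fun n t ht hnt => ?_⟩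
  · have := g2 (-t) (n + t) (by lia) hnt
    rw [show -t + (n + t) = n by ring, neg_neg] at this
    rw [this]; push_cast; ring
  · have a := h2 t (-(n + t)) 1 ht (by lia) le_rfl
    have b := g2 (-(n + t)) 1 (by lia) le_rfl
    rw [b, show -t - -(n + t) = n by ring] at a
    have h0 : ((-(n + t) : ℤ) : ℂ) ≠ 0 := by exact_mod_cast (by lia : -(n + t) ≠ 0)
    apply mul_left_cancel₀ h0
    linear_combination -a

theorem isPunctured_of_halves (hw : D.wt = 0) (hc : D.c = 0) (hS : ∀ t ≠ 0, t ∈ D.S)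
    {s s' : ℤ → ℂ} (hs : ∀ t, s t ≠ 0) (hs' : ∀ t, s' t ≠ 0)
    (hpos : ∀ n t, 1 ≤ t → 1 ≤ n + t → D.ℓ n t * s t = s (n + t) * t)
    (hneg : ∀ n t, t ≤ -1 → n + t ≤ -1 → D.ℓ n t * s' t = s' (n + t) * t) : D.IsPunctured := by
  let σ : ℤ → ℂ := fun t => if 0 < t then s t else s' t
  have hσ : ∀ t, σ t ≠ 0 := fun t => by
    dsimp only [σ]; split_ifs
    exacts [hs t, hs' t]
  have hσ1 : ∀ t, 1 ≤ t → σ t = s t := fun t ht => if_pos (by lia)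
  have hσ2 : ∀ t, t ≤ -1 → σ t = s' t := fun t ht => if_neg (by lia)
  obtain ⟨κ, hκ, h1, h2⟩ := cross_terms (D := D.rescale σ hσ) hc hS
    (fun n t ht hnt => by
      change σ t * D.ℓ n t / σ (n + t) = t
      rw [div_eq_iff (hσ _), hσ1 t ht, hσ1 _ hnt]
      linear_combination hpos n t ht hnt)
    (fun n t ht hnt => by
      change σ t * D.ℓ n t / σ (n + t) = t
      rw [div_eq_iff (hσ _), hσ2 t ht, hσ2 _ hnt]
      linear_combination hneg n t ht hnt)
  -- Multiplying the scale of one half by `κ` absorbs the gluing constant.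
  refine ⟨hw, hS, fun t => if 0 < t then κ * s t else s' t, fun t => ?_, fun n t ht hnt => ?_⟩
  · dsimp only; split_ifs
    exacts [mul_ne_zero hκ (hs t), hs' t]
  · dsimp only
    rcases lt_or_gt_of_ne ht with ht | ht <;> rcases lt_or_gt_of_ne hnt with hnt | hnt
    · rw [if_neg (by lia), if_neg (by lia)]
      exact hneg n t (by lia) (by lia)
    · rw [if_neg (by lia), if_pos (by lia)]
      have := h1 n t (by lia) (by lia)
      change σ t * D.ℓ n t / σ (n + t) = _ at this
      rw [div_eq_iff (hσ _), hσ2 t (by lia), hσ1 _ (by lia)] at this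
      linear_combination this
    · rw [if_pos (by lia), if_neg (by lia)]
      have := h2 n t (by lia) (by lia)
      change σ t * D.ℓ n t / σ (n + t) * κ = _ at this
      rw [div_mul_eq_mul_div, div_eq_iff (hσ _), hσ1 t (by lia), hσ2 _ (by lia)] at this
      linear_combination this
    · rw [if_pos (by lia), if_pos (by lia)]
      linear_combination κ * hpos n t (by lia) (by lia)

theorem classify_of_ray {T : ℤ} (hT : ∀ t, T ≤ t → t ∈ D.S) :
    D.c = 0 ∧ (D.IsGlobal ∨ D.IsPunctured) := by
  obtain ⟨hc, h | ⟨hw, hS, s, hs, h⟩⟩ := ray_dichotomy hT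
  · exact ⟨hc, Or.inl h⟩
  refine ⟨hc, ?_⟩
  -- If `v_{1-n}` were missing, `[L(-n), L(n)]` on `v_1` would give `L(-n)L(n) v_1 = 2n v_1`, while
  -- the `A_{0,0}` form on the positive half gives `(n + 1) v_1`. These agree only for `n = 1`.
  have hneg : ∀ n, 2 ≤ n → 1 - n ∈ D.S := by
    intro n hn
    by_contra hcon
    have e := D.comm_of_zero (n := n) (t := 1) (a := n + 1) (b := 1 - n) (hS 1 le_rfl) rfl
      (by ring)
    rw [D.source _ _ hcon, hc, hw] at e
    have e1 := h n 1 le_rfl (by lia)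
    have e2 := h (-n) (n + 1) (by lia) (by lia)
    rw [show -n + (n + 1) = 1 by ring] at e2
    rw [hw] at e1 e2
    push_cast at e e1 e2
    have e3 : ((n : ℂ) - 1) * s 1 = 0 := by
      linear_combination -s 1 * e + D.ℓ (-n) (n + 1) * e1 + e2
    have : (n : ℂ) - 1 = 0 := by simpa [hs 1] using e3
    have : n = 1 := by exact_mod_cast sub_eq_zero.1 this
    lia
  have hflip : ∀ t, 1 ≤ t → t ∈ D.flip.S := fun t ht => by
    have := hneg (t + 1) (by lia)
    rwa [show 1 - (t + 1) = -t by ring] at this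
  obtain ⟨-, h' | ⟨-, -, s', hs', h'⟩⟩ := ray_dichotomy hflip
  · exact Or.inl h'.of_flip
  · right
    refine isPunctured_of_halves hw hc (fun t ht => ?_) hs (s' := fun t => s' (-t))
      (fun t => hs' _) (fun n t ht hnt => ?_) (fun n t ht hnt => ?_)
    · rcases lt_or_gt_of_ne ht with ht | ht
      · have := hneg (1 - t) (by lia)
        rwa [sub_sub_cancel] at this
      · exact hS t ht
    · have := h n t ht hnt
      rw [hw] at this
      linear_combination this
    · have := h' (-n) (-t) (by lia) (by lia)
      simp only [flip, hw, neg_neg] at this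
      rw [← neg_add] at this
      push_cast at this
      linear_combination -this

theorem IsPunctured.of_flip (h : D.flip.IsPunctured) : D.IsPunctured := by
  obtain ⟨hw, hS, s, hs, h⟩ := h
  refine ⟨neg_eq_zero.1 hw, fun t ht => ?_, fun t => s (-t), fun t => hs _, fun n t ht hnt => ?_⟩
  · have := hS (-t) (by lia)
    simpa [flip] using this
  · have := h (-n) (-t) (by lia) (by lia)
    simp only [flip, neg_neg] at this
    rw [← neg_add] at this
    push_cast at this
    linear_combination -this

/-- Weight modules over the Virasoro algebra with weight multiplicities at most one. -/
theorem classify (hne : D.S.Nonempty) :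
    D.c = 0 ∧ ((D.S = {0} ∧ D.wt = 0) ∨ D.IsGlobal ∨ D.IsPunctured) := by
  by_cases hr : ∃ T, ∀ t, T ≤ t → t ∈ D.S
  · obtain ⟨T, hT⟩ := hr
    exact (classify_of_ray hT).imp_right Or.inr
  by_cases hl : ∃ T, ∀ t, t ≤ T → t ∈ D.S
  · obtain ⟨T, hT⟩ := hl
    obtain ⟨h1, h2⟩ := classify_of_ray (D := D.flip) (T := -T) fun t ht => hT (-t) (by lia)
    exact ⟨neg_eq_zero.1 h1, Or.inr (h2.imp IsGlobal.of_flip IsPunctured.of_flip)⟩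
  · obtain ⟨h1, h2, h3⟩ := D.support_of_no_ray hr hl hne
    exact ⟨h3, Or.inl ⟨h1, h2⟩⟩

end VirSystem

/-! ### The Heisenberg operators over a known Virasoro action. -/

theorem const_of_succ {g : ℤ → ℂ} (h : ∀ t, g (t + 1) = g t) (t t' : ℤ) : g t = g t' := by
  have : ∀ t, g t = g 0 := fun t => by
    induction t using Int.induction_on with
    | zero => rfl
    | succ i ih => rw [h, ih]
    | pred i ih => rw [← ih, ← h]; congr 1; ring
  rw [this t, this t']

/-- The Heisenberg part on a ray on which the Virasoro algebra acts as on `A_{wt,0}`. -/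
theorem heisenberg_on_ray {wt c₀ z k : ℂ} {f : ℤ → ℤ → ℂ} {T : ℤ}
    (hμ : ∀ t : ℤ, T ≤ t → wt + t ≠ 0) (hf : ∀ t, T ≤ t → f 0 t = c₀)
    (LI : ∀ m n t : ℤ, T ≤ t → T ≤ n + t → T ≤ m + t → T ≤ m + n + t →
      (wt + (n + t)) * f n t - f n (m + t) * (wt + t)
        = n * f (m + n) t + if m + n = 0 then ((m : ℂ) ^ 2 - m) * z else 0)
    (II : ∀ m n t : ℤ, T ≤ t → T ≤ n + t → T ≤ m + t → T ≤ m + n + t →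
      f m (n + t) * f n t - f n (m + t) * f m t = if m + n = 0 then (n : ℂ) * k else 0) :
    z = 0 ∧ k = 0 ∧ ∃ H, (H = 0 ∨ H = c₀) ∧
      ∀ n t : ℤ, T + 1 ≤ t → T ≤ n + t → f n t = c₀ - n * H / (wt + t + n) := by
  -- `[L(1), I(-1)] = -I(0)` carries no central term, since `m² - m = 0` at `m = 1`; it makes this
  -- expression independent of `t`.
  obtain ⟨H, hH⟩ : ∃ H, ∀ t, T + 1 ≤ t → (wt + t - 1) * (f (-1) t - c₀) = H := by
    refine ⟨(wt + (T + 1) - 1) * (f (-1) (T + 1) - c₀), fun t ht => ?_⟩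
    induction t, ht using Int.leInduction with
    | base => push_cast; ring
    | succ t ht ih =>
      rw [← ih]
      have := LI 1 (-1) t (by lia) (by lia) (by lia) (by lia)
      rw [show (1 : ℤ) + -1 = 0 by ring, hf t (by lia), if_pos rfl, add_comm 1 t] at this
      push_cast at this ⊢
      linear_combination -this
  have hr : ∀ t, T + 1 ≤ t → f (-1) t = c₀ + H / (wt + t - 1) := by
    intro t ht
    have h0 := hμ (t - 1) (by lia)
    push_cast at h0
    have h0 : wt + t - 1 ≠ 0 := by rwa [add_sub_assoc]
    have := hH t ht
    field_simp
    linear_combination this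
  -- From `[L(n+1), I(-1)] = -I(n)`. The bound `T + 1 ≤ t` is there because `I(-1) v_t` must still
  -- lie on the ray.
  have hform : ∀ n t : ℤ, T + 1 ≤ t → T ≤ n + t → f n t = c₀ - n * H / (wt + t + n) := by
    intro n t ht hnt
    have e := LI (n + 1) (-1) t (by lia) (by lia) (by lia) (by lia)
    rw [show n + 1 + -1 = n by ring, hr t ht, hr (n + 1 + t) (by lia)] at e
    have e0 : (if n = 0 then (((n + 1 : ℤ) : ℂ) ^ 2 - (n + 1 : ℤ)) * z else 0) = 0 := by
      split_ifs with h
      · simp [h]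
      · rfl
    rw [e0] at e
    have h0 := hμ (t - 1) (by lia)
    push_cast at h0
    have h0 : wt + t - 1 ≠ 0 := by rwa [add_sub_assoc]
    have h1 := hμ (n + t) hnt
    push_cast at e h1
    have h2 : wt + t + n ≠ 0 := by convert h1 using 1; ring
    rw [show wt + ((n : ℂ) + 1 + t) - 1 = wt + t + n by ring] at e
    field_simp at e ⊢
    apply mul_left_cancel₀ h0
    linear_combination e
  have e1 : ∀ n : ℕ, wt + T + n ≠ 0 := fun n => by
    have := hμ (T + n) (by lia)
    push_cast at this
    rwa [← add_assoc] at this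
  have hz : z = 0 := by
    have e := LI (-2) 2 (T + 3) (by lia) (by lia) (by lia) (by lia)
    rw [show -2 + (2 : ℤ) = 0 by ring, if_pos rfl, hf _ (by lia),
      hform 2 _ (by lia) (by lia), hform 2 _ (by lia) (by lia)] at e
    have a1 := e1 3
    have a2 := e1 5
    push_cast at e a1 a2
    rw [show wt + ((T : ℂ) + 3) + 2 = wt + T + 5 by ring,
      show wt + (-2 + ((T : ℂ) + 3)) + 2 = wt + T + 3 by ring,
      show wt + (2 + ((T : ℂ) + 3)) = wt + T + 5 by ring,
      show wt + ((T : ℂ) + 3) = wt + T + 3 by ring] at e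
    field_simp at e
    linear_combination -e / 6
  -- `I(2)` and `I(1)` commute, which is quadratic in `H`. The root `H = c₀` is `A_{wt,1}` rescaled
  -- to look like `A_{wt,0}`.
  have hHc : H = 0 ∨ H = c₀ := by
    have e := II 2 1 (T + 1) (by lia) (by lia) (by lia) (by lia)
    rw [if_neg (by norm_num), hform 2 _ (by lia) (by lia), hform 1 _ (by lia) (by lia),
      hform 1 _ (by lia) (by lia), hform 2 _ (by lia) (by lia)] at e
    have a2 := e1 2
    have a3 := e1 3
    have a4 := e1 4
    push_cast at e a2 a3 a4
    rw [show wt + (1 + ((T : ℂ) + 1)) + 2 = wt + T + 4 by ring,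
      show wt + ((T : ℂ) + 1) + 1 = wt + T + 2 by ring,
      show wt + (2 + ((T : ℂ) + 1)) + 1 = wt + T + 4 by ring,
      show wt + ((T : ℂ) + 1) + 2 = wt + T + 3 by ring] at e
    field_simp at e
    have : H * (H - c₀) = 0 := by linear_combination e / 2
    rcases mul_eq_zero.1 this with h | h
    · exact Or.inl h
    · exact Or.inr (sub_eq_zero.1 h)
  have hk : k = 0 := by
    have e := II (-1) 1 (T + 2) (by lia) (by lia) (by lia) (by lia)
    rw [if_pos (by norm_num), hform 1 _ (by lia) (by lia), hform 1 _ (by lia) (by lia),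
      hform (-1) _ (by lia) (by lia), hform (-1) _ (by lia) (by lia)] at e
    have a1 := e1 1
    have a2 := e1 2
    have a3 := e1 3
    push_cast at e a1 a2 a3
    rw [show wt + (1 + ((T : ℂ) + 2)) + -1 = wt + T + 2 by ring,
      show wt + ((T : ℂ) + 2) + 1 = wt + T + 3 by ring,
      show wt + (-1 + ((T : ℂ) + 2)) + 1 = wt + T + 2 by ring,
      show wt + ((T : ℂ) + 2) + -1 = wt + T + 1 by ring] at e
    rcases hHc with rfl | rfl
    · linear_combination -e
    · field_simp at e
      apply mul_left_cancel₀ (mul_ne_zero a1 (mul_ne_zero a3 a2))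
      linear_combination -e
  exact ⟨hz, hk, H, hHc, hform⟩

/-- The Heisenberg part on a density module `A_{wt,b}` with `b ≠ 0, 1`. -/
theorem heisenberg_on_density {wt b c₀ z : ℂ} {f : ℤ → ℤ → ℂ} (hb₀ : b ≠ 0) (hb₁ : b ≠ 1)
    (hf : ∀ t, f 0 t = c₀)
    (LI : ∀ m n t : ℤ, (wt + (n + t) + b * m) * f n t - f n (m + t) * (wt + t + b * m)
        = n * f (m + n) t + if m + n = 0 then ((m : ℂ) ^ 2 - m) * z else 0) :
    z = 0 ∧ ∀ n t, f n t = c₀ := by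
  let r : ℤ → ℂ := fun t => f (-1) t - c₀
  have hr : ∀ t, f (-1) t = c₀ + r t := fun t => by simp [r]
  obtain ⟨H, hH⟩ : ∃ H, ∀ t : ℤ, (wt + t + b - 1) * r t = H := by
    refine ⟨_, fun t => const_of_succ (g := fun t : ℤ => (wt + t + b - 1) * r t) ?_ t 0⟩
    intro t
    have := LI 1 (-1) t
    rw [show (1 : ℤ) + -1 = 0 by ring, hf t, if_pos rfl, add_comm 1 t, hr, hr] at this
    push_cast at this ⊢
    linear_combination -this
  have hform : ∀ n t : ℤ, f n t = c₀ + (wt + t + b * (n + 1)) * r (n + 1 + t)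
      - (wt + t - 1 + b * (n + 1)) * r t := by
    intro n t
    have e := LI (n + 1) (-1) t
    have e0 : (if n = 0 then (((n + 1 : ℤ) : ℂ) ^ 2 - (n + 1 : ℤ)) * z else 0) = 0 := by
      split_ifs with h
      · simp [h]
      · rfl
    rw [show n + 1 + -1 = n by ring, hr, hr, e0] at e
    push_cast at e
    linear_combination e
  -- The relation `[L(-1), I(1)] = I(0) + 2 C_LI` has not been used in determining the `I(n)`, so it
  -- is a genuine constraint on `r` and `z`.
  have hcon : ∀ t : ℤ, (wt + t + 1 - b) * ((wt + t + 2 * b) * r (t + 2)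
      - (wt + t - 1 + 2 * b) * r t) - (wt + t - b) * ((wt + t - 1 + 2 * b) * r (t + 1)
      - (wt + t - 2 + 2 * b) * r (t - 1)) = 2 * z := by
    intro t
    have e := LI (-1) 1 t
    rw [show (-1 : ℤ) + 1 = 0 by ring, hf t, if_pos rfl, hform, hform] at e
    rw [show 1 + 1 + t = t + 2 by ring, show 1 + 1 + (-1 + t) = t + 1 by ring,
      show -1 + t = t - 1 by ring] at e
    push_cast at e
    linear_combination e
  obtain ⟨T, hT⟩ := VirSystem.exists_ne_zero_from (wt + b - 2)
  -- Substituting `r = H / (wt + t + b - 1)` and clearing denominators gives a polynomial identity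
  -- in `y = wt + t + b`. The leading coefficient yields `z = 0` and the constant term `H b (1 - b)
  -- = 0`.
  have hinf := infinite_of_progression (d := 1) (a := wt + T + b) (P := fun y =>
    0 * y ^ 5 + (2 * z) * y ^ 4 + (-4 * z) * y ^ 3 + (-2 * z) * y ^ 2
      + (4 * z - 2 * (4 * H * b * (1 - b))) * y + (4 * H * b * (1 - b)) = 0)
    one_ne_zero fun j => by
      have hn : ∀ i : ℕ, wt + (T + j) + b - 2 + i ≠ 0 := fun i => by
        have := hT (T + j + i) (by lia)
        push_cast at this
        convert this using 1; ring
      have e := hcon (T + j)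
      have r0 := hH (T + j - 1)
      have r1 := hH (T + j)
      have r2 := hH (T + j + 1)
      have r3 := hH (T + j + 2)
      push_cast at e r0 r1 r2 r3
      obtain ⟨y, hy⟩ : ∃ y, y = wt + T + b + 1 * (j : ℂ) := ⟨_, rfl⟩
      have hw : wt = y - (T + j) - b := by rw [hy]; ring
      have n0 := hn 0
      have n1 := hn 1
      have n2 := hn 2
      have n3 := hn 3
      push_cast at n0 n1 n2 n3
      rw [hw] at n0 n1 n2 n3 e r0 r1 r2 r3
      have m0 : y - 2 ≠ 0 := by convert n0 using 1; ring
      have m1 : y - 1 ≠ 0 := by convert n1 using 1; ring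
      have m2 : y ≠ 0 := by convert n2 using 1; ring
      have m3 : y + 1 ≠ 0 := by convert n3 using 1; ring
      have q0 : r (T + j - 1) = H / (y - 2) := by
        rw [eq_div_iff m0]; linear_combination r0
      have q1 : r (T + j) = H / (y - 1) := by
        rw [eq_div_iff m1]; linear_combination r1
      have q2 : r (T + j + 1) = H / y := by
        rw [eq_div_iff m2]; linear_combination r2
      have q3 : r (T + j + 2) = H / (y + 1) := by
        rw [eq_div_iff m3]; linear_combination r3
      rw [q0, q1, q2, q3] at e
      rw [← hy]
      field_simp at e
      linear_combination -e
  obtain ⟨-, h4, -, -, -, h0⟩ := coeffs_eq_zero_of_infinite hinf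
  have hz : z = 0 := by simpa using h4
  have hb : b * (1 - b) ≠ 0 := mul_ne_zero hb₀ (sub_ne_zero.2 hb₁.symm)
  have hH0 : H = 0 := by
    apply mul_right_cancel₀ hb
    linear_combination h0 / 4
  have hr1 : ∀ t : ℤ, wt + t + b - 1 ≠ 0 → r t = 0 := fun t ht => by
    have := hH t
    rw [hH0] at this
    exact (mul_eq_zero.1 this).resolve_left ht
  -- `H = 0` leaves open the one index where `wt + t + b = 1`. There the constraint reduces to `b (1
  -- - b) r t = 0`, all neighbouring values being zero.
  have hr0 : ∀ t, r t = 0 := by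
    intro t
    by_cases ht : wt + t + b - 1 = 0
    · have e := hcon t
      rw [hr1 (t + 2), hr1 (t + 1), hr1 (t - 1), hz] at e
      · have hw : wt = 1 - b - t := by linear_combination ht
        rw [hw] at e
        apply mul_left_cancel₀ hb
        linear_combination -e / 2
      all_goals
        push_cast
        intro h
      · have : (1 : ℂ) = 0 := by linear_combination ht - h
        exact one_ne_zero this
      · have : (1 : ℂ) = 0 := by linear_combination h - ht
        exact one_ne_zero this
      · have : (2 : ℂ) = 0 := by linear_combination h - ht
        exact two_ne_zero this
    · exact hr1 t ht
  refine ⟨hz, fun n t => ?_⟩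
  rw [hform, hr0, hr0]; ring

/-! ### Systems for the twisted algebra, and the case without degeneration. -/

/-- Structure constants of a weight module over the twisted Heisenberg–Virasoro algebra with
weights in `wt + ℤ` of multiplicity at most one, on which `C_L, C_LI, C_I, I(0)` act by the scalars
`c, z, k, c₀`, and `I(n) v_t = f n t • v_{n+t}`. -/
structure HVSystem extends VirSystem where
  z : ℂ
  k : ℂ
  c₀ : ℂ
  f : ℤ → ℤ → ℂ
  f_source : ∀ n t, t ∉ S → f n t = 0
  f_target : ∀ n t, n + t ∉ S → f n t = 0
  f_zero : ∀ t ∈ S, f 0 t = c₀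
  LI : ∀ m n, ∀ t ∈ S, ℓ m (n + t) * f n t - f n (m + t) * ℓ m t
    = n * f (m + n) t + if m + n = 0 then ((m : ℂ) ^ 2 - m) * z else 0
  II : ∀ m n, ∀ t ∈ S, f m (n + t) * f n t - f n (m + t) * f m t
    = if m + n = 0 then (n : ℂ) * k else 0

namespace HVSystem

/-- The system with respect to the rescaled basis `s t • v_t`. -/
def rescale (D : HVSystem) (s : ℤ → ℂ) (hs : ∀ t, s t ≠ 0) : HVSystem where
  toVirSystem := D.toVirSystem.rescale s hs
  z := D.z
  k := D.k
  c₀ := D.c₀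
  f n t := s t * D.f n t / s (n + t)
  f_source n t h := by rw [D.f_source _ _ h]; simp
  f_target n t h := by rw [D.f_target _ _ h]; simp
  f_zero t h := by rw [D.f_zero t h, zero_add]; field_simp [hs t]
  LI m n t h := by
    have := D.LI m n t h
    change s (n + t) * D.ℓ m (n + t) / s (m + (n + t)) * (s t * D.f n t / s (n + t))
      - s (m + t) * D.f n (m + t) / s (n + (m + t)) * (s t * D.ℓ m t / s (m + t)) = _
    rw [show m + (n + t) = m + n + t by ring, show n + (m + t) = m + n + t by ring]
    have h1 := hs t
    have h2 := hs (n + t)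
    have h3 := hs (m + t)
    have h4 := hs (m + n + t)
    have e : (if m + n = 0 then ((m : ℂ) ^ 2 - m) * D.z else 0)
        = s t / s (m + n + t) * (if m + n = 0 then ((m : ℂ) ^ 2 - m) * D.z else 0) := by
      split_ifs with h0
      · rw [h0, zero_add, div_self h1, one_mul]
      · simp
    rw [e]
    generalize (if m + n = 0 then ((m : ℂ) ^ 2 - m) * D.z else 0) = x at *
    field_simp
    linear_combination this
  II m n t h := by
    have := D.II m n t h
    rw [show m + (n + t) = m + n + t by ring, show n + (m + t) = m + n + t by ring]
    have h1 := hs t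
    have h2 := hs (n + t)
    have h3 := hs (m + t)
    have h4 := hs (m + n + t)
    have e : (if m + n = 0 then (n : ℂ) * D.k else 0)
        = s t / s (m + n + t) * (if m + n = 0 then (n : ℂ) * D.k else 0) := by
      split_ifs with h0
      · rw [h0, zero_add, div_self h1, one_mul]
      · simp
    rw [e]
    generalize (if m + n = 0 then (n : ℂ) * D.k else 0) = x at *
    field_simp
    linear_combination this

variable (D : HVSystem)

theorem LI_of {m n t a b d : ℤ} (ht : t ∈ D.S) (ha : n + t = a) (hb : m + t = b)
    (hd : m + n = d) : D.ℓ m a * D.f n t - D.f n b * D.ℓ m t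
      = n * D.f d t + if d = 0 then ((m : ℂ) ^ 2 - m) * D.z else 0 := by
  subst ha hb hd; exact D.LI m n t ht

theorem LI_of_z {m n t a b d : ℤ} (hz : D.z = 0) (ht : t ∈ D.S) (ha : n + t = a) (hb : m + t = b)
    (hd : m + n = d) : D.ℓ m a * D.f n t - D.f n b * D.ℓ m t = n * D.f d t := by
  rw [D.LI_of ht ha hb hd, hz, mul_zero, ite_self, add_zero]

theorem II_of {m n t a b d : ℤ} (ht : t ∈ D.S) (ha : n + t = a) (hb : m + t = b)
    (hd : m + n = d) : D.f m a * D.f n t - D.f n b * D.f m t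
      = if d = 0 then (n : ℂ) * D.k else 0 := by
  subst ha hb hd; exact D.II m n t ht

/-- After rescaling, the structure constants are those of a listed module. -/
def IsModel (p : Param) : Prop :=
  D.S = Set.univ ∧ D.c = 0 ∧ D.z = 0 ∧ D.k = 0 ∧ ∃ s : ℤ → ℂ, (∀ t, s t ≠ 0) ∧
    (∀ n t, D.ℓ n t * s t = s (n + t) * p.coeffs.ℓ n t) ∧
    ∀ n t, D.f n t * s t = s (n + t) * p.coeffs.f n t

variable {D}

theorem IsModel.of_rescale {s : ℤ → ℂ} {hs : ∀ t, s t ≠ 0} {p : Param}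
    (h : (D.rescale s hs).IsModel p) : D.IsModel p := by
  obtain ⟨hS, hc, hz, hk, s', hs', h1, h2⟩ := h
  refine ⟨hS, hc, hz, hk, fun t => s t * s' t, fun t => mul_ne_zero (hs t) (hs' t),
    fun n t => ?_, fun n t => ?_⟩
  · have := h1 n t
    have e := hs (n + t)
    change s t * D.ℓ n t / s (n + t) * s' t = _ at this
    field_simp at this
    linear_combination this
  · have := h2 n t
    have e := hs (n + t)
    change s t * D.f n t / s (n + t) * s' t = _ at this
    field_simp at this
    linear_combination this

theorem isModel_of_density {b : ℂ} (hS : D.S = Set.univ) (hc : D.c = 0) (hb₀ : b ≠ 0)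
    (hb₁ : b ≠ 1) (hℓ : ∀ n t, D.ℓ n t = D.wt + t + b * n) :
    D.IsModel (.A D.wt b D.c₀) := by
  have hS' : ∀ t, t ∈ D.S := fun t => by rw [hS]; trivial
  obtain ⟨hz, hf⟩ := heisenberg_on_density hb₀ hb₁ (fun t => D.f_zero t (hS' t))
    (fun m n t => by
      have := D.LI m n t (hS' t)
      rw [hℓ, hℓ] at this
      push_cast at this
      exact this)
  have hk : D.k = 0 := by
    have := D.II (-1) 1 0 (hS' 0)
    rw [hf, hf, hf, hf, if_pos (by norm_num)] at this
    push_cast at this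
    linear_combination -this
  refine ⟨hS, hc, hz, hk, fun _ => 1, fun _ => one_ne_zero, fun n t => ?_, fun n t => ?_⟩
  · simp [hℓ, Param.coeffs, coeffsA]
  · simp [hf, Param.coeffs, coeffsA]

theorem exists_isModel_of_functions (hS : D.S = Set.univ) (hc : D.c = 0)
    (hμ : ∀ t : ℤ, D.wt + t ≠ 0) (hℓ : ∀ n t, D.ℓ n t = D.wt + t) :
    D.IsModel (.A D.wt 0 D.c₀) ∨ D.IsModel (.A D.wt 1 D.c₀) := by
  have hS' : ∀ t, t ∈ D.S := fun t => by rw [hS]; trivial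
  have ray : ∀ T : ℤ, D.z = 0 ∧ D.k = 0 ∧ ∃ H, (H = 0 ∨ H = D.c₀) ∧
      ∀ n t : ℤ, T + 1 ≤ t → T ≤ n + t → D.f n t = D.c₀ - n * H / (D.wt + t + n) := fun T =>
    heisenberg_on_ray (fun t _ => hμ t) (fun t _ => D.f_zero t (hS' t))
      (fun m n t _ _ _ _ => by
        have := D.LI m n t (hS' t)
        rw [hℓ, hℓ] at this
        push_cast at this
        exact this)
      (fun m n t _ _ _ _ => D.II m n t (hS' t))
  -- No weight vanishes, so rays may start arbitrarily far down. Their constants `H` agree because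
  -- any two rays overlap; the coefficient of `I(-1)` on `v_2` is compared.
  obtain ⟨hz, hk, H, hH, h0⟩ := ray 0
  have hform : ∀ n t : ℤ, D.f n t = D.c₀ - n * H / (D.wt + t + n) := by
    intro n t
    obtain ⟨-, -, H', -, h'⟩ := ray (min 0 (min (t - 1) (n + t)))
    have e1 := h0 (-1) 2 (by lia) (by lia)
    rw [h' (-1) 2 (by lia) (by lia)] at e1
    have h1 := hμ 1
    push_cast at e1 h1
    rw [show D.wt + 2 + -1 = D.wt + 1 by ring] at e1
    field_simp at e1
    obtain rfl : H' = H := by linear_combination e1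
    exact h' n t (by lia) (by lia)
  rcases hH with rfl | rfl
  · left
    refine ⟨hS, hc, hz, hk, fun _ => 1, fun _ => one_ne_zero, fun n t => ?_, fun n t => ?_⟩
    · simp [hℓ, Param.coeffs, coeffsA]
    · simp [hform, Param.coeffs, coeffsA]
  · right
    -- For `H = c₀` the coefficient of `I(n)` is `c₀ (wt + t) / (wt + t + n)`, so this scale makes
    -- it constant and at the same time turns `b = 0` into `b = 1`.
    refine ⟨hS, hc, hz, hk, fun t => (D.wt + t)⁻¹, fun t => inv_ne_zero (hμ t),
      fun n t => ?_, fun n t => ?_⟩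
    all_goals
      have h1 := hμ t
      have h2 := hμ (n + t)
      push_cast at h2
      simp only [Param.coeffs, coeffsA, hℓ, hform]
      push_cast
    · rw [mul_inv_cancel₀ h1, one_mul, show D.wt + (t : ℂ) + n = D.wt + (n + t) by ring,
        inv_mul_cancel₀ h2]
    · rw [show D.wt + (t : ℂ) + n = D.wt + (n + t) by ring]
      field_simp
      ring

theorem exists_isModel_of_isGlobal (hc : D.c = 0) (h : D.IsGlobal) : ∃ p, D.IsModel p := by
  obtain ⟨hS, b, s, hb, hs, h⟩ := h
  have hμ : b = 0 ∨ b = 1 → ∀ t : ℤ, D.wt + t ≠ 0 := fun hb' =>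
    D.normalized.resolve_left fun h0 => hb ⟨h0, hb'⟩
  have hℓ : ∀ n t, (D.rescale s hs).ℓ n t = D.wt + t + b * n := fun n t => by
    change s t * D.ℓ n t / s (n + t) = _
    rw [div_eq_iff (hs _)]
    linear_combination h n t
  by_cases hb₀ : b = 0
  · subst hb₀
    have := exists_isModel_of_functions (D := D.rescale s hs) hS hc (hμ (Or.inl rfl))
      (fun n t => by rw [hℓ]; change D.wt + _ + _ = D.wt + _; ring)
    rcases this with h | h
    exacts [⟨_, h.of_rescale⟩, ⟨_, h.of_rescale⟩]
  by_cases hb₁ : b = 1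
  · subst hb₁
    have hμ := hμ (Or.inr rfl)
    have := exists_isModel_of_functions
      (D := (D.rescale s hs).rescale (fun t => D.wt + t) hμ) hS hc hμ
      (fun n t => by
        change (D.wt + t) * (D.rescale s hs).ℓ n t / (D.wt + (n + t : ℤ)) = D.wt + t
        rw [hℓ, div_eq_iff (hμ _)]
        push_cast; ring)
    rcases this with h | h
    exacts [⟨_, h.of_rescale.of_rescale⟩, ⟨_, h.of_rescale.of_rescale⟩]
  · exact ⟨_, (isModel_of_density (D := D.rescale s hs) hS hc hb₀ hb₁ hℓ).of_rescale⟩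

/-! ### The punctured case: Heisenberg operators away from weight zero. -/

/-- Away from the vector of weight zero the Virasoro algebra acts as on `A_{0,0}`. -/
structure PuncturedForm (D : HVSystem) : Prop where
  wt : D.wt = 0
  c : D.c = 0
  mem : ∀ t ≠ 0, t ∈ D.S
  ℓ : ∀ n t, t ≠ 0 → n + t ≠ 0 → D.ℓ n t = t

namespace PuncturedForm

variable {D : HVSystem}

theorem of_isPunctured (hc : D.c = 0) (h : D.IsPunctured) :
    ∃ s hs, (D.rescale s hs).PuncturedForm := by
  obtain ⟨hw, hS, s, hs, h⟩ := h
  refine ⟨s, hs, hw, hc, hS, fun n t ht hnt => ?_⟩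
  change s t * D.ℓ n t / s (n + t) = t
  rw [div_eq_iff (hs _)]
  linear_combination h n t ht hnt

theorem f_pos (h : D.PuncturedForm) : D.z = 0 ∧ D.k = 0 ∧ ∃ H, (H = 0 ∨ H = D.c₀) ∧
    ∀ n t : ℤ, 2 ≤ t → 1 ≤ n + t → D.f n t = D.c₀ - n * H / (t + n) := by
  have := heisenberg_on_ray (wt := 0) (c₀ := D.c₀) (z := D.z) (k := D.k) (f := D.f) (T := 1)
    (fun t ht => by rw [zero_add]; exact_mod_cast (by lia : t ≠ 0))
    (fun t ht => D.f_zero t (h.mem t (by lia)))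
    (fun m n t h1 h2 h3 h4 => by
      have := D.LI m n t (h.mem t (by lia))
      rw [h.ℓ _ _ (by lia) (by lia), h.ℓ _ _ (by lia) (by lia)] at this
      push_cast at this
      rw [zero_add, zero_add]
      exact this)
    (fun m n t h1 h2 h3 h4 => D.II m n t (h.mem t (by lia)))
  obtain ⟨hz, hk, H, hH, hf⟩ := this
  refine ⟨hz, hk, H, hH, fun n t ht hnt => ?_⟩
  have := hf n t (by lia) hnt
  rwa [zero_add] at this

/-- The reflection `n ↦ -n`, `t ↦ -t` turns the negative half into a ray. The charges `z` and `k`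
are already known to vanish, so no central terms have to be carried along. -/
theorem f_neg (h : D.PuncturedForm) : ∃ H, (H = 0 ∨ H = D.c₀) ∧
    ∀ n t : ℤ, t ≤ -2 → n + t ≤ -1 → D.f n t = D.c₀ - n * H / (t + n) := by
  obtain ⟨hz, hk, -⟩ := h.f_pos
  have := heisenberg_on_ray (wt := 0) (c₀ := D.c₀) (z := 0) (k := 0)
    (f := fun n t => D.f (-n) (-t)) (T := 1)
    (fun t ht => by rw [zero_add]; exact_mod_cast (by lia : t ≠ 0))
    (fun t ht => by
      rw [neg_zero]; exact D.f_zero (-t) (h.mem (-t) (by lia)))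
    (fun m n t h1 h2 h3 h4 => by
      have := D.LI_of (m := -m) (n := -n) (t := -t) (a := -(n + t)) (b := -(m + t))
        (d := -(m + n)) (h.mem _ (by lia)) (by ring) (by ring) (by ring)
      rw [h.ℓ _ _ (by lia) (by lia), h.ℓ _ _ (by lia) (by lia), hz] at this
      push_cast at this
      simp only [mul_zero, ite_self, add_zero] at this ⊢
      linear_combination -this)
    (fun m n t h1 h2 h3 h4 => by
      have := D.II_of (m := -m) (n := -n) (t := -t) (a := -(n + t)) (b := -(m + t))
        (d := -(m + n)) (h.mem _ (by lia)) (by ring) (by ring) (by ring)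
      rw [hk] at this
      simp only [mul_zero, ite_self] at this ⊢
      exact this)
  obtain ⟨-, -, H, hH, hf⟩ := this
  refine ⟨H, hH, fun n t ht hnt => ?_⟩
  have := hf (-n) (-t) (by lia) (by lia)
  simp only [neg_neg] at this
  rw [this]
  push_cast
  rw [show (0 : ℂ) + -t + -n = -(t + n) by ring, neg_mul, neg_div_neg_eq]

/-- If `I(0)` acts by zero then so do all `I(n)` away from the weight zero vector. -/
theorem f_eq_zero (h : D.PuncturedForm) (h0 : D.c₀ = 0) (n t : ℤ) (ht : t ≠ 0)
    (hnt : n + t ≠ 0) : D.f n t = 0 := by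
  obtain ⟨hz, -, H, hH, hp⟩ := h.f_pos
  obtain ⟨H', hH', hn⟩ := h.f_neg
  obtain rfl : H = 0 := by rcases hH with h | h <;> simp [h, h0]
  obtain rfl : H' = 0 := by rcases hH' with h | h <;> simp [h, h0]
  simp only [h0, mul_zero, zero_div, sub_zero] at hp hn
  have LI : ∀ m n t : ℤ, t ≠ 0 → n + t ≠ 0 → m + t ≠ 0 → m + n + t ≠ 0 →
      ((n : ℂ) + t) * D.f n t - D.f n (m + t) * t = n * D.f (m + n) t := by
    intro m n t h1 h2 h3 h4
    have := D.LI m n t (h.mem t h1)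
    rw [h.ℓ _ _ h2 (by lia), h.ℓ _ _ h1 h3, hz, mul_zero, ite_self, add_zero] at this
    exact_mod_cast this
  have down : ∀ t : ℤ, t ≠ 0 → t ≠ 1 → D.f (-1) t = 0 := by
    intro t h1 h2
    rcases lt_or_gt_of_ne h1 with h3 | h3
    · rcases eq_or_ne t (-1) with rfl | h4
      · have := LI 1 (-1) (-2) (by lia) (by lia) (by lia) (by lia)
        rw [show (1 : ℤ) + -1 = 0 by ring, D.f_zero _ (h.mem _ (by lia)), h0,
          hn (-1) (-2) (by lia) (by lia)] at this
        norm_num at this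
        exact this
      · exact hn _ _ (by lia) (by lia)
    · exact hp _ _ (by lia) (by lia)
  have up : ∀ t : ℤ, t ≠ 0 → t ≠ -1 → D.f 1 t = 0 := by
    intro t h1 h2
    rcases lt_or_gt_of_ne h1 with h3 | h3
    · exact hn _ _ (by lia) (by lia)
    · rcases eq_or_ne t 1 with rfl | h4
      · have := LI (-1) 1 2 (by lia) (by lia) (by lia) (by lia)
        rw [show -1 + (1 : ℤ) = 0 by ring, D.f_zero _ (h.mem _ (by lia)), h0,
          hp 1 2 (by lia) (by lia)] at this
        norm_num at this
        exact this
      · exact hp _ _ (by lia) (by lia)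
  rcases eq_or_ne n 0 with rfl | hn0
  · rw [D.f_zero _ (h.mem t ht), h0]
  -- `I(n)` is a commutator with `I(-1)` or with `I(1)`. The first is unusable when an `I(-1)` step
  -- would touch `v_0`; in those cases the `I(1)` steps avoid it.
  by_cases hd : t ≠ 1 ∧ n + t ≠ -1
  · have := LI (n + 1) (-1) t ht (by lia) (by lia) (by lia)
    rw [show n + 1 + -1 = n by ring, down t ht hd.1, down _ (by lia) (by lia)] at this
    push_cast at this
    linear_combination this
  · have := LI (n - 1) 1 t ht (by lia) (by lia) (by lia)
    rw [show n - 1 + 1 = n by ring, up t ht (by lia), up _ (by lia) (by lia)] at this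
    push_cast at this
    linear_combination -this

/-- If `v_0 = 0` then `I(3)I(-2) v_2 = 0`, hence also `I(-2)I(3) v_2 = 0`. For either value of `H`
this composite is a nonzero multiple of `c₀²`. -/
theorem c₀_eq_zero (h : D.PuncturedForm) (h0 : (0 : ℤ) ∉ D.S) : D.c₀ = 0 := by
  obtain ⟨-, hk, H, hH, hp⟩ := h.f_pos
  have e := D.II_of (m := 3) (n := -2) (t := 2) (a := 0) (b := 5) (d := 1)
    (h.mem 2 (by lia)) (by ring) (by ring) (by ring)
  rw [D.f_source _ _ h0, if_neg one_ne_zero, hp (-2) 5 (by lia) (by lia),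
    hp 3 2 (by lia) (by lia)] at e
  push_cast at e
  rcases hH with rfl | rfl
  · have : D.c₀ * D.c₀ = 0 := by linear_combination -e
    exact mul_self_eq_zero.1 this
  · have : D.c₀ * D.c₀ = 0 := by linear_combination -(3 / 2) * e
    exact mul_self_eq_zero.1 this

end PuncturedForm

/-! ### The vector of weight zero: arrows out of it and into it. -/

/-- Linear functions solve the equation. After subtracting the one that agrees with `ψ` at `1` and
`2`, the recursion with `m = 1` propagates the zeros. It cannot pass from `1` to `2`, where `n - m =
0`, which is why two values have to be matched. -/
theorem linear_of_cocycle {ψ : ℤ → ℂ} (h : ∀ m n : ℤ, m ≠ 0 → n ≠ 0 → m + n ≠ 0 →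
    n * ψ n - m * ψ m = ((n : ℂ) - m) * ψ (m + n)) :
    ∃ α β : ℂ, ∀ n : ℤ, n ≠ 0 → ψ n = α * n + β := by
  refine ⟨ψ 2 - ψ 1, 2 * ψ 1 - ψ 2, ?_⟩
  obtain ⟨χ, hχ⟩ : ∃ χ : ℤ → ℂ, ∀ n, χ n = ψ n - ((ψ 2 - ψ 1) * n + (2 * ψ 1 - ψ 2)) :=
    ⟨_, fun _ => rfl⟩
  have hc : ∀ m n : ℤ, m ≠ 0 → n ≠ 0 → m + n ≠ 0 →
      n * χ n - m * χ m = ((n : ℂ) - m) * χ (m + n) := by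
    intro m n hm hn hmn
    rw [hχ, hχ, hχ]
    push_cast
    linear_combination h m n hm hn hmn
  have h1 : χ 1 = 0 := by rw [hχ]; push_cast; ring
  have h2 : χ 2 = 0 := by rw [hχ]; push_cast; ring
  have hpos : ∀ n : ℤ, 2 ≤ n → χ n = 0 := by
    intro n hn
    induction n, hn using Int.leInduction with
    | base => exact h2
    | succ n hn ih =>
      have := hc 1 n (by lia) (by lia) (by lia)
      rw [ih, h1, add_comm] at this
      have h0 : (n : ℂ) - 1 ≠ 0 := sub_ne_zero.2 (by exact_mod_cast (by lia : n ≠ 1))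
      apply mul_left_cancel₀ h0
      push_cast at this
      linear_combination -this
  have hm1 : χ (-1) = 0 := by
    have := hc 2 (-1) (by lia) (by lia) (by lia)
    rw [show (2 : ℤ) + -1 = 1 by ring, h1, h2] at this
    push_cast at this
    linear_combination -this
  have hneg : ∀ n : ℕ, χ (-(n + 1)) = 0 := by
    intro n
    induction n with
    | zero => simpa using hm1
    | succ n ih =>
      have := hc 1 (-(n + 2)) (by lia) (by lia) (by lia)
      rw [show 1 + -((n : ℤ) + 2) = -(n + 1) by ring, ih, h1] at this
      have h0 : (n : ℂ) + 2 ≠ 0 := by exact_mod_cast (by lia : n + 2 ≠ 0)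
      rw [show -(((n + 1 : ℕ) : ℤ) + 1) = -((n : ℤ) + 2) by push_cast; ring]
      apply mul_left_cancel₀ h0
      push_cast at this
      linear_combination -this
  intro n hn
  rw [← sub_eq_zero, ← hχ]
  rcases lt_or_gt_of_ne hn with h | h
  · obtain ⟨j, rfl⟩ : ∃ j : ℕ, n = -((j : ℤ) + 1) := ⟨(-n - 1).toNat, by lia⟩
    exact hneg j
  · rcases eq_or_ne n 1 with rfl | h'
    · exact h1
    · exact hpos n (by lia)

namespace PuncturedForm

variable {D : HVSystem}

theorem univ (h : D.PuncturedForm) (h0 : (0 : ℤ) ∈ D.S) : D.S = Set.univ :=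
  Set.eq_univ_of_forall fun t => by
    by_cases ht : t = 0
    · rwa [ht]
    · exact h.mem t ht

theorem ℓ_zero_zero (h : D.PuncturedForm) : D.ℓ 0 0 = 0 := by
  by_cases h0 : (0 : ℤ) ∈ D.S
  · rw [D.zero 0 h0, h.wt]; simp
  · exact D.source _ _ h0

theorem exists_linear_out (h : D.PuncturedForm) (h0 : (0 : ℤ) ∈ D.S) :
    ∃ α β : ℂ, ∀ n : ℤ, n ≠ 0 → D.ℓ n 0 = α * n + β := by
  refine linear_of_cocycle fun m n hm hn hmn => ?_
  have := D.comm_of_ne (m := m) (n := n) h0 (add_zero n) (add_zero m) rfl hmn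
  rw [h.ℓ m n hn hmn, h.ℓ n m hm (by lia)] at this
  exact this

/-- For the arrows into `v_0`, dividing by `n` turns the commutator identity into the cocycle
equation satisfied by the arrows out of `v_0`. -/
theorem exists_linear_in (h : D.PuncturedForm) :
    ∃ α β : ℂ, ∀ n : ℤ, n ≠ 0 → D.ℓ n (-n) = n * (α * n + β) := by
  obtain ⟨α, β, hψ⟩ := linear_of_cocycle (ψ := fun n : ℤ => D.ℓ n (-n) / n)
    fun m n hm hn hmn => by
      have := D.comm_of_ne (m := m) (n := n) (t := -(m + n)) (a := -m) (b := -n) (d := m + n)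
        (h.mem _ (by lia)) (by ring) (by ring) (by ring) hmn
      rw [h.ℓ n (-(m + n)) (by lia) (by lia), h.ℓ m (-(m + n)) (by lia) (by lia)] at this
      have hm' : (m : ℂ) ≠ 0 := by exact_mod_cast hm
      have hn' : (n : ℂ) ≠ 0 := by exact_mod_cast hn
      have hmn' : (m : ℂ) + n ≠ 0 := by exact_mod_cast hmn
      push_cast at this ⊢
      field_simp
      linear_combination this
  refine ⟨α, β, fun n hn => ?_⟩
  have hn' : (n : ℂ) ≠ 0 := by exact_mod_cast hn
  have := hψ n hn
  field_simp at this
  linear_combination this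

/-- Either no vector maps into, or the weight zero vector does not map out. -/
theorem out_or_in_eq_zero (h : D.PuncturedForm) (h0 : (0 : ℤ) ∈ D.S) :
    (∀ n : ℤ, n ≠ 0 → D.ℓ n 0 = 0) ∨ ∀ n : ℤ, n ≠ 0 → D.ℓ n (-n) = 0 := by
  -- The path `-n → 0 → m` is compared with `-n → m - n → m`. The latter and the commutator term
  -- cancel exactly, so the product of the two arrows at `v_0` is zero.
  have prod : ∀ m n : ℤ, m ≠ 0 → n ≠ 0 → m ≠ n → D.ℓ m 0 = 0 ∨ D.ℓ n (-n) = 0 := by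
    intro m n hm hn hmn
    have := D.comm_of (m := m) (n := n) (t := -n) (a := 0) (b := m - n) (d := m + n)
      (h.mem _ (by lia)) (by ring) (by ring) rfl
    rw [h.ℓ n (m - n) (by lia) (by lia), h.ℓ m (-n) (by lia) (by lia),
      h.ℓ (m + n) (-n) (by lia) (by lia), h.c, mul_zero, ite_self] at this
    rw [← mul_eq_zero]
    push_cast at this
    linear_combination this
  by_contra! hcon
  obtain ⟨⟨m, hm, hm'⟩, n, hn, hn'⟩ := hcon
  have h1 : m = n := by
    by_contra hmn
    rcases prod m n hm hn hmn with h | h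
    exacts [hm' h, hn' h]
  subst h1
  obtain ⟨α, β, hα⟩ := h.exists_linear_out h0
  -- The products leave open the case of equal indices `m = n`. A nonzero linear function cannot
  -- vanish at all nonzero integers but one, so another index is available.
  obtain ⟨j, hj, hjm, hj'⟩ : ∃ j : ℤ, j ≠ 0 ∧ j ≠ m ∧ D.ℓ j 0 ≠ 0 := by
    by_contra! hall
    obtain ⟨i, j, hi, hj, hij, him, hjm⟩ : ∃ i j : ℤ, i ≠ 0 ∧ j ≠ 0 ∧ i ≠ j ∧ i ≠ m ∧ j ≠ m := by
      by_cases h1 : 0 < m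
      · exact ⟨-1, -2, by lia, by lia, by lia, by lia, by lia⟩
      · exact ⟨1, 2, by lia, by lia, by lia, by lia, by lia⟩
    have e1 := hall i hi him
    have e2 := hall j hj hjm
    rw [hα i hi] at e1
    rw [hα j hj] at e2
    have hα0 : α = 0 := by
      have : ((i : ℂ) - j) ≠ 0 := sub_ne_zero.2 (by exact_mod_cast hij)
      apply mul_right_cancel₀ this
      linear_combination e1 - e2
    rw [hα0] at e1
    apply hm'
    rw [hα m hm, hα0]
    linear_combination e1
  rcases prod j m hj hm hjm with h | h
  exacts [hj' h, hn' h]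

theorem isModel_functions (h : D.PuncturedForm) (h0 : (0 : ℤ) ∈ D.S) (hc₀ : D.c₀ ≠ 0)
    (hℓ : ∀ n t, D.ℓ n t = t) : D.IsModel (.A 0 0 D.c₀) := by
  have hS := h.univ h0
  have hS' : ∀ t, t ∈ D.S := fun t => by rw [hS]; trivial
  obtain ⟨hz, hk, -⟩ := h.f_pos
  have LI : ∀ m n t : ℤ, ((n : ℂ) + t) * D.f n t - D.f n (m + t) * t = n * D.f (m + n) t := by
    intro m n t
    have := D.LI m n t (hS' t)
    rw [hℓ, hℓ, hz, mul_zero, ite_self, add_zero] at this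
    exact_mod_cast this
  have hr : ∀ t : ℤ, t ≠ 1 → D.f (-1) t = D.c₀ := by
    intro t ht
    have := const_of_succ (g := fun t : ℤ => ((t : ℂ) - 1) * (D.f (-1) t - D.c₀)) (fun t => by
      have := LI 1 (-1) t
      rw [show (1 : ℤ) + -1 = 0 by ring, D.f_zero t (hS' t), add_comm 1 t] at this
      push_cast at this ⊢
      linear_combination -this) t 1
    push_cast at this
    rw [sub_self, zero_mul] at this
    have h1 : (t : ℂ) - 1 ≠ 0 := sub_ne_zero.2 (by exact_mod_cast ht)
    exact sub_eq_zero.1 ((mul_eq_zero.1 this).resolve_left h1)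
  have hf : ∀ n t : ℤ, D.f n t = t * D.f (-1) (n + 1 + t) - (t - 1) * D.c₀ := by
    intro n t
    have := LI (n + 1) (-1) t
    rw [show n + 1 + -1 = n by ring] at this
    push_cast at this
    by_cases ht : t = 1
    · subst ht
      push_cast at this ⊢
      linear_combination this
    · rw [hr t ht] at this
      linear_combination this
  -- The `L`–`I` relations leave this arrow into `v_0` free. Commutativity of `I(3)` and `I(1)` on
  -- `v_{-1}` fixes it, and needs `c₀ ≠ 0`.
  have hr1 : D.f (-1) 1 = D.c₀ := by
    have := D.II_of (m := 3) (n := 1) (t := -1) (a := 0) (b := 2) (d := 4) (hS' _)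
      (by ring) (by ring) (by ring)
    rw [hf 3 0, hf 1 (-1), hf 1 2, hf 3 (-1), hr (1 + 1 + 2) (by lia), hr (3 + 1 + -1) (by lia),
      if_neg (by lia), show (1 : ℤ) + 1 + -1 = 1 by ring] at this
    push_cast at this
    have e : D.c₀ * (D.f (-1) 1 - D.c₀) = 0 := by linear_combination -this
    exact sub_eq_zero.1 ((mul_eq_zero.1 e).resolve_left hc₀)
  have hall : ∀ n t : ℤ, D.f n t = D.c₀ := by
    intro n t
    rw [hf]
    by_cases e : n + 1 + t = 1
    · rw [e, hr1]; ring
    · rw [hr _ e]; ring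
  refine ⟨hS, h.c, hz, hk, fun _ => 1, fun _ => one_ne_zero, fun n t => ?_, fun n t => ?_⟩
  · simp [hℓ, Param.coeffs, coeffsA]
  · simp [hall, Param.coeffs, coeffsA]

/-- The `I(n)` with `n ≠ 0` leave `v_0` with one common coefficient `p`. Then `[L(n), I(-n)] = -n
I(0)` on `v_0` gives `p ≠ 0` and determines the Virasoro arrows into `v_0`; rescaling `v_0` by `c₀ /
p` brings the Virasoro action to that of `A_{0,0}`. -/
theorem isModel_of_out_eq_zero (h : D.PuncturedForm) (h0 : (0 : ℤ) ∈ D.S) (hc₀ : D.c₀ ≠ 0)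
    (hout : ∀ n : ℤ, n ≠ 0 → D.ℓ n 0 = 0) : D.IsModel (.A 0 0 D.c₀) := by
  obtain ⟨hz, hk, -⟩ := h.f_pos
  obtain ⟨p, hp⟩ : ∃ p, ∀ n : ℤ, n ≠ 0 → D.f n 0 = p := by
    refine ⟨D.f 1 0, fun n hn => ?_⟩
    by_cases h1 : n = 1
    · rw [h1]
    have := D.LI_of_z (m := 1 - n) (n := n) (t := 0) (a := n) (b := 1 - n) (d := 1) hz h0
      (by ring) (by ring) (by ring)
    rw [h.ℓ _ _ hn (by lia), hout _ (by lia)] at this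
    apply mul_left_cancel₀ (by exact_mod_cast hn : (n : ℂ) ≠ 0)
    linear_combination this
  have hε : ∀ n : ℤ, n ≠ 0 → D.ℓ n (-n) * p = -n * D.c₀ := by
    intro n hn
    have := D.LI_of_z (m := n) (n := -n) (t := 0) (a := -n) (b := n) (d := 0) hz h0
      (by ring) (by ring) (by ring)
    rw [hp _ (by lia), hout n hn, D.f_zero 0 h0] at this
    push_cast at this
    linear_combination this
  have hp0 : p ≠ 0 := by
    rintro rfl
    have := hε 1 one_ne_zero
    rw [mul_zero] at this
    push_cast at this
    exact hc₀ (by linear_combination this)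
  let s : ℤ → ℂ := fun t => if t = 0 then D.c₀ / p else 1
  have hs : ∀ t, s t ≠ 0 := fun t => by
    dsimp only [s]; split_ifs
    exacts [div_ne_zero hc₀ hp0, one_ne_zero]
  have hs0 : s 0 = D.c₀ / p := if_pos rfl
  have hs1 : ∀ t ≠ 0, s t = 1 := fun t ht => if_neg ht
  have hℓ : ∀ n t, (D.rescale s hs).ℓ n t = t := by
    intro n t
    change s t * D.ℓ n t / s (n + t) = t
    rw [div_eq_iff (hs _)]
    rcases eq_or_ne t 0 with rfl | ht
    · rcases eq_or_ne n 0 with rfl | hn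
      · rw [h.ℓ_zero_zero]; simp
      · rw [hout n hn]; simp
    · rcases eq_or_ne (n + t) 0 with hnt | hnt
      · obtain rfl : t = -n := by lia
        rw [hnt, hs0, hs1 _ ht]
        field_simp
        have := hε n (by lia)
        push_cast
        linear_combination this
      · rw [h.ℓ n t ht hnt, hs1 _ ht, hs1 _ hnt]; ring
  have h' : (D.rescale s hs).PuncturedForm := ⟨h.wt, h.c, h.mem, fun n t _ _ => hℓ n t⟩
  exact (h'.isModel_functions h0 hc₀ hℓ).of_rescale

end PuncturedForm

/-- The system of the restricted dual module. -/
def dual (D : HVSystem) (hc : D.c = 0) (hz : D.z = 0) (hk : D.k = 0) : HVSystem where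
  S := {t | -t ∈ D.S}
  wt := -D.wt
  c := 0
  z := 0
  k := 0
  c₀ := -D.c₀
  ℓ n t := -D.ℓ n (-n - t)
  f n t := -D.f n (-n - t)
  normalized := D.toVirSystem.flip.normalized
  source n t h := by
    rw [D.target _ _ _, neg_zero]
    rwa [show n + (-n - t) = -t by ring]
  target n t h := by
    rw [D.source _ _ _, neg_zero]
    rwa [show -n - t = -(n + t) by ring]
  zero t h := by
    rw [show (-0 : ℤ) - t = -t by ring, D.zero _ h]; push_cast; ring
  comm m n t h := by
    by_cases ht : -m - n - t ∈ D.S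
    · have := D.comm_of (m := m) (n := n) (a := -m - t) (b := -n - t) (d := m + n) ht
        (by ring) (by ring) rfl
      rw [hc, mul_zero, ite_self, add_zero] at this
      rw [show -m - (n + t) = -m - n - t by ring, show -n - (m + t) = -m - n - t by ring,
        show -(m + n) - t = -m - n - t by ring, mul_zero, ite_self, add_zero]
      linear_combination -this
    · rw [show -m - (n + t) = -m - n - t by ring, show -n - (m + t) = -m - n - t by ring,
        show -(m + n) - t = -m - n - t by ring, mul_zero, ite_self, D.source _ _ ht,
        D.source _ _ ht, D.source _ _ ht]
      ring
  f_source n t h := by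
    rw [D.f_target _ _ _, neg_zero]
    rwa [show n + (-n - t) = -t by ring]
  f_target n t h := by
    rw [D.f_source _ _ _, neg_zero]
    rwa [show -n - t = -(n + t) by ring]
  f_zero t h := by
    rw [show (-0 : ℤ) - t = -t by ring, D.f_zero _ h]
  LI m n t h := by
    by_cases ht : -m - n - t ∈ D.S
    · have := D.LI_of (m := m) (n := n) (a := -m - t) (b := -n - t) (d := m + n) ht
        (by ring) (by ring) rfl
      rw [hz, mul_zero, ite_self, add_zero] at this
      rw [show -m - (n + t) = -m - n - t by ring, show -n - (m + t) = -m - n - t by ring,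
        show -(m + n) - t = -m - n - t by ring, mul_zero, ite_self, add_zero]
      linear_combination -this
    · rw [show -m - (n + t) = -m - n - t by ring, show -n - (m + t) = -m - n - t by ring,
        show -(m + n) - t = -m - n - t by ring, mul_zero, ite_self, D.source _ _ ht,
        D.f_source _ _ ht, D.f_source _ _ ht]
      ring
  II m n t h := by
    by_cases ht : -m - n - t ∈ D.S
    · have := D.II_of (m := m) (n := n) (a := -m - t) (b := -n - t) (d := m + n) ht
        (by ring) (by ring) rfl
      rw [hk, mul_zero, ite_self] at this
      rw [show -m - (n + t) = -m - n - t by ring, show -n - (m + t) = -m - n - t by ring,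
        mul_zero, ite_self]
      linear_combination -this
    · rw [show -m - (n + t) = -m - n - t by ring, show -n - (m + t) = -m - n - t by ring,
        mul_zero, ite_self, D.f_source _ _ ht, D.f_source _ _ ht]
      ring

namespace PuncturedForm

variable {D : HVSystem}

/-- Duality exchanges arrows into and out of `v_0`, and `A_{0,1,c}` is dual to `A_{0,0,-c}`. The
scale `t` returns the dual to punctured form; the scale obtained for the dual is then inverted. -/
theorem isModel_of_in_eq_zero (h : D.PuncturedForm) (h0 : (0 : ℤ) ∈ D.S) (hc₀ : D.c₀ ≠ 0)
    (hin : ∀ n : ℤ, n ≠ 0 → D.ℓ n (-n) = 0) : D.IsModel (.A 0 1 D.c₀) := by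
  obtain ⟨hz, hk, -⟩ := h.f_pos
  let s : ℤ → ℂ := fun t => if t = 0 then 1 else t
  have hs : ∀ t, s t ≠ 0 := fun t => by
    dsimp only [s]; split_ifs with ht
    exacts [one_ne_zero, by exact_mod_cast ht]
  have hs1 : ∀ t ≠ 0, s t = t := fun t ht => if_neg ht
  have h' : ((D.dual h.c hz hk).rescale s hs).PuncturedForm := by
    refine ⟨neg_eq_zero.2 h.wt, rfl, fun t ht => h.mem (-t) (by lia), fun n t ht hnt => ?_⟩
    change s t * (-D.ℓ n (-n - t)) / s (n + t) = t
    rw [div_eq_iff (hs _), hs1 t ht, hs1 _ hnt, h.ℓ _ _ (by lia) (by lia)]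
    push_cast; ring
  obtain ⟨-, -, -, -, σ, hσ, h1, h2⟩ := (h'.isModel_of_out_eq_zero
    (by change -(0 : ℤ) ∈ D.S; simpa using h0) (neg_ne_zero.2 hc₀) (fun n hn => by
      change s 0 * (-D.ℓ n (-n - 0)) / s (n + 0) = 0
      rw [sub_zero, hin n hn]; simp)).of_rescale
  refine ⟨h.univ h0, h.c, hz, hk, fun t => (σ (-t))⁻¹, fun t => inv_ne_zero (hσ _),
    fun n t => ?_, fun n t => ?_⟩
  · have := h1 n (-n - t)
    change -D.ℓ n (-n - (-n - t)) * _ = _ at this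
    rw [show -n - (-n - t) = t by ring, show n + (-n - t) = -t by ring,
      show -n - t = -(n + t) by ring] at this
    simp only [Param.coeffs, coeffsA] at this ⊢
    have e1 := hσ (-t)
    have e2 := hσ (-(n + t))
    push_cast at this ⊢
    field_simp
    linear_combination -this
  · have := h2 n (-n - t)
    change -D.f n (-n - (-n - t)) * _ = _ * (-D.c₀) at this
    rw [show -n - (-n - t) = t by ring, show n + (-n - t) = -t by ring,
      show -n - t = -(n + t) by ring] at this
    simp only [Param.coeffs, coeffsA] at this ⊢
    have e1 := hσ (-t)
    have e2 := hσ (-(n + t))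
    field_simp
    linear_combination -this

/-- To compare with a model it is enough to look at the vector of weight zero. -/
theorem isModel_of_forall (h : D.PuncturedForm) (h0 : (0 : ℤ) ∈ D.S) (hc₀ : D.c₀ = 0) {p : Param}
    (s : ℤ → ℂ) (hs : ∀ t, s t ≠ 0)
    (h1 : ∀ n t, t ≠ 0 → n + t ≠ 0 → t * s t = s (n + t) * p.coeffs.ℓ n t ∧ p.coeffs.f n t = 0)
    (h2 : ∀ n, n ≠ 0 → D.ℓ n 0 * s 0 = s n * p.coeffs.ℓ n 0 ∧
      D.f n 0 * s 0 = s n * p.coeffs.f n 0)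
    (h3 : ∀ n, n ≠ 0 → D.ℓ n (-n) * s (-n) = s 0 * p.coeffs.ℓ n (-n) ∧
      D.f n (-n) * s (-n) = s 0 * p.coeffs.f n (-n))
    (h4 : p.coeffs.ℓ 0 0 = 0 ∧ p.coeffs.f 0 0 = 0) : D.IsModel p := by
  obtain ⟨hz, hk, -⟩ := h.f_pos
  have : ∀ n t, D.ℓ n t * s t = s (n + t) * p.coeffs.ℓ n t ∧
      D.f n t * s t = s (n + t) * p.coeffs.f n t := by
    intro n t
    rcases eq_or_ne t 0 with rfl | ht
    · rcases eq_or_ne n 0 with rfl | hn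
      · rw [h.ℓ_zero_zero, D.f_zero 0 h0, hc₀, h4.1, h4.2]; simp
      · rw [add_zero]; exact h2 n hn
    · rcases eq_or_ne (n + t) 0 with hnt | hnt
      · obtain rfl : t = -n := by lia
        rw [hnt]; exact h3 n (by lia)
      · rw [h.ℓ n t ht hnt, h.f_eq_zero hc₀ n t ht hnt, (h1 n t ht hnt).2]
        exact ⟨(h1 n t ht hnt).1, by ring⟩
  exact ⟨h.univ h0, h.c, hz, hk, s, hs, fun n t => (this n t).1, fun n t => (this n t).2⟩

theorem f_out_eq (h : D.PuncturedForm) (h0 : (0 : ℤ) ∈ D.S) (hc₀ : D.c₀ = 0) :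
    ∀ n : ℤ, n ≠ 0 → D.f n 0 = D.f 1 0 := by
  intro n hn
  obtain ⟨hz, -⟩ := h.f_pos
  by_cases h1 : n = 1
  · rw [h1]
  have := D.LI_of_z (m := 1 - n) (n := n) (t := 0) (a := n) (b := 1 - n) (d := 1) hz h0
    (by ring) (by ring) (by ring)
  rw [h.ℓ (1 - n) n hn (by lia), h.f_eq_zero hc₀ n (1 - n) (by lia) (by lia)] at this
  apply mul_left_cancel₀ (by exact_mod_cast hn : (n : ℂ) ≠ 0)
  linear_combination this

theorem f_in_eq (h : D.PuncturedForm) (hc₀ : D.c₀ = 0) :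
    ∀ n : ℤ, n ≠ 0 → D.f n (-n) = n * D.f 1 (-1) := by
  intro n hn
  obtain ⟨hz, -⟩ := h.f_pos
  by_cases h1 : n = 1
  · rw [h1]; push_cast; ring
  have := D.LI_of_z (m := 1 - n) (n := n) (t := -1) (a := n - 1) (b := -n) (d := 1)
    hz (h.mem _ (by lia)) (by ring) (by ring) (by ring)
  rw [h.ℓ (1 - n) (-1) (by lia) (by lia), h.f_eq_zero hc₀ n (-1) (by lia) (by lia)] at this
  push_cast at this
  linear_combination this

/-- Extensions between the trivial module and the punctured `A_{0,0}` with `I(0) = 0`. -/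
theorem classify_extension (h : D.PuncturedForm) (h0 : (0 : ℤ) ∈ D.S) (hc₀ : D.c₀ = 0) :
    (∃ p, D.IsModel p) ∨ ∀ n : ℤ, D.ℓ n 0 = 0 ∧ D.f n 0 = 0 ∧ D.ℓ n (-n) = 0 ∧
      D.f n (-n) = 0 := by
  obtain ⟨hz, hk, -⟩ := h.f_pos
  obtain ⟨α, β, hα⟩ := h.exists_linear_out h0
  obtain ⟨α', β', hα'⟩ := h.exists_linear_in
  obtain ⟨p, hp⟩ : ∃ p, ∀ n : ℤ, n ≠ 0 → D.f n 0 = p := ⟨_, h.f_out_eq h0 hc₀⟩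
  obtain ⟨q, hq⟩ : ∃ q, ∀ n : ℤ, n ≠ 0 → D.f n (-n) = n * q := ⟨_, h.f_in_eq hc₀⟩
  -- `I(2)I(1) v_{-1}` passes through `v_0` with coefficient `pq`, while `I(1)I(2) v_{-1}` avoids
  -- `v_0` and vanishes. The same comparison of paths shows below that an `I`-arrow on one side of
  -- `v_0` excludes Virasoro arrows on the other.
  have hpq : p = 0 ∨ q = 0 := by
    have := D.II_of (m := 2) (n := 1) (t := -1) (a := 0) (b := 1) (d := 3) (h.mem _ (by lia))
      (by ring) (by ring) (by ring)
    rw [h.f_eq_zero hc₀ 1 1 (by lia) (by lia), hp 2 (by lia), hq 1 (by lia),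
      if_neg (by lia)] at this
    rw [← mul_eq_zero]
    push_cast at this
    linear_combination this
  have hout : ∀ m n : ℤ, m ≠ 0 → n ≠ 0 → m ≠ n → D.ℓ m 0 * (n * q) = 0 := by
    intro m n hm hn hmn
    have := D.LI_of_z (m := m) (n := n) (t := -n) (a := 0) (b := m - n) (d := m + n)
      hz (h.mem _ (by lia)) (by ring) (by ring) (by ring)
    rw [h.f_eq_zero hc₀ n (m - n) (by lia) (by lia), h.f_eq_zero hc₀ (m + n) (-n) (by lia) (by lia),
      hq n hn] at this
    linear_combination this
  have hin : ∀ m n : ℤ, m ≠ 0 → n ≠ 0 → m ≠ n → p * D.ℓ m (-m) = 0 := by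
    intro m n hm hn hmn
    have := D.LI_of_z (m := m) (n := n) (t := -m) (a := n - m) (b := 0) (d := m + n)
      hz (h.mem _ (by lia)) (by ring) (by ring) (by ring)
    rw [h.f_eq_zero hc₀ n (-m) (by lia) (by lia), h.f_eq_zero hc₀ (m + n) (-m) (by lia) (by lia),
      hp n hn] at this
    linear_combination -this
  have hcast : ∀ n : ℤ, n ≠ 0 → (n : ℂ) ≠ 0 := fun n hn => by exact_mod_cast hn
  by_cases hφ : ∀ n : ℤ, n ≠ 0 → D.ℓ n 0 = 0
  · by_cases hε : ∀ n : ℤ, n ≠ 0 → D.ℓ n (-n) = 0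
    · by_cases hp0 : p = 0
      · by_cases hq0 : q = 0
        · right
          intro n
          by_cases hn : n = 0
          · subst hn
            rw [neg_zero, h.ℓ_zero_zero, D.f_zero 0 h0]; simp [hc₀]
          · rw [hφ n hn, hε n hn, hp n hn, hq n hn, hp0, hq0]; simp
        · left
          refine ⟨.U' q hq0, h.isModel_of_forall h0 hc₀ (fun _ => 1) (fun _ => one_ne_zero)
            (fun n t ht hnt => ?_) (fun n hn => ?_) (fun n hn => ?_) ?_⟩
          · simp [Param.coeffs, coeffsU', hnt]
          · simp [Param.coeffs, coeffsU', hn, hφ n hn, hp n hn, hp0]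
          · simp [Param.coeffs, coeffsU', hε n hn, hq n hn, mul_comm]
          · simp [Param.coeffs, coeffsU']
      · left
        have hq0 : q = 0 := hpq.resolve_left hp0
        refine ⟨.V' p hp0, h.isModel_of_forall h0 hc₀ (fun _ => 1) (fun _ => one_ne_zero)
          (fun n t ht hnt => ?_) (fun n hn => ?_) (fun n hn => ?_) ?_⟩
        · simp [Param.coeffs, coeffsV', hnt, ht]
        · simp [Param.coeffs, coeffsV', hn, hφ n hn, hp n hn]
        · simp [Param.coeffs, coeffsV', hε n hn, hq n hn, hq0, hn]
        · simp [Param.coeffs, coeffsV']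
    · left
      push Not at hε
      obtain ⟨m, hm, hm'⟩ := hε
      have hp0 : p = 0 := by
        have := hin m (-m) hm (by lia) (by lia)
        exact (mul_eq_zero.1 this).resolve_right hm'
      by_cases hα0 : α' = 0
      · have hβ : β' ≠ 0 := by
          rintro rfl
          apply hm'
          rw [hα' m hm, hα0]; ring
        -- The scale of `v_0` matches the Virasoro arrow `n β'` with the arrow `-n` of the model.
        refine ⟨.U (-q / β'), h.isModel_of_forall h0 hc₀ (fun t => if t = 0 then -β' else 1)
          (fun t => ?_) (fun n t ht hnt => ?_) (fun n hn => ?_) (fun n hn => ?_) ?_⟩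
        · split_ifs
          exacts [neg_ne_zero.2 hβ, one_ne_zero]
        · simp [Param.coeffs, coeffsU, hnt, ht]
        · simp [Param.coeffs, coeffsU, hn, hφ n hn, hp n hn, hp0]
        · simp only [Param.coeffs, coeffsU, hα' n hn, hq n hn, hα0, neg_eq_zero, hn, if_false,
            if_true, add_neg_cancel]
          push_cast
          constructor
          · ring
          · field_simp
        · simp [Param.coeffs, coeffsU]
      · refine ⟨.B (β' / α') (-q / α'), h.isModel_of_forall h0 hc₀
          (fun t => if t = 0 then -α' else 1)
          (fun t => ?_) (fun n t ht hnt => ?_) (fun n hn => ?_) (fun n hn => ?_) ?_⟩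
        · split_ifs
          exacts [neg_ne_zero.2 hα0, one_ne_zero]
        · simp [Param.coeffs, coeffsB, hnt, ht]
        · simp [Param.coeffs, coeffsB, hn, hφ n hn, hp n hn, hp0]
        · simp only [Param.coeffs, coeffsB, hα' n hn, hq n hn, neg_eq_zero, hn, if_false,
            if_true, add_neg_cancel]
          constructor
          · field_simp
          · field_simp
        · simp [Param.coeffs, coeffsB]
  · left
    have hε := (h.out_or_in_eq_zero h0).resolve_left hφ
    push Not at hφ
    obtain ⟨m, hm, hm'⟩ := hφ
    have hq0 : q = 0 := by
      have := hout m (-m) hm (by lia) (by lia)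
      have := (mul_eq_zero.1 this).resolve_left hm'
      exact (mul_eq_zero.1 this).resolve_left (hcast _ (by lia))
    by_cases hα0 : α = 0
    · have hβ : β ≠ 0 := by
        rintro rfl
        apply hm'
        rw [hα m hm, hα0]; ring
      -- The scale `1 / t` away from zero converts `L(n) v_t = t v_{n+t}` into the form `(t + n)
      -- v_{n+t}` of the model.
      refine ⟨.V (p / β), h.isModel_of_forall h0 hc₀ (fun t => if t = 0 then 1 / β else 1 / t)
        (fun t => ?_) (fun n t ht hnt => ?_) (fun n hn => ?_) (fun n hn => ?_) ?_⟩
      · split_ifs with ht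
        exacts [one_div_ne_zero hβ, one_div_ne_zero (hcast t ht)]
      · have e1 := hcast t ht
        have e2 := hcast _ hnt
        push_cast at e2
        simp only [Param.coeffs, coeffsV, hnt, ht, if_false]
        push_cast
        refine ⟨?_, trivial⟩
        rw [add_comm (t : ℂ) n]
        field_simp
      · have e := hcast n hn
        simp only [Param.coeffs, coeffsV, hn, hα n hn, hp n hn, hα0, if_false, if_true]
        push_cast
        constructor <;> field_simp <;> ring
      · simp [Param.coeffs, coeffsV, hn, hε n hn, hq n hn, hq0]
      · simp [Param.coeffs, coeffsV]
    · refine ⟨.A' (β / α) (p / α), h.isModel_of_forall h0 hc₀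
        (fun t => if t = 0 then 1 / α else 1 / t)
        (fun t => ?_) (fun n t ht hnt => ?_) (fun n hn => ?_) (fun n hn => ?_) ?_⟩
      · split_ifs with ht
        exacts [one_div_ne_zero hα0, one_div_ne_zero (hcast t ht)]
      · have e1 := hcast t ht
        have e2 := hcast _ hnt
        push_cast at e2
        simp only [Param.coeffs, coeffsA', hnt, ht, if_false]
        push_cast
        refine ⟨?_, trivial⟩
        rw [add_comm (t : ℂ) n]
        field_simp
      · have e := hcast n hn
        simp only [Param.coeffs, coeffsA', hn, hα n hn, hp n hn, if_false, if_true]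
        constructor <;> field_simp
      · simp [Param.coeffs, coeffsA', hn, hε n hn, hq n hn, hq0]
      · simp [Param.coeffs, coeffsA']

end PuncturedForm

/-- The possible systems: a trivial module, a listed module, the punctured `A_{0,0}`, or a direct
sum of the latter with a trivial module. -/
theorem classify (hne : D.S.Nonempty) :
    (D.S = {0} ∧ D.c = 0 ∧ D.z = 0 ∧ D.k = 0 ∧ D.ℓ 0 0 = 0 ∧ D.f 0 0 = 0) ∨
    (∃ p, D.IsModel p) ∨
    (∃ s hs, (D.rescale s hs).PuncturedForm ∧ (0 : ℤ) ∉ D.S) ∨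
    (∃ s hs, (D.rescale s hs).PuncturedForm ∧ (0 : ℤ) ∈ D.S ∧
      ∀ n : ℤ, D.ℓ n 0 = 0 ∧ D.f n 0 = 0 ∧ D.ℓ n (-n) = 0 ∧ D.f n (-n) = 0) := by
  obtain ⟨hc, ⟨hS, hw⟩ | h | h⟩ := VirSystem.classify hne
  · left
    have h0 : (0 : ℤ) ∈ D.S := by rw [hS]; rfl
    have hf : ∀ n : ℤ, n ≠ 0 → D.f n 0 = 0 := fun n hn =>
      D.f_target _ _ (by rw [hS, add_zero]; exact hn)
    have hℓ : ∀ n : ℤ, n ≠ 0 → D.ℓ n 0 = 0 := fun n hn =>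
      D.target _ _ (by rw [hS, add_zero]; exact hn)
    -- On a one-point support every operator of nonzero degree vanishes. The commutators giving
    -- `I(0)`, `C_LI` and `C_I` then force these to vanish too.
    have e1 := D.LI (-1) 1 0 h0
    have e2 := D.LI 1 (-1) 0 h0
    have e3 := D.II (-1) 1 0 h0
    rw [hf 1 (by lia), hℓ (-1) (by lia), show (-1 : ℤ) + 1 = 0 by ring, if_pos rfl] at e1
    rw [hf (-1) (by lia), hℓ 1 (by lia), show (1 : ℤ) + -1 = 0 by ring, if_pos rfl] at e2
    rw [hf 1 (by lia), hf (-1) (by lia), if_pos (by ring)] at e3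
    push_cast at e1 e2 e3
    have e4 : D.f 0 0 = 0 := by linear_combination e2
    exact ⟨hS, hc, by linear_combination -e1 / 2 - e4 / 2, by linear_combination -e3,
      by rw [D.zero 0 h0, hw]; simp, e4⟩
  · exact Or.inr (Or.inl (exists_isModel_of_isGlobal hc h))
  · obtain ⟨s, hs, h⟩ := PuncturedForm.of_isPunctured hc h
    by_cases h0 : (0 : ℤ) ∈ D.S
    · by_cases hc₀ : D.c₀ = 0
      · rcases h.classify_extension h0 hc₀ with ⟨p, hp⟩ | h'
        · exact Or.inr (Or.inl ⟨p, hp.of_rescale⟩)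
        · have cancel : ∀ n t x, s t * x / s (n + t) = 0 → x = 0 := fun n t x hx => by
            rw [div_eq_zero_iff] at hx
            exact (mul_eq_zero.1 (hx.resolve_right (hs _))).resolve_left (hs _)
          exact Or.inr (Or.inr (Or.inr ⟨s, hs, h, h0, fun n =>
            ⟨cancel _ _ _ (h' n).1, cancel _ _ _ (h' n).2.1, cancel _ _ _ (h' n).2.2.1,
              cancel _ _ _ (h' n).2.2.2⟩⟩))
      · rcases h.out_or_in_eq_zero h0 with h' | h'
        · exact Or.inr (Or.inl ⟨_, (h.isModel_of_out_eq_zero h0 hc₀ h').of_rescale⟩)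
        · exact Or.inr (Or.inl ⟨_, (h.isModel_of_in_eq_zero h0 hc₀ h').of_rescale⟩)
    · exact Or.inr (Or.inr (Or.inl ⟨s, hs, h, h0⟩))

end HVSystem

-- From modules to structure constants.

universe u

theorem mono_eq_smul (g : Gen) (z : ℂ) : mono g z = z • mono g 1 := by rw [smul_mono, mul_one]

/-- The degree of a basis element with respect to `L(0)`. -/
def Gen.deg : Gen → ℤ
  | .L m => m
  | .I m => m
  | _ => 0

theorem lie_L_zero (g : Gen) : ⁅mono (.L 0) 1, mono g 1⁆ = (g.deg : ℂ) • mono g 1 := by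
  rw [lie_mono, mul_one, one_smul]
  rcases g with m | m | _ | _ | _ <;>
    simp [bracketGen, Gen.deg, mono_zero, smul_mono]

section Modules

variable {V : Type u} [AddCommGroup V] [Module ℂ V] [LieRingModule Alg V] [LieModule ℂ Alg V]

theorem mem_weightSpace {μ : ℂ} {v : V} : v ∈ weightSpace V μ ↔ ⁅mono (.L 0) 1, v⁆ = μ • v :=
  Module.End.mem_eigenspace_iff

theorem lie_mem_weightSpace {μ : ℂ} {v : V} (hv : v ∈ weightSpace V μ) (g : Gen) :
    ⁅mono g 1, v⁆ ∈ weightSpace V (μ + g.deg) := by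
  rw [mem_weightSpace] at hv ⊢
  rw [leibniz_lie, lie_L_zero, hv, smul_lie, lie_smul, ← add_smul, add_comm]

/-- The sum of the weight spaces with weights in `A`, when it is a submodule. -/
def sector (A : Set ℂ) (hA : ∀ g : Gen, ∀ μ ∈ A, ∀ v ∈ weightSpace V μ,
    ⁅mono g 1, v⁆ ≠ 0 → μ + g.deg ∈ A) : LieSubmodule ℂ Alg V where
  toSubmodule := ⨆ μ ∈ A, weightSpace V μ
  lie_mem {x v} hv := by
    change v ∈ (⨆ μ ∈ A, weightSpace V μ) at hv
    change ⁅x, v⁆ ∈ (⨆ μ ∈ A, weightSpace V μ)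
    induction x using alg_induction with
    | h0 => rw [zero_lie]; exact zero_mem _
    | ha a b h1 h2 => rw [_root_.add_lie]; exact add_mem h1 h2
    | hs g z =>
      rw [mono_eq_smul, smul_lie]
      apply Submodule.smul_mem
      suffices (⨆ μ ∈ A, weightSpace V μ) ≤
          (⨆ μ ∈ A, weightSpace V μ).comap (LieModule.toEnd ℂ Alg V (mono g 1)) from this hv
      refine iSup₂_le fun μ hμ w hw => ?_
      rw [Submodule.mem_comap, LieModule.toEnd_apply_apply]
      by_cases h0 : ⁅mono g 1, w⁆ = 0
      · rw [h0]; exact zero_mem _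
      · exact Submodule.mem_iSup_of_mem _ (Submodule.mem_iSup_of_mem (hA g μ hμ w hw h0)
          (lie_mem_weightSpace hw g))

/-- A set of weights that the action neither leaves nor enters contains all or none of the weights
of an indecomposable weight module. -/
theorem weights_of_indecomposable (hV : IsIndecomposable V) (hW : IsWeightModule V) (A : Set ℂ)
    (hA : ∀ g : Gen, ∀ μ, ∀ v ∈ weightSpace V μ, ⁅mono g 1, v⁆ ≠ 0 → (μ ∈ A ↔ μ + g.deg ∈ A)) :
    (∀ μ ∈ A, weightSpace V μ = ⊥) ∨ ∀ μ ∉ A, weightSpace V μ = ⊥ := by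
  let N := sector (V := V) A fun g μ hμ v hv h0 => (hA g μ v hv h0).1 hμ
  let P := sector (V := V) Aᶜ fun g μ hμ v hv h0 h => hμ ((hA g μ v hv h0).2 h)
  have hN : ∀ μ ∈ A, weightSpace V μ ≤ N.toSubmodule := fun μ hμ => le_iSup₂_of_le μ hμ le_rfl
  have hP : ∀ μ ∉ A, weightSpace V μ ≤ P.toSubmodule := fun μ hμ =>
    le_iSup₂_of_le (f := fun μ (_ : μ ∈ Aᶜ) => weightSpace V μ) μ hμ le_rfl
  have hc : IsCompl N P := by
    rw [← LieSubmodule.isCompl_toSubmodule]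
    constructor
    · exact (Module.End.eigenspaces_iSupIndep
        (LieModule.toEnd ℂ Alg V (mono (.L 0) 1))).disjoint_biSup_biSup disjoint_compl_right
    · rw [codisjoint_iff, eq_top_iff, ← hW]
      refine iSup_le fun μ => ?_
      by_cases hμ : μ ∈ A
      · exact (hN μ hμ).trans le_sup_left
      · exact (hP μ hμ).trans le_sup_right
  rcases hV.2 N P hc with h | h
  · left; intro μ hμ
    have := hN μ hμ
    rwa [h, LieSubmodule.bot_toSubmodule, le_bot_iff] at this
  · right; intro μ hμ
    have := hP μ hμ
    rwa [h, LieSubmodule.bot_toSubmodule, le_bot_iff] at this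

theorem weight_induction (hW : IsWeightModule V) {p : V → Prop} (v : V)
    (mem : ∀ μ, ∀ v ∈ weightSpace V μ, p v) (zero : p 0)
    (add : ∀ v w, p v → p w → p (v + w)) : p v := by
  refine Submodule.iSup_induction (weightSpace V) (motive := p) (x := v) ?_ mem zero add
  have : ⨆ μ, weightSpace V μ = ⊤ := hW
  rw [this]; trivial

theorem exists_weight (hV : IsIndecomposable V) (hW : IsWeightModule V) :
    ∃ μ, weightSpace V μ ≠ ⊥ := by
  by_contra! h
  have := hV.1
  have hW : ⨆ μ, weightSpace V μ = ⊤ := hW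
  simp only [h, iSup_bot] at hW
  exact bot_ne_top hW

theorem exists_generator (hr : ∀ μ, Module.rank ℂ (weightSpace V μ) ≤ 1) (μ : ℂ) :
    ∃ v ∈ weightSpace V μ, ∀ w ∈ weightSpace V μ, ∃ a : ℂ, w = a • v := by
  obtain ⟨v, hv⟩ := rank_le_one_iff.1 (hr μ)
  refine ⟨v, v.2, fun w hw => ?_⟩
  obtain ⟨a, ha⟩ := hv ⟨w, hw⟩
  exact ⟨a, by rw [← SetLike.val_smul, ha]⟩

theorem eq_smul_of_rank_le_one (hr : ∀ μ, Module.rank ℂ (weightSpace V μ) ≤ 1) {μ : ℂ} {v w : V}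
    (hv : v ∈ weightSpace V μ) (hv0 : v ≠ 0) (hw : w ∈ weightSpace V μ) : ∃ a : ℂ, w = a • v := by
  obtain ⟨x, hx, hgen⟩ := exists_generator hr μ
  obtain ⟨a, rfl⟩ := hgen v hv
  obtain ⟨b, rfl⟩ := hgen w hw
  have ha : a ≠ 0 := fun h => hv0 (by rw [h, zero_smul])
  exact ⟨b / a, by rw [smul_smul, div_mul_cancel₀ _ ha]⟩

/-- Central basis elements, including `I(0)`, act by scalars. -/
theorem central_scalar (hV : IsIntermediateSeries V) {g : Gen} (hg : g.deg = 0)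
    (hc : ∀ h : Gen, ⁅mono g 1, mono h 1⁆ = 0) : ∃ c : ℂ, ∀ v : V, ⁅mono g 1, v⁆ = c • v := by
  obtain ⟨⟨hI, hW, -⟩, -, hr⟩ := hV
  have hmem : ∀ μ, ∀ v ∈ weightSpace V μ, ⁅mono g 1, v⁆ ∈ weightSpace V μ := fun μ v hv => by
    have := lie_mem_weightSpace hv g
    rwa [hg, Int.cast_zero, add_zero] at this
  have hcomm : ∀ (h : Gen) (v : V), ⁅mono g 1, ⁅mono h 1, v⁆⁆ = ⁅mono h 1, ⁅mono g 1, v⁆⁆ :=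
    fun h v => by rw [leibniz_lie, hc, zero_lie, zero_add]
  obtain ⟨μ₀, hμ₀⟩ := exists_weight hI hW
  obtain ⟨v₀, hv₀, h0⟩ := Submodule.exists_mem_ne_zero_of_ne_bot hμ₀
  obtain ⟨c, hcv⟩ := eq_smul_of_rank_le_one hr hv₀ h0 (hmem _ _ hv₀)
  refine ⟨c, fun v => ?_⟩
  -- A nonzero arrow between weight spaces of dimension at most one transports the scalar in both
  -- directions, since `g` commutes with it. So `A` is neither left nor entered.
  let A : Set ℂ := {μ | ∀ w ∈ weightSpace V μ, ⁅mono g 1, w⁆ = c • w}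
  have hA := weights_of_indecomposable hI hW A fun h μ v hv hne => by
    constructor
    · intro hμ w hw
      obtain ⟨a, rfl⟩ := eq_smul_of_rank_le_one hr (lie_mem_weightSpace hv h) hne hw
      rw [lie_smul, hcomm, hμ v hv, lie_smul, smul_comm]
    · intro hμ w hw
      have hv0 : v ≠ 0 := fun e => hne (by rw [e, lie_zero])
      obtain ⟨c', hc'⟩ := eq_smul_of_rank_le_one hr hv hv0 (hmem _ _ hv)
      have e := hμ _ (lie_mem_weightSpace hv h)
      rw [hcomm, hc', lie_smul] at e
      obtain rfl : c' = c := smul_left_injective ℂ hne e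
      obtain ⟨a, rfl⟩ := eq_smul_of_rank_le_one hr hv hv0 hw
      rw [lie_smul, hc', smul_comm]
  have hall : ∀ μ, μ ∈ A := by
    have h₀ : μ₀ ∈ A := fun w hw => by
      obtain ⟨a, rfl⟩ := eq_smul_of_rank_le_one hr hv₀ h0 hw
      rw [lie_smul, hcv, smul_comm]
    rcases hA with hA | hA
    · exact absurd (hA _ h₀) hμ₀
    · intro μ
      by_contra hμ
      refine hμ fun w hw => ?_
      rw [hA μ hμ, Submodule.mem_bot] at hw
      rw [hw, lie_zero, smul_zero]
  refine weight_induction hW v (fun μ v hv => hall μ v hv) (by rw [lie_zero, smul_zero]) ?_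
  intro v w h1 h2
  rw [_root_.lie_add, smul_add, h1, h2]

/-- The family `v` of weight vectors exhibits `D` as the structure constants of a module. -/
structure Realization (D : HVSystem) (v : ℤ → V) : Prop where
  mem : ∀ t : ℤ, v t ∈ weightSpace V (D.wt + t)
  ne_zero : ∀ t, v t ≠ 0 ↔ t ∈ D.S
  weight : ∀ μ, weightSpace V μ ≠ ⊥ → ∃ t : ℤ, μ = D.wt + t
  gen : ∀ t : ℤ, ∀ w ∈ weightSpace V (D.wt + t), ∃ a : ℂ, w = a • v t
  L : ∀ n t : ℤ, ⁅mono (.L n) 1, v t⁆ = D.ℓ n t • v (n + t)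
  I : ∀ n t, ⁅mono (.I n) 1, v t⁆ = D.f n t • v (n + t)
  CL : ∀ x : V, ⁅mono .CL 1, x⁆ = D.c • x
  CI : ∀ x : V, ⁅mono .CI 1, x⁆ = D.k • x
  CLI : ∀ x : V, ⁅mono .CLI 1, x⁆ = D.z • x

/-- The action changes weights by integers, so a single coset of `ℤ` carries all of them. A coset
containing zero is represented by `0`, so that a vanishing weight can only sit at the index `0`. -/
theorem exists_coset (hI : IsIndecomposable V) (hW : IsWeightModule V) : ∃ wt : ℂ,
    (wt = 0 ∨ ∀ t : ℤ, wt + t ≠ 0) ∧ ∀ μ, weightSpace V μ ≠ ⊥ → ∃ t : ℤ, μ = wt + t := by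
  obtain ⟨μ₀, hμ₀⟩ := exists_weight hI hW
  have key : ∀ μ, weightSpace V μ ≠ ⊥ → ∃ t : ℤ, μ = μ₀ + t := by
    rcases weights_of_indecomposable hI hW {μ | ∃ t : ℤ, μ = μ₀ + t} (fun g μ v _ _ => by
      constructor
      · rintro ⟨t, rfl⟩
        exact ⟨t + g.deg, by push_cast; ring⟩
      · rintro ⟨t, ht⟩
        exact ⟨t - g.deg, by push_cast; linear_combination ht⟩) with h | h
    · exact absurd (h μ₀ ⟨0, by simp⟩) hμ₀
    · intro μ hμ
      by_contra hcon
      exact hμ (h μ hcon)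
  by_cases h0 : ∃ t : ℤ, μ₀ + t = 0
  · obtain ⟨t₀, ht₀⟩ := h0
    refine ⟨0, Or.inl rfl, fun μ hμ => ?_⟩
    obtain ⟨t, rfl⟩ := key μ hμ
    exact ⟨t - t₀, by push_cast; linear_combination ht₀⟩
  · push Not at h0
    exact ⟨μ₀, Or.inr h0, key⟩

theorem exists_realization (hV : IsIntermediateSeries V) :
    ∃ (D : HVSystem) (v : ℤ → V), D.S.Nonempty ∧ Realization D v := by
  have hV' := hV
  obtain ⟨⟨hI, hW, -⟩, -, hr⟩ := hV'
  obtain ⟨wt, hwt, hcoset⟩ := exists_coset hI hW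
  choose v hv hgen using fun t : ℤ => exists_generator (V := V) hr (wt + t)
  have coeff : ∀ (g : Gen) (t : ℤ), ∃ a : ℂ, ⁅mono g 1, v t⁆ = a • v (g.deg + t) ∧
      (v t = 0 → a = 0) ∧ (v (g.deg + t) = 0 → a = 0) := by
    intro g t
    have hmem := lie_mem_weightSpace (hv t) g
    rw [show wt + (t : ℂ) + g.deg = wt + ((g.deg + t : ℤ) : ℂ) by push_cast; ring] at hmem
    obtain ⟨a, ha⟩ := hgen _ _ hmem
    -- When the source or the target is absent, any scalar would do; zero is chosen, as the
    -- vanishing conditions off the support demand.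
    by_cases h : v t = 0 ∨ v (g.deg + t) = 0
    · refine ⟨0, ?_, fun _ => rfl, fun _ => rfl⟩
      rcases h with h | h
      · rw [h, lie_zero, zero_smul]
      · rw [ha, h, smul_zero, smul_zero]
    · push Not at h
      exact ⟨a, ha, fun e => absurd e h.1, fun e => absurd e h.2⟩
  choose x hx hx1 hx2 using coeff
  have hL : ∀ n t, ⁅mono (.L n) 1, v t⁆ = x (.L n) t • v (n + t) := fun n t => hx (.L n) t
  have hIn : ∀ n t, ⁅mono (.I n) 1, v t⁆ = x (.I n) t • v (n + t) := fun n t => hx (.I n) t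
  have central : ∀ g : Gen, g = .CL ∨ g = .CI ∨ g = .CLI ∨ g = .I 0 →
      ∃ c : ℂ, ∀ v : V, ⁅mono g 1, v⁆ = c • v := by
    intro g hg
    refine central_scalar hV (by rcases hg with rfl | rfl | rfl | rfl <;> rfl) fun h => ?_
    rw [lie_mono]
    rcases hg with rfl | rfl | rfl | rfl <;> rcases h with m | m | _ | _ | _ <;>
      simp [bracketGen, mono_zero]
    all_goals
      split_ifs with hm <;> simp [mono_zero, hm]
  obtain ⟨c, hc⟩ := central .CL (by simp)
  obtain ⟨k, hk⟩ := central .CI (by simp)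
  obtain ⟨z, hz⟩ := central .CLI (by simp)
  obtain ⟨c₀, hc₀⟩ := central (.I 0) (by simp)
  have compare : ∀ {t : ℤ} {a b : ℂ}, v t ≠ 0 → a • v t = b • v t → a = b :=
    fun h e => smul_left_injective ℂ h e
  refine ⟨
    { S := {t | v t ≠ 0}
      wt := wt
      c := c
      z := z
      k := k
      c₀ := c₀
      ℓ := fun n t => x (.L n) t
      f := fun n t => x (.I n) t
      normalized := hwt
      source := fun n t h => hx1 _ _ (not_not.1 h)
      target := fun n t h => hx2 (.L n) _ (not_not.1 h)
      f_source := fun n t h => hx1 _ _ (not_not.1 h)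
      f_target := fun n t h => hx2 (.I n) _ (not_not.1 h)
      zero := fun t h => compare h (by
        have := hL 0 t
        rw [zero_add] at this
        rw [← this, mem_weightSpace.1 (hv t)])
      f_zero := fun t h => compare h (by
        have := hIn 0 t
        rw [zero_add] at this
        rw [← this, hc₀])
      comm := fun m n t h => ?_
      LI := fun m n t h => ?_
      II := fun m n t h => ?_ }, v, ?_, ?_⟩
  · have e1 : m + (n + t) = m + n + t := by ring
    have e2 : n + (m + t) = m + n + t := by ring
    have e := lie_lie (mono (.L m) 1) (mono (.L n) 1) (v t)
    rw [lie_mono, mul_one, one_smul, bracketGen, _root_.add_lie, mono_eq_smul (.L _),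
      mono_eq_smul .CL, smul_lie, smul_lie, hc, hL, hL, hL, lie_smul, lie_smul, hL, hL, e1, e2]
      at e
    simp only [smul_smul] at e
    -- If the target vanishes, scalars cannot be compared, but all the coefficients are zero. Also
    -- `m + n ≠ 0`, since otherwise the target is `v t`, so there is no central term.
    by_cases h0 : v (m + n + t) = 0
    · have hmn : m + n ≠ 0 := by
        rintro hmn
        rw [hmn, zero_add] at h0
        exact h h0
      rw [hx2 (.L m) _ (by simpa [Gen.deg, e1] using h0),
        hx2 (.L n) (m + t) (by simpa [Gen.deg, e2] using h0),
        hx2 (.L (m + n)) _ (by simpa [Gen.deg] using h0), if_neg hmn]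
      ring
    · apply compare h0
      rw [sub_smul, add_smul, mul_comm (x (.L m) _), mul_comm (x (.L n) (m + t)), ← e]
      congr 1
      split_ifs with hmn
      · rw [hmn, zero_add]
      · simp
  · have e1 : m + (n + t) = m + n + t := by ring
    have e2 : n + (m + t) = m + n + t := by ring
    have e := lie_lie (mono (.L m) 1) (mono (.I n) 1) (v t)
    rw [lie_mono, mul_one, one_smul, bracketGen, _root_.add_lie, mono_eq_smul (.I _),
      mono_eq_smul .CLI, smul_lie, smul_lie, hz, hIn, hIn, hL, lie_smul, lie_smul, hL, hIn, e1, e2]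
      at e
    simp only [smul_smul] at e
    by_cases h0 : v (m + n + t) = 0
    · have hmn : m + n ≠ 0 := by
        rintro hmn
        rw [hmn, zero_add] at h0
        exact h h0
      rw [hx2 (.L m) _ (by simpa [Gen.deg, e1] using h0),
        hx2 (.I n) (m + t) (by simpa [Gen.deg, e2] using h0),
        hx2 (.I (m + n)) _ (by simpa [Gen.deg] using h0), if_neg hmn]
      ring
    · apply compare h0
      rw [sub_smul, add_smul, mul_comm (x (.L m) _), mul_comm (x (.I n) (m + t)), ← e]
      congr 1
      split_ifs with hmn
      · rw [hmn, zero_add]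
      · simp
  · have e1 : m + (n + t) = m + n + t := by ring
    have e2 : n + (m + t) = m + n + t := by ring
    have e := lie_lie (mono (.I m) 1) (mono (.I n) 1) (v t)
    rw [lie_mono, mul_one, one_smul, bracketGen, mono_eq_smul .CI, smul_lie, hk, hIn, hIn,
      lie_smul, lie_smul, hIn, hIn, e1, e2] at e
    simp only [smul_smul] at e
    by_cases h0 : v (m + n + t) = 0
    · have hmn : m + n ≠ 0 := by
        rintro hmn
        rw [hmn, zero_add] at h0
        exact h h0
      rw [hx2 (.I m) _ (by simpa [Gen.deg, e1] using h0),
        hx2 (.I n) (m + t) (by simpa [Gen.deg, e2] using h0), if_neg hmn]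
      ring
    · apply compare h0
      rw [sub_smul, mul_comm (x (.I m) _), mul_comm (x (.I n) (m + t)), ← e]
      split_ifs with hmn
      · rw [hmn, zero_add]
      · simp
  · obtain ⟨μ, hμ⟩ := exists_weight hI hW
    obtain ⟨t, rfl⟩ := hcoset μ hμ
    refine ⟨t, fun h => hμ ?_⟩
    rw [Submodule.eq_bot_iff]
    intro w hw
    obtain ⟨a, rfl⟩ := hgen t w hw
    rw [h, smul_zero]
  · exact ⟨hv, fun t => Iff.rfl, hcoset, hgen, hL, hIn, hc, hk, hz⟩

namespace Realization

variable {D : HVSystem} {v : ℤ → V}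

theorem rescale (R : Realization D v) (s : ℤ → ℂ) (hs : ∀ t, s t ≠ 0) :
    Realization (D.rescale s hs) fun t => s t • v t where
  mem t := Submodule.smul_mem _ _ (R.mem t)
  ne_zero t := by
    rw [smul_ne_zero_iff, R.ne_zero]
    exact ⟨fun h => h.2, fun h => ⟨hs t, h⟩⟩
  weight := R.weight
  gen t w hw := by
    obtain ⟨a, rfl⟩ := R.gen t w hw
    exact ⟨a / s t, by rw [smul_smul, div_mul_cancel₀ _ (hs t)]⟩
  L n t := by
    rw [lie_smul, R.L, smul_smul, smul_smul]
    change _ = (s t * D.ℓ n t / s (n + t) * s (n + t)) • _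
    rw [div_mul_cancel₀ _ (hs _)]
  I n t := by
    rw [lie_smul, R.I, smul_smul, smul_smul]
    change _ = (s t * D.f n t / s (n + t) * s (n + t)) • _
    rw [div_mul_cancel₀ _ (hs _)]
  CL := R.CL
  CI := R.CI
  CLI := R.CLI

theorem span (R : Realization D v) (hW : IsWeightModule V) :
    Submodule.span ℂ (Set.range v) = ⊤ := by
  have hW : ⨆ μ, weightSpace V μ = ⊤ := hW
  rw [eq_top_iff, ← hW]
  refine iSup_le fun μ w hw => ?_
  by_cases hμ : weightSpace V μ = ⊥
  · rw [hμ, Submodule.mem_bot] at hw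
    rw [hw]; exact zero_mem _
  · obtain ⟨t, rfl⟩ := R.weight μ hμ
    obtain ⟨a, rfl⟩ := R.gen t w hw
    exact Submodule.smul_mem _ _ (Submodule.subset_span ⟨t, rfl⟩)

theorem linearIndependent (R : Realization D v) (hS : D.S = Set.univ) : LinearIndependent ℂ v := by
  refine Module.End.eigenvectors_linearIndependent' (LieModule.toEnd ℂ Alg V (mono (.L 0) 1))
    (fun t : ℤ => D.wt + t) (fun i j h => ?_) v fun t => ⟨R.mem t, ?_⟩
  · have : (i : ℂ) = j := add_left_cancel h
    exact_mod_cast this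
  · rw [R.ne_zero, hS]; trivial

end Realization

/-- The homomorphism from a module with given structure constants determined by a family of vectors
satisfying the same relations. -/
def homOfFamily (C : Coeffs) (w : ℤ → V)
    (hL : ∀ n t, ⁅mono (.L n) 1, w t⁆ = C.ℓ n t • w (n + t))
    (hI : ∀ n t, ⁅mono (.I n) 1, w t⁆ = C.f n t • w (n + t))
    (hCL : ∀ x : V, ⁅mono .CL 1, x⁆ = 0) (hCI : ∀ x : V, ⁅mono .CI 1, x⁆ = 0)
    (hCLI : ∀ x : V, ⁅mono .CLI 1, x⁆ = 0) : Mod C →ₗ⁅ℂ,Alg⁆ V where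
  toLinearMap := (Finsupp.linearCombination ℂ w : (ℤ →₀ ℂ) →ₗ[ℂ] V)
  map_lie' {x m} := by
    let φ : Mod C →ₗ[ℂ] V := (Finsupp.linearCombination ℂ w : (ℤ →₀ ℂ) →ₗ[ℂ] V)
    have hφ : ∀ t z, φ (vec C t z) = z • w t := fun t z =>
      Finsupp.linearCombination_single ℂ z t
    change φ ⁅x, m⁆ = ⁅x, φ m⁆
    induction x using alg_induction with
    | h0 => simp
    | ha a b h1 h2 => rw [_root_.add_lie, _root_.add_lie, map_add, h1, h2]
    | hs g z =>
      induction m using mod_induction C with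
      | h0 => simp
      | ha a b h1 h2 => rw [_root_.lie_add, map_add, map_add, _root_.lie_add, h1, h2]
      | hs t y =>
        rw [act_mono, map_smul, hφ, mono_eq_smul, smul_lie, lie_smul, smul_smul]
        congr 1
        rcases g with n | n | _ | _ | _
        · rw [hL, actGen, hφ]
        · rw [hI, actGen, hφ]
        · rw [hCL, actGen, map_zero]
        · rw [hCI, actGen, map_zero]
        · rw [hCLI, actGen, map_zero]

end Modules

/-! ### From structure constants back to modules. -/

/-- A bijective homomorphism of Lie modules is an isomorphism. -/
def equivOfBijective {M N : Type*} [AddCommGroup M] [Module ℂ M] [LieRingModule Alg M]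
    [AddCommGroup N] [Module ℂ N] [LieRingModule Alg N]
    (φ : M →ₗ⁅ℂ,Alg⁆ N) (h : Function.Bijective φ) : M ≃ₗ⁅ℂ,Alg⁆ N :=
  { LinearEquiv.ofBijective (φ : M →ₗ[ℂ] N) h, φ with }

theorem isIrreducible_of_equiv {M N : Type*} [AddCommGroup M] [Module ℂ M] [LieRingModule Alg M]
    [AddCommGroup N] [Module ℂ N] [LieRingModule Alg N] (e : M ≃ₗ⁅ℂ,Alg⁆ N)
    (h : LieModule.IsIrreducible ℂ Alg M) : LieModule.IsIrreducible ℂ Alg N :=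
  have : IsSimpleOrder (LieSubmodule ℂ Alg M) := h
  (LieSubmodule.orderIsoMapComap e).symm.isSimpleOrder

theorem isNontrivialSimpleSubquotient_of_surjective {V : Type*}
    [AddCommGroup V] [Module ℂ V] [LieRingModule Alg V] {M : Type}
    [AddCommGroup M] [Module ℂ M] [LieRingModule Alg M] [LieModule ℂ Alg M]
    (hirr : LieModule.IsIrreducible ℂ Alg V) (htriv : ¬ LieModule.IsTrivial Alg V) (φ : M →ₗ⁅ℂ,Alg⁆ V) (hφ : Function.Surjective φ) :
    IsNontrivialSimpleSubquotient V M := by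
  let ψ : (⊤ : LieSubmodule ℂ Alg M) →ₗ⁅ℂ,Alg⁆ V := φ.comp (LieSubmodule.incl ⊤)
  have hψ : Function.Surjective ψ := fun x => by
    obtain ⟨m, rfl⟩ := hφ x
    exact ⟨⟨m, trivial⟩, rfl⟩
  have hker : ψ.ker.toSubmodule = LinearMap.ker (ψ : (⊤ : LieSubmodule ℂ Alg M) →ₗ[ℂ] V) :=
    LieModuleHom.ker_toSubmodule ψ
  let χ : ((⊤ : LieSubmodule ℂ Alg M) ⧸ ψ.ker) →ₗ⁅ℂ,Alg⁆ V :=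
    { toLinearMap := ψ.ker.toSubmodule.liftQ (ψ : (⊤ : LieSubmodule ℂ Alg M) →ₗ[ℂ] V) hker.le
      map_lie' := fun {x m} => by
        induction m using Submodule.Quotient.induction_on with
        | _ m => exact LieModuleHom.map_lie ψ x m }
  have hχ : Function.Bijective χ := by
    constructor
    · refine (injective_iff_map_eq_zero χ).2 fun m hm => ?_
      induction m using Submodule.Quotient.induction_on with
      | _ m => exact (Submodule.Quotient.mk_eq_zero _).2 hm
    · intro x
      obtain ⟨m, rfl⟩ := hψ x
      exact ⟨LieSubmodule.Quotient.mk m, rfl⟩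
  let e := (equivOfBijective χ hχ).symm
  refine ⟨⊤, ψ.ker, isIrreducible_of_equiv e hirr, fun ht => htriv ⟨fun x m => ?_⟩, ⟨e⟩⟩
  apply e.injective
  have : e ⁅x, m⁆ = ⁅x, e m⁆ := LieModuleHom.map_lie e.toLieModuleHom x m
  rw [this, ht.trivial]
  exact (map_zero e.toLieModuleHom).symm

variable {V : Type u} [AddCommGroup V] [Module ℂ V] [LieRingModule Alg V] [LieModule ℂ Alg V]

/-- A family of eigenvectors of `L(0)` inside a submodule: the components of a finite sum. -/
theorem mem_of_sum_mem {w : ℤ → V} {μ : ℂ}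
    (hw : ∀ t : ℤ, w t ∈ weightSpace V (μ + t)) (N : LieSubmodule ℂ Alg V) (s : Finset ℤ) :
    ∀ a : ℤ → ℂ, ∑ t ∈ s, a t • w t ∈ N → ∀ t ∈ s, a t • w t ∈ N := by
  induction s using Finset.induction_on with
  | empty => intro a _ t ht; simp at ht
  | insert t₀ s ht₀ ih =>
    intro a ha
    -- Applying `L(0) - (μ + t₀)` removes the `t₀` summand and multiplies the others by nonzero
    -- factors, so the induction hypothesis applies to a shorter sum.
    have h1 : ∑ t ∈ s, (((t : ℂ) - t₀) * a t) • w t ∈ N := by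
      have h2 := sub_mem (N.lie_mem (x := mono (.L 0) 1) ha)
        (N.smul_mem (μ + t₀) ha)
      convert h2 using 1
      have h3 (t : ℤ) : ⁅mono (.L 0) 1, a t • w t⁆ - (μ + t₀) • a t • w t
          = (((t : ℂ) - t₀) * a t) • w t := by
        rw [lie_smul, mem_weightSpace.1 (hw t), smul_smul, smul_smul, ← sub_smul]
        congr 1; ring
      rw [lie_sum, Finset.smul_sum, ← Finset.sum_sub_distrib, Finset.sum_insert ht₀,
        h3, sub_self, zero_mul, zero_smul, zero_add]
      rw [Finset.sum_congr rfl fun t _ => h3 t]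
      rfl
    have h3 : ∀ t ∈ s, a t • w t ∈ N := fun t ht => by
      have := ih _ h1 t ht
      rw [mul_smul] at this
      have h0 : (t : ℂ) - t₀ ≠ 0 := by
        rw [sub_ne_zero]
        intro e
        have : t = t₀ := by exact_mod_cast e
        exact ht₀ (this ▸ ht)
      have := N.smul_mem ((t : ℂ) - t₀)⁻¹ this
      rwa [smul_smul, inv_mul_cancel₀ h0, one_smul] at this
    intro t ht
    rcases Finset.mem_insert.1 ht with rfl | ht
    · rw [Finset.sum_insert ht₀] at ha
      have := sub_mem ha (sum_mem h3)
      rwa [add_sub_cancel_right] at this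
    · exact h3 t ht

namespace Realization

variable {D : HVSystem} {v : ℤ → V}

theorem exists_mem_of_ne_bot (R : Realization D v) (hW : IsWeightModule V)
    {N : LieSubmodule ℂ Alg V} (hN : N ≠ ⊥) : ∃ t ∈ D.S, v t ∈ N := by
  obtain ⟨x, hx, hx0⟩ : ∃ x ∈ N, x ≠ 0 := by
    by_contra! h
    exact hN ((LieSubmodule.eq_bot_iff N).2 h)
  obtain ⟨c, rfl⟩ : ∃ c : ℤ →₀ ℂ, Finsupp.linearCombination ℂ v c = x := by
    rw [← LinearMap.mem_range, Finsupp.range_linearCombination, R.span hW]; trivial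
  rw [Finsupp.linearCombination_apply, Finsupp.sum] at hx hx0
  have h := mem_of_sum_mem R.mem N c.support c hx
  by_contra! hcon
  refine hx0 (Finset.sum_eq_zero fun t ht => ?_)
  have h1 := N.smul_mem (c t)⁻¹ (h t ht)
  rw [smul_smul, inv_mul_cancel₀ (Finsupp.mem_support_iff.1 ht), one_smul] at h1
  by_cases htS : t ∈ D.S
  · exact absurd h1 (hcon t htS)
  · have := (R.ne_zero t).not.2 htS
    rw [not_not.1 this, smul_zero]

theorem lie_eq_zero_of_forall (R : Realization D v) (hW : IsWeightModule V) {x : Alg}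
    (h : ∀ t, ⁅x, v t⁆ = 0) (m : V) : ⁅x, m⁆ = 0 := by
  have hm : m ∈ Submodule.span ℂ (Set.range v) := by rw [R.span hW]; trivial
  induction hm using Submodule.span_induction with
  | mem _ hx => obtain ⟨t, rfl⟩ := hx; exact h t
  | zero => exact lie_zero _
  | add _ _ _ _ h1 h2 => rw [_root_.lie_add, h1, h2, add_zero]
  | smul a _ _ h1 => rw [lie_smul, h1, smul_zero]

theorem isTrivial (R : Realization D v) (hW : IsWeightModule V) (hS : D.S = {0}) (hc : D.c = 0)
    (hz : D.z = 0) (hk : D.k = 0) (hℓ : D.ℓ 0 0 = 0) (hf : D.f 0 0 = 0) :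
    LieModule.IsTrivial Alg V := by
  have hv : ∀ t ≠ 0, v t = 0 := fun t ht => by
    by_contra h
    have := (R.ne_zero t).1 h
    rw [hS] at this
    exact ht this
  refine ⟨fun x m => ?_⟩
  induction x using alg_induction with
  | h0 => rw [zero_lie]
  | ha a b h1 h2 => rw [_root_.add_lie, h1, h2, add_zero]
  | hs g z =>
    rw [mono_eq_smul, smul_lie]
    suffices ⁅mono g 1, m⁆ = 0 by rw [this, smul_zero]
    rcases g with n | n | _ | _ | _
    · refine R.lie_eq_zero_of_forall hW (fun t => ?_) m
      rw [R.L]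
      by_cases ht : t = 0
      · subst ht
        by_cases hn : n = 0
        · rw [hn, hℓ, zero_smul]
        · rw [hv (n + 0) (by simpa using hn), smul_zero]
      · rw [D.source n t (by rw [hS]; exact ht), zero_smul]
    · refine R.lie_eq_zero_of_forall hW (fun t => ?_) m
      rw [R.I]
      by_cases ht : t = 0
      · subst ht
        by_cases hn : n = 0
        · rw [hn, hf, zero_smul]
        · rw [hv (n + 0) (by simpa using hn), smul_zero]
      · rw [D.f_source n t (by rw [hS]; exact ht), zero_smul]
    · rw [R.CL, hc, zero_smul]
    · rw [R.CI, hk, zero_smul]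
    · rw [R.CLI, hz, zero_smul]

theorem nonempty_equiv (R : Realization D v) (hW : IsWeightModule V) {p : Param}
    (h : D.IsModel p) : Nonempty (V ≃ₗ⁅ℂ,Alg⁆ Series p) := by
  obtain ⟨hS, hc, hz, hk, s, hs, h1, h2⟩ := h
  have R' := R.rescale s hs
  let φ := homOfFamily p.coeffs (fun t => s t • v t)
    (fun n t => by rw [lie_smul, R.L, smul_smul, smul_smul, mul_comm, h1, mul_comm])
    (fun n t => by rw [lie_smul, R.I, smul_smul, smul_smul, mul_comm, h2, mul_comm])
    (fun x => by rw [R.CL, hc, zero_smul]) (fun x => by rw [R.CI, hk, zero_smul])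
    (fun x => by rw [R.CLI, hz, zero_smul])
  refine ⟨(equivOfBijective φ ⟨?_, ?_⟩).symm⟩
  · exact R'.linearIndependent hS
  · exact LinearMap.range_eq_top.1 ((Finsupp.range_linearCombination ℂ).trans (R'.span hW))

/-- Without arrows into or out of `v_0`, the weight set `{0}` is neither left nor entered. Both it
and its complement carry nonzero vectors, contradicting indecomposability. -/
theorem not_split (R : Realization D v) (hI : IsIndecomposable V) (hW : IsWeightModule V)
    (hw : D.wt = 0) (hS : ∀ t, t ∈ D.S)
    (h : ∀ n : ℤ, D.ℓ n 0 = 0 ∧ D.f n 0 = 0 ∧ D.ℓ n (-n) = 0 ∧ D.f n (-n) = 0) : False := by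
  have hne : ∀ t : ℤ, weightSpace V (t : ℂ) ≠ ⊥ := fun t e => by
    have := R.mem t
    rw [hw, zero_add, e, Submodule.mem_bot] at this
    exact (R.ne_zero t).2 (hS t) this
  have key : ∀ (n t : ℤ), D.ℓ n t ≠ 0 ∨ D.f n t ≠ 0 → (t = 0 ↔ n + t = 0) := by
    intro n t hnt
    constructor
    · rintro rfl
      exact absurd hnt (by simp [(h n).1, (h n).2.1])
    · intro e
      obtain rfl : t = -n := by lia
      exact absurd hnt (by simp [(h n).2.2.1, (h n).2.2.2])
  rcases weights_of_indecomposable hI hW {0} (fun g μ w hwμ hg => by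
    have hμ : weightSpace V μ ≠ ⊥ := by
      rw [Submodule.ne_bot_iff]
      exact ⟨w, hwμ, fun e => hg (by rw [e, lie_zero])⟩
    obtain ⟨t, rfl⟩ := R.weight μ hμ
    obtain ⟨a, rfl⟩ := R.gen t w hwμ
    rw [lie_smul] at hg
    have hg := (smul_ne_zero_iff.1 hg).2
    rw [hw, zero_add, Set.mem_singleton_iff, Set.mem_singleton_iff]
    have main : ∀ n : ℤ, D.ℓ n t ≠ 0 ∨ D.f n t ≠ 0 → ((t : ℂ) = 0 ↔ (t : ℂ) + n = 0) := by
      intro n hn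
      have := key n t hn
      rw [add_comm] at this
      exact_mod_cast this
    rcases g with n | n | _ | _ | _
    · rw [R.L] at hg
      exact main n (Or.inl (smul_ne_zero_iff.1 hg).1)
    · rw [R.I] at hg
      exact main n (Or.inr (smul_ne_zero_iff.1 hg).1)
    all_goals simp [Gen.deg]) with h' | h'
  · exact hne 0 (by simpa using h' 0 rfl)
  · exact hne 1 (h' _ (by simp))

/-- The simple quotient of `A_{0,0,0}`. -/
theorem punctured (R : Realization D v) (hI : IsIndecomposable V) (hW : IsWeightModule V)
    (h : D.PuncturedForm) (h0 : (0 : ℤ) ∉ D.S) :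
    LieModule.IsIrreducible ℂ Alg V ∧ ∃ φ : Series (.A 0 0 0) →ₗ⁅ℂ,Alg⁆ V,
      Function.Surjective φ := by
  have hc₀ := h.c₀_eq_zero h0
  obtain ⟨hz, hk, -⟩ := h.f_pos
  have hv0 : v 0 = 0 := not_not.1 ((R.ne_zero 0).not.2 h0)
  -- Because `v 0 = 0`, the formulas of `A_{0,0,0}` hold at every index, including arrows that start
  -- or end at `v 0`.
  have hL : ∀ n t : ℤ, ⁅mono (.L n) 1, v t⁆ = (t : ℂ) • v (n + t) := by
    intro n t
    by_cases ht : t = 0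
    · rw [ht, hv0, lie_zero]; simp
    by_cases hnt : n + t = 0
    · rw [R.L, hnt, hv0, smul_zero, smul_zero]
    · rw [R.L, h.ℓ n t ht hnt]
  have hIn : ∀ n t : ℤ, ⁅mono (.I n) 1, v t⁆ = 0 := by
    intro n t
    by_cases ht : t = 0
    · rw [ht, hv0, lie_zero]
    by_cases hnt : n + t = 0
    · rw [R.I, hnt, hv0, smul_zero]
    · rw [R.I, h.f_eq_zero hc₀ n t ht hnt, zero_smul]
  constructor
  · have := hI.1
    refine LieModule.IsIrreducible.mk fun N hN => ?_
    obtain ⟨t, ht, htN⟩ := R.exists_mem_of_ne_bot hW hN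
    have ht0 : (t : ℂ) ≠ 0 := by
      intro e
      have : t = 0 := by exact_mod_cast e
      exact h0 (this ▸ ht)
    rw [← LieSubmodule.toSubmodule_eq_top, eq_top_iff, ← R.span hW, Submodule.span_le]
    rintro _ ⟨r, rfl⟩
    -- `L(r - t)` takes `v t` to `t • v r` with `t ≠ 0`, so a single basis vector generates the
    -- whole module.
    have := N.smul_mem (t : ℂ)⁻¹ (N.lie_mem (x := mono (.L (r - t)) 1) htN)
    rwa [hL, smul_smul, inv_mul_cancel₀ ht0, one_smul, sub_add_cancel] at this
  · refine ⟨homOfFamily _ v (fun n t => ?_) (fun n t => ?_) (fun x => by rw [R.CL, h.c, zero_smul])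
      (fun x => by rw [R.CI, hk, zero_smul]) (fun x => by rw [R.CLI, hz, zero_smul]), ?_⟩
    · rw [hL]; simp [Param.coeffs, coeffsA]
    · rw [hIn]; simp [Param.coeffs, coeffsA]
    · exact LinearMap.range_eq_top.1 ((Finsupp.range_linearCombination ℂ).trans (R.span hW))

end Realization

end TwistedHV

end

theorem theorem3p6 (V : Type*) [AddCommGroup V] [Module ℂ V] [LieRingModule TwistedHV.Alg V]
    [LieModule ℂ TwistedHV.Alg V] (hV : TwistedHV.IsIntermediateSeries V) :
    (LieModule.IsIrreducible ℂ TwistedHV.Alg V →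
      (∃ p : TwistedHV.Param, LieModule.IsIrreducible ℂ TwistedHV.Alg (TwistedHV.Series p) ∧
        Nonempty (V ≃ₗ⁅ℂ,TwistedHV.Alg⁆ TwistedHV.Series p)) ∨
      (∃ p : TwistedHV.Param,
        TwistedHV.IsNontrivialSimpleSubquotient V (TwistedHV.Series p))) ∧
    (¬ LieModule.IsIrreducible ℂ TwistedHV.Alg V →
      ∃ p : TwistedHV.Param, Nonempty (V ≃ₗ⁅ℂ,TwistedHV.Alg⁆ TwistedHV.Series p)) := by
  obtain ⟨D, v, hne, R⟩ := TwistedHV.exists_realization hV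
  obtain ⟨⟨hI, hW, -⟩, htriv, -⟩ := hV
  -- Nontriviality of the action excludes the first case and indecomposability the last. The third
  -- case is always irreducible and supplies the subquotient; in the second case the listed module
  -- inherits irreducibility from `V` when needed.
  rcases TwistedHV.HVSystem.classify hne with
    ⟨hS, hc, hz, hk, hℓ, hf⟩ | ⟨p, hp⟩ | ⟨s, hs, h, h0⟩ | ⟨s, hs, h, h0, h'⟩
  · exact absurd (R.isTrivial hW hS hc hz hk hℓ hf) htriv
  · obtain ⟨e⟩ := R.nonempty_equiv hW hp
    exact ⟨fun hirr => Or.inl ⟨p, TwistedHV.isIrreducible_of_equiv e hirr, ⟨e⟩⟩,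
      fun _ => ⟨p, ⟨e⟩⟩⟩
  · obtain ⟨hirr, φ, hφ⟩ := (R.rescale s hs).punctured hI hW h h0
    exact ⟨fun _ => Or.inr ⟨_,
      TwistedHV.isNontrivialSimpleSubquotient_of_surjective hirr htriv φ hφ⟩,
      fun hn => absurd hirr hn⟩
  · exact (R.not_split hI hW h.wt (fun t => by
      have := h.univ h0
      change D.S = _ at this
      rw [this]; trivial) h').elim
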